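/- Let $k$ be a field and let $H=(H,\Delta,\varepsilon,\phi,S,\alpha,\beta)$ be a quasi-Hopf algebra over $k$ with bijective antipode $S$, normalized by $\varepsilon(\alpha)=\varepsilon(\beta)=1$. (So $\Delta,\varepsilon$ are algebra maps, $\phi\in H^{\otimes 3}$ is invertible, $S$ is an anti-algebra map, and for all $h\in H$: $(\mathrm{id}\otimes\Delta)\Delta(h)=\phi\,(\Delta\otimes\mathrm{id})\Delta(h)\,\phi^{-1}$; $\ \varepsilon(h_{(1)})h_{(2)}=h=h_{(1)}\varepsilon(h_{(2)})$; $\ (\mathrm{id}\otimes\mathrm{id}\otimes\Delta)(\phi)(\Delta\otimes\mathrm{id}\otimes\mathrm{id})(\phi)=(1\otimes\phi)(\mathrm{id}\otimes\Delta\otimes\mathrm{id})(\phi)(\phi\otimes1)$; $\ (\mathrm{id}\otimes\varepsilon\otimes\mathrm{id})(\phi)=1\otimes1$; $\ S(h_{(1)})\alpha h_{(2)}=\varepsilon(h)\alpha$, $\ h_{(1)}\beta S(h_{(2)})=\varepsilon(h)\beta$; $\ \phi_1\beta S(\phi_2)\alpha\phi_3=1=S(\bar\phi_1)\alpha\bar\phi_2\beta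 S(\bar\phi_3)$.) *Notation.* Write $\phi=\phi_1\otimes\phi_2\otimes\phi_3$, $\phi^{-1}=\bar\phi_1\otimes\bar\phi_2\otimes\bar\phi_3$ (sums suppressed), $\phi'=\phi$ for a second copy, $\Delta(h)=h_{(1)}\otimes h_{(2)}$, $\Delta(h_{(1)})\otimes h_{(2)}=h_{(1,1)}\otimes h_{(1,2)}\otimes h_{(2)}$, $\Delta^{\mathrm{cop}}(h)=h_{(2)}\otimes h_{(1)}$. Put $$p^R=\bar\phi_1\otimes\bar\phi_2\beta S(\bar\phi_3),\quad q^R=\phi_1\otimes S^{-1}(\alpha\phi_3)\phi_2,\quad q^L=S(\bar\phi_1)\alpha\bar\phi_2\otimes\bar\phi_3,$$ $$\mathbf a=S(\bar\phi_1\phi_2)\alpha\bar\phi_2\phi_{3(1)}\otimes S(\phi_1)\alpha\bar\phi_3\phi_{3(2)},\quad \mathbf b=\phi_{1(1)}\bar\phi_1\beta S(\phi_3)\otimes\phi_{1(2)}\bar\phi_2\beta S(\phi_2\bar\phi_3),$$ and let $f=(S\otimes S)(\Delta^{\mathrm{cop}}(p^R_1))\,\mathbf a\,\Delta(p^R_2)$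 be Drinfeld's gauge transformation; it is invertible with inverse $\bar f_1\otimes\bar f_2=f^{-1}=\Delta(q^L_1)\,\mathbf b\,(S\otimes S)(\Delta^{\mathrm{cop}}(q^L_2))$. Put $\chi=(\phi\otimes1)(\Delta\otimes\mathrm{id}\otimes\mathrm{id})(\phi^{-1})$ and $\omega=(1\otimes1\otimes1\otimes\bar f_2\otimes\bar f_1)(\mathrm{id}\otimes\Delta\otimes S\otimes S)(\chi)(\phi\otimes1\otimes1)\in H^{\otimes5}$. *Yetter–Drinfeld modules.* A Yetter–Drinfeld module is a left $H$-module $V$ with two linear maps $V\to H\otimes V$, the coactions of the first kind $\delta^{1}(v)=v_{[-1]}\otimes v_{[0]}$ and of the second kind $\delta^{2}(v)=v_{\{-1\}}\otimes v_{\{0\}}$, such that $\varepsilon(v_{[-1]})v_{[0]}=v=\varepsilon(v_{\{-1\}})v_{\{0\}}$ and, for all $h\in H$, $v\in V$, $$\phi_1v_{[-1]}\otimes(\phi_2v_{[0]})_{[-1]}\phi_3\otimes(\phi_2v_{[0]})_{[0]}=\phi'_1(\phi_1v)_{[-1](1)}\phi_2\otimes\phi'_2(\phi_1v)_{[-1](2)}\phi_3\otimes\phi'_3(\phi_1v)_{[0]},$$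 $$h_{(1)}v_{[-1]}\otimes h_{(2)}v_{[0]}=(h_{(1)}v)_{[-1]}h_{(2)}\otimes(h_{(1)}v)_{[0]},$$ $$v_{\{-1\}}\otimes\delta^{2}(v_{\{0\}})=\omega_1v_{\{-1\}(1)}\omega_5\otimes\omega_2v_{\{-1\}(2)}\omega_4\otimes\omega_3v_{\{0\}},\qquad \delta^{2}(hv)=h_{(1,1)}v_{\{-1\}}S(h_{(2)})\otimes h_{(1,2)}v_{\{0\}},$$ and which determine each other by $$\delta^{2}(v)=(p^R_1v)_{[-1]}p^R_2\otimes(p^R_1v)_{[0]},\qquad \delta^{1}(v)=q^R_{1(1)}v_{\{-1\}}S(q^R_2)\otimes q^R_{1(2)}v_{\{0\}}.$$ Morphisms are the linear maps that preserve the action and the coactions. The tensor product $V\otimes W$ has the action $h(v\otimes w)=h_{(1)}v\otimes h_{(2)}w$ and the first-kind coaction $$v\otimes w\mapsto\phi_1(\bar\phi_1\phi'_1v)_{[-1]}\bar\phi_2(\phi'_2w)_{[-1]}\phi'_3\otimes\phi_2(\bar\phi_1\phi'_1v)_{[0]}\otimes\phi_3\bar\phi_3(\phi'_2w)_{[0]},$$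 the associator is the action of $\phi$, and the unit object is $\mathbb 1=k$, on which $h\in H$ acts by $\varepsilon(h)$, with $\delta^1(1)=1\otimes1$. *The functor $R$ and the algebra $\mathbf A$.* For a left $H$-module $V$ let $R(V)=H\otimes V$ with $h\triangleright(a\otimes v)=h_{(1,1)}aS(h_{(2)})\otimes h_{(1,2)}v$, second-kind coaction $a\otimes v\mapsto\omega_1a_{(1)}\omega_5\otimes\omega_2a_{(2)}\omega_4\otimes\omega_3v$ and the corresponding first-kind coaction. $R$ is right adjoint to the functor $F$ forgetting the coactions, with unit $\eta_M=\delta^2_M$ and counit $\varepsilon_V(a\otimes v)=\varepsilon(a)v$, and hence is monoidal by $R^{(0)}=\eta_{\mathbb 1}$, $R^{(2)}_{V,W}=R(\varepsilon_V\otimes\varepsilon_W)\circ\eta_{R(V)\otimes R(W)}$. Let $\mathbf A=R(\mathbb 1)$ with multiplication $R(\mathbb 1)\otimes R(\mathbb 1)\xrightarrow{R^{(2)}}R(\mathbb 1\otimes\mathbb 1)\cong R(\mathbb 1)$ and unit $R^{(0)}$, and identify $\mathbf A=H\otimes k$ with $H$ as a vector space. **Theorem.** $\mathbf A$ is an algebra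 in the category of Yetter–Drinfeld modules (its multiplication and its unit are morphisms, and it is associative up to the associator and unital). Together with $\varepsilon:\mathbf A\to\mathbb 1$ it is the value at $\mathbb 1$ of the right adjoint of $F$: for every Yetter–Drinfeld module $M$ and every $H$-linear map $g:M\to\mathbb 1$ there is a unique morphism $G:M\to\mathbf A$ of Yetter–Drinfeld modules with $\varepsilon\circ G=g$. Its action, its coactions of the first and of the second kind, its multiplication and its unit are, for $a,b\in\mathbf A=H$ and $h\in H$, $$h\triangleright a=h_{(1)}aS(h_{(2)}),$$ $$\delta^{1}_{\mathbf A}(a)=\phi_1\phi'_{1(1)}a_{(1)}\bar f_1S(q^R_2\phi'_{2(2)})\phi'_3\otimes\phi_2\phi'_{1(2)}a_{(2)}\bar f_2S(\phi_3q^R_1\phi'_{2(1)}),$$ $$\delta^{2}_{\mathbf A}(a)=\phi_1\bar\phi_{1(1)}a_{(1)}\bar f_1S(\bar\phi_3)\otimes\phi_2\bar\phi_{1(2)}a_{(2)}\bar f_2S(\phi_3\bar\phi_2),$$ $$a\star b=\phi_1aS(\bar\phi_1\phi_2)\alpha\bar\phi_2\phi_{3(1)}bS(\bar\phi_3\phi_{3(2)}),\qquad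 1_{\mathbf A}=\beta.$$ In particular $\mathbf A$ coincides with the algebra $H_0$ of Bulacu, Caenepeel and Panaite, that is, the vector space $H$ with the above action, first-kind coaction, multiplication $\star$ and unit $\beta$, with the second-kind coaction that corresponds to this first-kind coaction. -/

import Mathlib

open scoped TensorProduct

universe u v w

noncomputable section

namespace QHopf

section Contractions

variable {k : Type u} {H : Type v} [Field k] [Ring H] [Algebra k H]

/-- An algebra anti-automorphism `s`, viewed as a linear endomorphism. -/
def antiLin (s : H ≃ₐ[k] Hᵐᵒᵖ) : H →ₗ[k] H :=
  (MulOpposite.opLinearEquiv k).symm.toLinearMap ∘ₗ s.toLinearMap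

/-- `x ⊗ y ↦ S(x) α y`. -/
def contrA (S : H →ₗ[k] H) (α : H) : H ⊗[k] H →ₗ[k] H :=
  LinearMap.mul' k H ∘ₗ TensorProduct.map (LinearMap.mulRight k α ∘ₗ S) LinearMap.id

/-- `x ⊗ y ↦ x β S(y)`. -/
def contrB (S : H →ₗ[k] H) (β : H) : H ⊗[k] H →ₗ[k] H :=
  LinearMap.mul' k H ∘ₗ TensorProduct.map (LinearMap.mulRight k β) S

theorem contrA_tmul (S : H →ₗ[k] H) (α x y : H) : contrA S α (x ⊗ₜ[k] y) = S x * α * y := by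
  simp [contrA]

theorem contrB_tmul (S : H →ₗ[k] H) (β x y : H) : contrB S β (x ⊗ₜ[k] y) = x * β * S y := by
  simp [contrB]

end Contractions

/-- A quasi-Hopf algebra structure, with bijective antipode and `ε(α) = ε(β) = 1`, on the
associative unital `k`-algebra `H`.  Iterated tensor powers of `H` are nested to the right. -/
structure QuasiHopfAlgebra (k : Type u) (H : Type v) [Field k] [Ring H] [Algebra k H] where
  /-- the comultiplication `Δ` -/
  comul : H →ₐ[k] H ⊗[k] H
  /-- the counit `ε` -/
  counit : H →ₐ[k] k
  /-- the associator `φ` -/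
  phi : (H ⊗[k] (H ⊗[k] H))ˣ
  /-- the antipode, a bijective algebra anti-homomorphism -/
  antipode : H ≃ₐ[k] Hᵐᵒᵖ
  alpha : H
  beta : H
  /-- `(id ⊗ Δ)(Δ(h)) = φ (Δ ⊗ id)(Δ(h)) φ⁻¹` -/
  quasi_coassoc : ∀ h : H,
    TensorProduct.map LinearMap.id comul.toLinearMap (comul h) =
      phi.val * TensorProduct.assoc k H H H
        (TensorProduct.map comul.toLinearMap LinearMap.id (comul h)) * phi.inv
  /-- `ε(h₁) h₂ = h` -/
  counit_left : ∀ h : H,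
    TensorProduct.lid k H (TensorProduct.map counit.toLinearMap LinearMap.id (comul h)) = h
  /-- `h₁ ε(h₂) = h` -/
  counit_right : ∀ h : H,
    TensorProduct.rid k H (TensorProduct.map LinearMap.id counit.toLinearMap (comul h)) = h
  /-- `(id ⊗ id ⊗ Δ)(φ) (Δ ⊗ id ⊗ id)(φ) = (1 ⊗ φ) (id ⊗ Δ ⊗ id)(φ) (φ ⊗ 1)` -/
  pentagon :
    TensorProduct.map LinearMap.id (TensorProduct.map LinearMap.id comul.toLinearMap) phi.val *
      TensorProduct.assoc k H H (H ⊗[k] H)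
        (TensorProduct.map comul.toLinearMap LinearMap.id phi.val) =
    ((1 : H) ⊗ₜ[k] phi.val) *
      TensorProduct.map LinearMap.id
        ((TensorProduct.assoc k H H H).toLinearMap ∘ₗ
          TensorProduct.map comul.toLinearMap LinearMap.id) phi.val *
      TensorProduct.map LinearMap.id (TensorProduct.assoc k H H H).toLinearMap
        (TensorProduct.assoc k H (H ⊗[k] H) H (phi.val ⊗ₜ[k] (1 : H)))
  /-- `(id ⊗ ε ⊗ id)(φ) = 1 ⊗ 1` -/
  counit_phi :
    TensorProduct.map LinearMap.id
      ((TensorProduct.lid k H).toLinearMap ∘ₗ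
        TensorProduct.map counit.toLinearMap LinearMap.id) phi.val = (1 : H) ⊗ₜ[k] (1 : H)
  /-- `S(h₁) α h₂ = ε(h) α` -/
  antipode_alpha : ∀ h : H, contrA (antiLin antipode) alpha (comul h) = counit h • alpha
  /-- `h₁ β S(h₂) = ε(h) β` -/
  antipode_beta : ∀ h : H, contrB (antiLin antipode) beta (comul h) = counit h • beta
  /-- `φ₁ β S(φ₂) α φ₃ = 1` -/
  phi_antipode :
    LinearMap.mul' k H (TensorProduct.map (LinearMap.mulRight k beta)
      (contrA (antiLin antipode) alpha) phi.val) = 1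
  /-- `S(φ̄₁) α φ̄₂ β S(φ̄₃) = 1`, where `φ̄ = φ⁻¹` -/
  phi_inv_antipode :
    LinearMap.mul' k H (TensorProduct.map
      (LinearMap.mulRight k alpha ∘ₗ antiLin antipode)
      (contrB (antiLin antipode) beta) phi.inv) = 1
  counit_alpha : counit alpha = 1
  counit_beta : counit beta = 1

/-- The external tensor product of two representations:
`(a ⊗ b) • (v ⊗ w) = a v ⊗ b w`. -/
def boxAct {k : Type*} [Field k] {A B V W : Type*} [Ring A] [Algebra k A] [Ring B] [Algebra k B]
    [AddCommGroup V] [Module k V] [AddCommGroup W] [Module k W]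
    (σ : A →ₐ[k] Module.End k V) (τ : B →ₐ[k] Module.End k W) :
    A ⊗[k] B →ₐ[k] Module.End k (V ⊗[k] W) :=
  Module.endTensorEndAlgHom.comp (Algebra.TensorProduct.map σ τ)

theorem boxAct_tmul {k : Type*} [Field k] {A B V W : Type*} [Ring A] [Algebra k A] [Ring B]
    [Algebra k B] [AddCommGroup V] [Module k V] [AddCommGroup W] [Module k W]
    (σ : A →ₐ[k] Module.End k V) (τ : B →ₐ[k] Module.End k W) (a : A) (b : B) (x : V) (y : W) :
    boxAct σ τ (a ⊗ₜ[k] b) (x ⊗ₜ[k] y) = σ a x ⊗ₜ[k] τ b y := by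
  simp [boxAct, Module.endTensorEndAlgHom_apply]

namespace QuasiHopfAlgebra

variable {k : Type u} {H : Type v} [Field k] [Ring H] [Algebra k H] (Q : QuasiHopfAlgebra k H)

/-- The comultiplication as a linear map. -/
def Δ : H →ₗ[k] H ⊗[k] H := Q.comul.toLinearMap

/-- The counit as a linear map. -/
def ε : H →ₗ[k] k := Q.counit.toLinearMap

/-- The antipode as a linear map. -/
def S : H →ₗ[k] H := antiLin Q.antipode

/-- The inverse of the antipode as a linear map. -/
def Sinv : H →ₗ[k] H :=
  Q.antipode.symm.toLinearMap ∘ₗ (MulOpposite.opLinearEquiv k).toLinearMap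

/-- `φ⁻¹` -/
def phiInv : H ⊗[k] (H ⊗[k] H) := Q.phi.inv

/-- `pᴿ = φ̄₁ ⊗ φ̄₂ β S(φ̄₃)` -/
def pR : H ⊗[k] H := TensorProduct.map LinearMap.id (contrB Q.S Q.beta) Q.phiInv

/-- `qᴿ = φ₁ ⊗ S⁻¹(α φ₃) φ₂` -/
def qR : H ⊗[k] H :=
  TensorProduct.map LinearMap.id
    (LinearMap.mul' k H ∘ₗ (TensorProduct.comm k H H).toLinearMap ∘ₗ
      TensorProduct.map LinearMap.id (Q.Sinv ∘ₗ LinearMap.mulLeft k Q.alpha)) Q.phi.val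

/-- `qᴸ = S(φ̄₁) α φ̄₂ ⊗ φ̄₃` -/
def qL : H ⊗[k] H :=
  TensorProduct.map (contrA Q.S Q.alpha) LinearMap.id ((TensorProduct.assoc k H H H).symm Q.phiInv)

/-- `t ⊗ 1 ∈ H^{⊗4}` for `t ∈ H^{⊗3}` -/
def pad (t : H ⊗[k] (H ⊗[k] H)) : H ⊗[k] (H ⊗[k] (H ⊗[k] H)) :=
  TensorProduct.map LinearMap.id (TensorProduct.assoc k H H H).toLinearMap
    (TensorProduct.assoc k H (H ⊗[k] H) H (t ⊗ₜ[k] (1 : H)))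

/-- `(Δ ⊗ id ⊗ id)(t)` -/
def Δ1 (t : H ⊗[k] (H ⊗[k] H)) : H ⊗[k] (H ⊗[k] (H ⊗[k] H)) :=
  TensorProduct.assoc k H H (H ⊗[k] H) (TensorProduct.map Q.Δ LinearMap.id t)

/-- `(id ⊗ id ⊗ Δ)(t)` -/
def Δ3 (t : H ⊗[k] (H ⊗[k] H)) : H ⊗[k] (H ⊗[k] (H ⊗[k] H)) :=
  TensorProduct.map LinearMap.id (TensorProduct.map LinearMap.id Q.Δ) t

/-- `x₁ ⊗ x₂ ⊗ x₃ ⊗ x₄ ↦ (x₁ ⊗ x₄) ⊗ (x₂ ⊗ x₃)` -/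
def outerInner : H ⊗[k] (H ⊗[k] (H ⊗[k] H)) ≃ₗ[k] (H ⊗[k] H) ⊗[k] (H ⊗[k] H) :=
  TensorProduct.congr (LinearEquiv.refl k H)
      ((TensorProduct.assoc k H H H).symm ≪≫ₗ TensorProduct.comm k (H ⊗[k] H) H) ≪≫ₗ
    (TensorProduct.assoc k H H (H ⊗[k] H)).symm

theorem outerInner_tmul (a b c d : H) :
    outerInner (k := k) (a ⊗ₜ[k] (b ⊗ₜ[k] (c ⊗ₜ[k] d))) =
      (a ⊗ₜ[k] d) ⊗ₜ[k] (b ⊗ₜ[k] c) := by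
  simp [outerInner]

/-- `φ₁ ⊗ φ̄₁ φ₂ ⊗ φ̄₂ φ₃₍₁₎ ⊗ φ̄₃ φ₃₍₂₎` -/
def tauA : H ⊗[k] (H ⊗[k] (H ⊗[k] H)) := ((1 : H) ⊗ₜ[k] Q.phiInv) * Q.Δ3 Q.phi.val

/-- `𝕒 = S(φ̄₁ φ₂) α φ̄₂ φ₃₍₁₎ ⊗ S(φ₁) α φ̄₃ φ₃₍₂₎` -/
def aElt : H ⊗[k] H :=
  TensorProduct.map (contrA Q.S Q.alpha) (contrA Q.S Q.alpha)
    (TensorProduct.comm k (H ⊗[k] H) (H ⊗[k] H) (outerInner Q.tauA))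

/-- `𝕓 = φ₁₍₁₎ φ̄₁ β S(φ₃) ⊗ φ₁₍₂₎ φ̄₂ β S(φ₂ φ̄₃)` -/
def bElt : H ⊗[k] H :=
  TensorProduct.map (contrB Q.S Q.beta) (contrB Q.S Q.beta)
    (outerInner (Q.Δ1 Q.phi.val * pad Q.phiInv))

/-- `(S ⊗ S) Δᶜᵒᵖ` -/
def SSΔcop : H →ₗ[k] H ⊗[k] H :=
  TensorProduct.map Q.S Q.S ∘ₗ (TensorProduct.comm k H H).toLinearMap ∘ₗ Q.Δ

/-- Drinfeld's gauge transformation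
`𝕗 = (S ⊗ S)(Δᶜᵒᵖ(pᴿ₁)) 𝕒 Δ(pᴿ₂)`. -/
def drinfeldTwist : H ⊗[k] H :=
  LinearMap.mul' k (H ⊗[k] H)
    (TensorProduct.map (LinearMap.mulRight k Q.aElt ∘ₗ Q.SSΔcop) Q.Δ Q.pR)

/-- The inverse of Drinfeld's gauge transformation, by the formula
`𝕗⁻¹ = Δ(qᴸ₁) 𝕓 (S ⊗ S)(Δᶜᵒᵖ(qᴸ₂))`. -/
def drinfeldTwistInv : H ⊗[k] H :=
  LinearMap.mul' k (H ⊗[k] H)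
    (TensorProduct.map (LinearMap.mulRight k Q.bElt ∘ₗ Q.Δ) Q.SSΔcop Q.qL)

/-- `χ = (φ ⊗ 1) (Δ ⊗ id ⊗ id)(φ⁻¹)` -/
def chi : H ⊗[k] (H ⊗[k] (H ⊗[k] H)) := pad Q.phi.val * Q.Δ1 Q.phiInv

/-- `ω = (1 ⊗ 1 ⊗ 1 ⊗ 𝕗̄₂ ⊗ 𝕗̄₁) (id ⊗ Δ ⊗ S ⊗ S)(χ) (φ ⊗ 1 ⊗ 1)`, where `H^{⊗5}` is bracketed
as `H^{⊗3} ⊗ H^{⊗2}`. -/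
def omega : (H ⊗[k] (H ⊗[k] H)) ⊗[k] (H ⊗[k] H) :=
  ((1 : H ⊗[k] (H ⊗[k] H)) ⊗ₜ[k] TensorProduct.comm k H H Q.drinfeldTwistInv) *
    TensorProduct.map (TensorProduct.map LinearMap.id Q.Δ) (TensorProduct.map Q.S Q.S)
      ((TensorProduct.assoc k H H (H ⊗[k] H)).symm Q.chi) *
    (Q.phi.val ⊗ₜ[k] (1 : H ⊗[k] H))

section Modules

/-! A left `H`-module with underlying `k`-space `V` is given by an algebra homomorphism
`ρ : H →ₐ[k] Module.End k V`. -/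

variable {V : Type*} [AddCommGroup V] [Module k V] {W : Type*} [AddCommGroup W] [Module k W]
variable (ρ : H →ₐ[k] Module.End k V) (σ : H →ₐ[k] Module.End k W)

/-- The left regular action of `H`. -/
abbrev lreg : H →ₐ[k] Module.End k H := Algebra.lmul k H

/-- The trivial module `k`: `h • c = ε(h) c`. -/
def trivAct : H →ₐ[k] Module.End k k := (Algebra.lmul k k).comp Q.counit

/-- The tensor product of `H`-modules: `h • (v ⊗ w) = h₁ v ⊗ h₂ w`. -/
def tensorAct : H →ₐ[k] Module.End k (V ⊗[k] W) := (boxAct ρ σ).comp Q.comul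

/-- The operator attached to `x ⊗ y ∈ H ⊗ H` that sends `v` to
`(x v)_[-1] y ⊗ (x v)_[0]`, where `δ(v) = v_[-1] ⊗ v_[0]`. -/
def coactTwist (δ : V →ₗ[k] H ⊗[k] V) : H ⊗[k] H →ₗ[k] V →ₗ[k] H ⊗[k] V :=
  TensorProduct.lift <| LinearMap.mk₂ k
    (fun x y => LinearMap.rTensor V (LinearMap.mulRight k y) ∘ₗ δ ∘ₗ ρ x)
    (by intro x x' y; simp [LinearMap.comp_add])
    (by intro c x y; simp [LinearMap.comp_smul])
    (by
      intro x y y'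
      have : LinearMap.mulRight k (y + y') = LinearMap.mulRight k y + LinearMap.mulRight k y' := by
        ext; simp [mul_add]
      rw [this, LinearMap.rTensor_add, LinearMap.add_comp])
    (by
      intro c x y
      have : LinearMap.mulRight k (c • y) = c • LinearMap.mulRight k y := by
        ext; simp
      rw [this, LinearMap.rTensor_smul, LinearMap.smul_comp])

theorem coactTwist_tmul (δ : V →ₗ[k] H ⊗[k] V) (x y : H) (m : V) :
    coactTwist ρ δ (x ⊗ₜ[k] y) m =
      LinearMap.rTensor V (LinearMap.mulRight k y) (δ (ρ x m)) := by
  simp [coactTwist]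

/-- The left-hand side of the coassociativity axiom of the first kind:
`v ↦ φ₁ v_[-1] ⊗ (φ₂ v_[0])_[-1] φ₃ ⊗ (φ₂ v_[0])_[0]`. -/
def yd1Left (δ : V →ₗ[k] H ⊗[k] V) (x : V) : H ⊗[k] (H ⊗[k] V) :=
  TensorProduct.homTensorHomMap (.id k) H V H (H ⊗[k] V)
    (TensorProduct.map (Algebra.lmul k H).toLinearMap (coactTwist ρ δ) Q.phi.val) (δ x)

/-- The operator attached to `x ⊗ t ∈ H ⊗ (H ⊗ H)` that sends `v` to
`(x v)_[-1](1) t₁ ⊗ (x v)_[-1](2) t₂ ⊗ (x v)_[0]`. -/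
def coactTwistΔ (δ : V →ₗ[k] H ⊗[k] V) :
    H ⊗[k] (H ⊗[k] H) →ₗ[k] V →ₗ[k] H ⊗[k] (H ⊗[k] V) :=
  TensorProduct.lift <| LinearMap.mk₂ k
    (fun x t => (TensorProduct.assoc k H H V).toLinearMap ∘ₗ
      LinearMap.rTensor V (LinearMap.mulRight k t ∘ₗ Q.Δ) ∘ₗ δ ∘ₗ ρ x)
    (by intro x x' y; simp [LinearMap.comp_add])
    (by intro c x y; simp [LinearMap.comp_smul])
    (by
      intro x y y'
      have : LinearMap.mulRight k (y + y') = LinearMap.mulRight k y + LinearMap.mulRight k y' := by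
        apply LinearMap.ext; intro z; simp [mul_add]
      rw [this, LinearMap.add_comp, LinearMap.rTensor_add, LinearMap.add_comp,
        LinearMap.comp_add])
    (by
      intro c x y
      have : LinearMap.mulRight k (c • y) = c • LinearMap.mulRight k y := by
        apply LinearMap.ext; intro z; simp
      rw [this, LinearMap.smul_comp, LinearMap.rTensor_smul, LinearMap.smul_comp,
        LinearMap.comp_smul])

/-- The right-hand side of the coassociativity axiom of the first kind:
`v ↦ φ'₁ (φ₁ v)_[-1](1) φ₂ ⊗ φ'₂ (φ₁ v)_[-1](2) φ₃ ⊗ φ'₃ (φ₁ v)_[0]` with `φ' = φ`. -/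
def yd1Right (δ : V →ₗ[k] H ⊗[k] V) (x : V) : H ⊗[k] (H ⊗[k] V) :=
  boxAct lreg (boxAct lreg ρ) Q.phi.val (Q.coactTwistΔ ρ δ Q.phi.val x)

/-- Yetter–Drinfeld modules of the first kind. -/
structure IsYD₁ (δ : V →ₗ[k] H ⊗[k] V) : Prop where
  coassoc : ∀ x : V, Q.yd1Left ρ δ x = Q.yd1Right ρ δ x
  /-- `ε(v_[-1]) v_[0] = v` -/
  counit : ∀ x : V, TensorProduct.lid k V (LinearMap.rTensor V Q.ε (δ x)) = x
  /-- `h₁ v_[-1] ⊗ h₂ v_[0] = (h₁ v)_[-1] h₂ ⊗ (h₁ v)_[0]` -/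
  compat : ∀ (h : H) (x : V), boxAct lreg ρ (Q.Δ h) (δ x) = coactTwist ρ δ (Q.Δ h) x

/-- The coaction of the first kind on a tensor product:
`v ⊗ w ↦ φ₁ (φ̄₁ φ'₁ v)_[-1] φ̄₂ (φ'₂ w)_[-1] φ'₃
  ⊗ φ₂ (φ̄₁ φ'₁ v)_[0] ⊗ φ₃ φ̄₃ (φ'₂ w)_[0]`, with `φ' = φ`. The four maps are, from
right to left:
`v ⊗ w ↦ φ'₁ v ⊗ (φ'₂ w)_[-1] φ'₃ ⊗ (φ'₂ w)_[0]`,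
`v ⊗ x ⊗ w ↦ φ̄₁ v ⊗ φ̄₂ x ⊗ φ̄₃ w`,
`v ⊗ x ⊗ w ↦ v_[-1] x ⊗ v_[0] ⊗ w`,
`x ⊗ v ⊗ w ↦ φ₁ x ⊗ φ₂ v ⊗ φ₃ w`. -/
def tensorCoact₁ (δV : V →ₗ[k] H ⊗[k] V) (δW : W →ₗ[k] H ⊗[k] W) :
    V ⊗[k] W →ₗ[k] H ⊗[k] (V ⊗[k] W) :=
  boxAct lreg (boxAct ρ σ) Q.phi.val ∘ₗ
    ((LinearMap.rTensor (V ⊗[k] W) (LinearMap.mul' k H)) ∘ₗ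
      (TensorProduct.tensorTensorTensorComm k H V H W).toLinearMap ∘ₗ
        LinearMap.rTensor (H ⊗[k] W) δV) ∘ₗ
    boxAct ρ (boxAct lreg σ) Q.phiInv ∘ₗ
    TensorProduct.homTensorHomMap (.id k) V W V (H ⊗[k] W)
      (TensorProduct.map ρ.toLinearMap (coactTwist σ δW) Q.phi.val)

/-- The coaction of the first kind on the trivial module: `1 ↦ 1 ⊗ 1`. -/
def trivCoact₁ : k →ₗ[k] H ⊗[k] k := LinearMap.toSpanSingleton k (H ⊗[k] k) (1 ⊗ₜ[k] 1)

/-- The right action of `S(c)` on the first factor of `H ⊗ V`: `m ⊗ v ↦ m S(c) ⊗ v`. -/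
def rightS (V : Type*) [AddCommGroup V] [Module k V] : H →ₐ[k] Module.End k (H ⊗[k] V) :=
  (Module.endTensorEndAlgHom.comp Algebra.TensorProduct.includeLeft).comp
    ((Algebra.lsmul k k H : Hᵐᵒᵖ →ₐ[k] Module.End k H).comp (Q.antipode : H →ₐ[k] Hᵐᵒᵖ))

theorem rightS_tmul (c m : H) (x : V) :
    Q.rightS V c (m ⊗ₜ[k] x) = (m * Q.S c) ⊗ₜ[k] x := by
  simp [rightS, Module.endTensorEndAlgHom_apply, S, antiLin]

/-- The operator on `H ⊗ V` attached to `(a ⊗ b) ⊗ c`: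
`m ⊗ v ↦ a m S(c) ⊗ b v`. -/
def adBox : (H ⊗[k] H) ⊗[k] H →ₐ[k] Module.End k (H ⊗[k] V) :=
  Algebra.TensorProduct.lift (boxAct lreg ρ) (Q.rightS V) (by
    intro x c
    induction x with
    | zero => simp [Commute.zero_left]
    | add x y hx hy => rw [map_add]; exact hx.add_left hy
    | tmul a b =>
      apply TensorProduct.ext'
      intro m x
      simp [boxAct_tmul, rightS_tmul, mul_assoc])

theorem adBox_tmul (a b c m : H) (x : V) :
    Q.adBox ρ ((a ⊗ₜ[k] b) ⊗ₜ[k] c) (m ⊗ₜ[k] x) = (a * m * Q.S c) ⊗ₜ[k] ρ b x := by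
  simp [adBox, boxAct_tmul, rightS_tmul, mul_assoc]

/-- The `H`-action on `R(V) = H ⊗ V`:
`h • (a ⊗ v) = h₍₁,₁₎ a S(h₍₂₎) ⊗ h₍₁,₂₎ v`. -/
def RAct : H →ₐ[k] Module.End k (H ⊗[k] V) :=
  (Q.adBox ρ).comp ((Algebra.TensorProduct.map Q.comul (AlgHom.id k H)).comp Q.comul)

/-- The operator on `H ⊗ H ⊗ V` attached to `x ⊗ y`: `m ⊗ n ⊗ v ↦ m y ⊗ n x ⊗ v`. -/
def rightMul₂ (V : Type*) [AddCommGroup V] [Module k V] :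
    H ⊗[k] H →ₗ[k] H ⊗[k] (H ⊗[k] V) →ₗ[k] H ⊗[k] (H ⊗[k] V) :=
  TensorProduct.homTensorHomMap (.id k) H (H ⊗[k] V) H (H ⊗[k] V) ∘ₗ
    TensorProduct.map (LinearMap.mul k H).flip
      (LinearMap.rTensorHom V ∘ₗ (LinearMap.mul k H).flip) ∘ₗ
    (TensorProduct.comm k H H).toLinearMap

theorem rightMul₂_tmul (x y m n : H) (a : V) :
    rightMul₂ (k := k) V (x ⊗ₜ[k] y) (m ⊗ₜ[k] (n ⊗ₜ[k] a)) =
      (m * y) ⊗ₜ[k] ((n * x) ⊗ₜ[k] a) := by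
  simp [rightMul₂]

/-- `Ω_{H,H,V} : m ⊗ n ⊗ v ↦ ω₁ m ω₅ ⊗ ω₂ n ω₄ ⊗ ω₃ v`. -/
def Omega : H ⊗[k] (H ⊗[k] V) →ₗ[k] H ⊗[k] (H ⊗[k] V) :=
  LinearMap.mul' k (Module.End k (H ⊗[k] (H ⊗[k] V)))
    (TensorProduct.map (boxAct lreg (boxAct lreg ρ)).toLinearMap (rightMul₂ V) Q.omega)

/-- `a ⊗ v ↦ Ω(a₁ ⊗ a₂ ⊗ v) = ω₁ a₁ ω₅ ⊗ ω₂ a₂ ω₄ ⊗ ω₃ v`; this is the (free) coaction of the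
second kind on `R(V) = H ⊗ V`. -/
def RCoact₂ : H ⊗[k] V →ₗ[k] H ⊗[k] (H ⊗[k] V) :=
  Q.Omega ρ ∘ₗ (TensorProduct.assoc k H H V).toLinearMap ∘ₗ LinearMap.rTensor V Q.Δ

/-- Yetter–Drinfeld modules of the second kind. -/
structure IsYD₂ (δ : V →ₗ[k] H ⊗[k] V) : Prop where
  /-- `v_{-1} ⊗ δ(v_0) = ω₁ v_{-1}(1) ω₅ ⊗ ω₂ v_{-1}(2) ω₄ ⊗ ω₃ v_0` -/
  coassoc : ∀ x : V, LinearMap.lTensor H δ (δ x) = Q.RCoact₂ ρ (δ x)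
  /-- `ε(v_{-1}) v_0 = v` -/
  counit : ∀ x : V, TensorProduct.lid k V (LinearMap.rTensor V Q.ε (δ x)) = x
  /-- `δ(h v) = h₍₁,₁₎ v_{-1} S(h₍₂₎) ⊗ h₍₁,₂₎ v_0` -/
  compat : ∀ (h : H) (x : V), δ (ρ h x) = Q.RAct ρ h (δ x)

/-- From the first to the second kind:
`v ↦ (pᴿ₁ v)_[-1] pᴿ₂ ⊗ (pᴿ₁ v)_[0]`. -/
def toSecond (δ : V →ₗ[k] H ⊗[k] V) : V →ₗ[k] H ⊗[k] V := coactTwist ρ δ Q.pR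

/-- From the second to the first kind:
`v ↦ qᴿ₁₍₁₎ v_{-1} S(qᴿ₂) ⊗ qᴿ₁₍₂₎ v_0`. -/
def toFirst (δ : V →ₗ[k] H ⊗[k] V) : V →ₗ[k] H ⊗[k] V :=
  Q.adBox ρ (TensorProduct.map Q.Δ LinearMap.id Q.qR) ∘ₗ δ

/-- Yetter–Drinfeld modules: `H`-modules with coactions of both kinds that determine each
other. -/
structure IsYD (δ₁ δ₂ : V →ₗ[k] H ⊗[k] V) : Prop where
  first : Q.IsYD₁ ρ δ₁
  second : Q.IsYD₂ ρ δ₂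
  toSecond_eq : Q.toSecond ρ δ₁ = δ₂
  toFirst_eq : Q.toFirst ρ δ₂ = δ₁

/-- Morphisms of Yetter–Drinfeld modules: linear maps preserving action and coaction. -/
structure IsYDHom (δV : V →ₗ[k] H ⊗[k] V) (δW : W →ₗ[k] H ⊗[k] W) (f : V →ₗ[k] W) : Prop where
  map_act : ∀ (h : H) (x : V), f (ρ h x) = σ h (f x)
  map_coact : ∀ x : V, δW (f x) = LinearMap.lTensor H f (δV x)

/-- The coaction of the first kind on `R(V)`. -/
def RCoact₁ : H ⊗[k] V →ₗ[k] H ⊗[k] (H ⊗[k] V) := Q.toFirst (Q.RAct ρ) (Q.RCoact₂ ρ)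

/-- The counit `ε_V : F R(V) → V`, `a ⊗ v ↦ ε(a) v`, of the adjunction between the functor `F`
forgetting the coaction and `R`. -/
def RCounit (V : Type*) [AddCommGroup V] [Module k V] : H ⊗[k] V →ₗ[k] V :=
  (TensorProduct.lid k V).toLinearMap ∘ₗ LinearMap.rTensor V Q.ε

/-- The functor `R` on morphisms: `a ⊗ v ↦ a ⊗ f(v)`. -/
def RMap (f : V →ₗ[k] W) : H ⊗[k] V →ₗ[k] H ⊗[k] W := LinearMap.lTensor H f

/-- The unit `η_M : M → R F(M)` of the adjunction, at a Yetter–Drinfeld module given by its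
coaction of the first kind: it is the coaction of the second kind. -/
def RUnit (δ₁ : V →ₗ[k] H ⊗[k] V) : V →ₗ[k] H ⊗[k] V := Q.toSecond ρ δ₁

/-- `R⁽⁰⁾ = η_𝟙 : 𝟙 → R(𝟙)`. -/
def Rzero : k →ₗ[k] H ⊗[k] k := Q.RUnit Q.trivAct trivCoact₁

/-- `R⁽²⁾ = R(ε_V ⊗ ε_W) ∘ η_{R(V) ⊗ R(W)} : R(V) ⊗ R(W) → R(V ⊗ W)`. -/
def Rtwo : (H ⊗[k] V) ⊗[k] (H ⊗[k] W) →ₗ[k] H ⊗[k] (V ⊗[k] W) :=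
  RMap (V := (H ⊗[k] V) ⊗[k] (H ⊗[k] W)) (TensorProduct.map (Q.RCounit V) (Q.RCounit W)) ∘ₗ
    Q.RUnit (Q.tensorAct (Q.RAct ρ) (Q.RAct σ))
      (Q.tensorCoact₁ (Q.RAct ρ) (Q.RAct σ) (Q.RCoact₁ ρ) (Q.RCoact₁ σ))

end Modules

/-- The structure maps of an algebra in the category of Yetter–Drinfeld modules, on the space
`V`. -/
structure YDAlgebraData (k : Type u) (H : Type v) [Field k] [Ring H] [Algebra k H]
    (V : Type w) [AddCommGroup V] [Module k V] where
  act : H →ₐ[k] Module.End k V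
  coact₁ : V →ₗ[k] H ⊗[k] V
  coact₂ : V →ₗ[k] H ⊗[k] V
  mul : V ⊗[k] V →ₗ[k] V
  one : V

/-- An algebra in the monoidal category of Yetter–Drinfeld modules. -/
structure IsYDAlgebra {V : Type w} [AddCommGroup V] [Module k V] (A : YDAlgebraData k H V) :
    Prop where
  isYD : Q.IsYD A.act A.coact₁ A.coact₂
  /-- the multiplication `A ⊗ A → A` is a morphism -/
  mul_hom : IsYDHom (Q.tensorAct A.act A.act) A.act
    (Q.tensorCoact₁ A.act A.act A.coact₁ A.coact₁) A.coact₁ A.mul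
  /-- the unit `𝟙 → A` is a morphism -/
  one_hom : IsYDHom Q.trivAct A.act trivCoact₁ A.coact₁ (LinearMap.toSpanSingleton k V A.one)
  /-- `m ∘ (m ⊗ id) = m ∘ (id ⊗ m) ∘ Φ_{A,A,A}` -/
  mul_assoc : ∀ a b c : V,
    A.mul (A.mul (a ⊗ₜ[k] b) ⊗ₜ[k] c) =
      A.mul (LinearMap.lTensor V A.mul
        (boxAct A.act (boxAct A.act A.act) Q.phi.val (a ⊗ₜ[k] (b ⊗ₜ[k] c))))
  one_mul : ∀ a : V, A.mul (A.one ⊗ₜ[k] a) = a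
  mul_one : ∀ a : V, A.mul (a ⊗ₜ[k] A.one) = a

/-- The adjoint algebra `𝐀 = R(𝟙)`, transported along the identification
`H ≃ H ⊗ k = R(𝟙)`, `a ↦ a ⊗ 1`; its multiplication is
`R(𝟙) ⊗ R(𝟙) → R(𝟙 ⊗ 𝟙) ≃ R(𝟙)` and its unit is `R⁽⁰⁾`. -/
def adjointAlgebra : YDAlgebraData k H H where
  act := (LinearEquiv.conjAlgEquiv k (TensorProduct.rid k H) :
    Module.End k (H ⊗[k] k) →ₐ[k] Module.End k H).comp (Q.RAct Q.trivAct)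
  coact₁ := LinearMap.lTensor H (TensorProduct.rid k H).toLinearMap ∘ₗ
    Q.RCoact₁ Q.trivAct ∘ₗ (TensorProduct.rid k H).symm.toLinearMap
  coact₂ := LinearMap.lTensor H (TensorProduct.rid k H).toLinearMap ∘ₗ
    Q.RCoact₂ Q.trivAct ∘ₗ (TensorProduct.rid k H).symm.toLinearMap
  mul := (TensorProduct.rid k H).toLinearMap ∘ₗ
    RMap (TensorProduct.lid k k).toLinearMap ∘ₗ Q.Rtwo Q.trivAct Q.trivAct ∘ₗ
      TensorProduct.map (TensorProduct.rid k H).symm.toLinearMap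
        (TensorProduct.rid k H).symm.toLinearMap
  one := TensorProduct.rid k H (Q.Rzero 1)

section Explicit

/-- The operator attached to `x ⊗ y`: `a ↦ x a S(y)`. -/
def sandwich : H ⊗[k] H →ₐ[k] Module.End k H :=
  Algebra.TensorProduct.lift (C := Module.End k H) (Algebra.lmul k H)
    ((Algebra.lsmul k k H : Hᵐᵒᵖ →ₐ[k] Module.End k H).comp (Q.antipode : H →ₐ[k] Hᵐᵒᵖ)) (by
      intro x y
      ext a
      simp [mul_assoc])

theorem sandwich_tmul (x y a : H) : Q.sandwich (x ⊗ₜ[k] y) a = x * a * Q.S y := by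
  refine (LinearMap.congr_fun (Algebra.TensorProduct.lift_tmul _ _ _ x y) a).trans ?_
  simp [S, antiLin, mul_assoc]

/-- `h ▷ a = h₁ a S(h₂)` -/
def adAct : H →ₐ[k] Module.End k H := Q.sandwich.comp Q.comul

/-- The operator attached to `x₁ ⊗ x₂ ⊗ x₃ ⊗ x₄`:
`a ⊗ b ↦ x₁ a S(x₄) ⊗ x₂ b S(x₃)`. -/
def sandwichOI : H ⊗[k] (H ⊗[k] (H ⊗[k] H)) →ₗ[k] Module.End k (H ⊗[k] H) :=
  (boxAct Q.sandwich Q.sandwich).toLinearMap ∘ₗ outerInner.toLinearMap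

theorem sandwichOI_tmul (x₁ x₂ x₃ x₄ a b : H) :
    Q.sandwichOI (x₁ ⊗ₜ[k] (x₂ ⊗ₜ[k] (x₃ ⊗ₜ[k] x₄))) (a ⊗ₜ[k] b) =
      (x₁ * a * Q.S x₄) ⊗ₜ[k] (x₂ * b * Q.S x₃) := by
  simp [sandwichOI, outerInner_tmul, boxAct_tmul, sandwich_tmul]

/-- `a ↦ a₁ 𝕗̄₁ ⊗ a₂ 𝕗̄₂` -/
def ΔfInv : H →ₗ[k] H ⊗[k] H := LinearMap.mulRight k Q.drinfeldTwistInv ∘ₗ Q.Δ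

/-- `a ↦ φ₁ φ̄₁₍₁₎ a₁ 𝕗̄₁ S(φ̄₃) ⊗ φ₂ φ̄₁₍₂₎ a₂ 𝕗̄₂ S(φ₃ φ̄₂)`; the element of `H^{⊗4}` used is
`(φ ⊗ 1) (Δ ⊗ id ⊗ id)(φ⁻¹) = φ₁ φ̄₁₍₁₎ ⊗ φ₂ φ̄₁₍₂₎ ⊗ φ₃ φ̄₂ ⊗ φ̄₃`. -/
def coactFormula₂ : H →ₗ[k] H ⊗[k] H :=
  Q.sandwichOI (pad Q.phi.val * Q.Δ1 Q.phiInv) ∘ₗ Q.ΔfInv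

/-- The element
`φ₁ φ'₁₍₁₎ ⊗ φ₂ φ'₁₍₂₎ ⊗ φ₃ qᴿ₁ φ'₂₍₁₎ ⊗ qᴿ₂ φ'₂₍₂₎ ⊗ φ'₃` with `φ' = φ`, bracketed as
`H^{⊗4} ⊗ H`; it is `(φ ⊗ 1 ⊗ 1) (1 ⊗ 1 ⊗ qᴿ ⊗ 1) (Δ ⊗ Δ ⊗ id)(φ)`. -/
def tau₁ : (H ⊗[k] (H ⊗[k] (H ⊗[k] H))) ⊗[k] H :=
  TensorProduct.map
    (LinearMap.mulLeft k (pad Q.phi.val * ((1 : H) ⊗ₜ[k] ((1 : H) ⊗ₜ[k] Q.qR))) ∘ₗ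
      (TensorProduct.assoc k H H (H ⊗[k] H)).toLinearMap ∘ₗ TensorProduct.map Q.Δ Q.Δ)
    LinearMap.id ((TensorProduct.assoc k H H H).symm Q.phi.val)

/-- The operator attached to `(x₁ ⊗ x₂ ⊗ x₃ ⊗ x₄) ⊗ x₅`:
`a ⊗ b ↦ x₁ a S(x₄) x₅ ⊗ x₂ b S(x₃)`. -/
def sandwichOI' : (H ⊗[k] (H ⊗[k] (H ⊗[k] H))) ⊗[k] H →ₗ[k] Module.End k (H ⊗[k] H) :=
  LinearMap.mul' k (Module.End k (H ⊗[k] H)) ∘ₗ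
    TensorProduct.map (LinearMap.rTensorHom H ∘ₗ (LinearMap.mul k H).flip) Q.sandwichOI ∘ₗ
    (TensorProduct.comm k (H ⊗[k] (H ⊗[k] (H ⊗[k] H))) H).toLinearMap

theorem sandwichOI'_tmul (x₁ x₂ x₃ x₄ x₅ a b : H) :
    Q.sandwichOI' ((x₁ ⊗ₜ[k] (x₂ ⊗ₜ[k] (x₃ ⊗ₜ[k] x₄))) ⊗ₜ[k] x₅) (a ⊗ₜ[k] b) =
      (x₁ * a * Q.S x₄ * x₅) ⊗ₜ[k] (x₂ * b * Q.S x₃) := by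
  simp [sandwichOI', sandwichOI_tmul]

/-- `a ↦ φ₁ φ'₁₍₁₎ a₁ 𝕗̄₁ S(qᴿ₂ φ'₂₍₂₎) φ'₃ ⊗ φ₂ φ'₁₍₂₎ a₂ 𝕗̄₂ S(φ₃ qᴿ₁ φ'₂₍₁₎)` -/
def coactFormula₁ : H →ₗ[k] H ⊗[k] H := Q.sandwichOI' Q.tau₁ ∘ₗ Q.ΔfInv

/-- The map attached to `x₁ ⊗ x₂ ⊗ x₃ ⊗ x₄`: `a ⊗ b ↦ x₁ a S(x₂) α x₃ b S(x₄)`. -/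
def starOp (x : H ⊗[k] (H ⊗[k] (H ⊗[k] H))) : H ⊗[k] H →ₗ[k] H :=
  LinearMap.mul' k H ∘ₗ LinearMap.rTensor H (LinearMap.mulRight k Q.alpha) ∘ₗ
    boxAct Q.sandwich Q.sandwich ((TensorProduct.assoc k H H (H ⊗[k] H)).symm x)

theorem starOp_tmul (x₁ x₂ x₃ x₄ a b : H) :
    Q.starOp (x₁ ⊗ₜ[k] (x₂ ⊗ₜ[k] (x₃ ⊗ₜ[k] x₄))) (a ⊗ₜ[k] b) =
      x₁ * a * Q.S x₂ * Q.alpha * x₃ * b * Q.S x₄ := by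
  simp [starOp, boxAct_tmul, sandwich_tmul, mul_assoc]

/-- `a ⊗ b ↦ φ₁ a S(φ̄₁ φ₂) α φ̄₂ φ₃₍₁₎ b S(φ̄₃ φ₃₍₂₎)` -/
def starMul : H ⊗[k] H →ₗ[k] H := Q.starOp Q.tauA

/-- The algebra `H₀` of Bulacu, Caenepeel and Panaite: the space `H` with the adjoint action, the
(first kind) coaction, the multiplication and the unit below. Its coaction of the second kind
is the one that corresponds to its coaction of the first kind. -/
def bcpAlgebra : YDAlgebraData k H H where
  act := Q.adAct
  coact₁ := Q.coactFormula₁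
  coact₂ := Q.toSecond Q.adAct Q.coactFormula₁
  mul := Q.starMul
  one := Q.beta

end Explicit

end QuasiHopfAlgebra

end QHopf

end

/-!
The theorem is reduced to one linear map, `U(a) = φ₁ a S(φ₂) α φ₃`, which turns the adjoint action
into left multiplication: `h U(a) = U(h₁ ▷ a) h₂` (`isTwisted_U`), and which can be undone:
`U(pᴿ₁ ▷ a) pᴿ₂ = a` (`twistEval_U_pR`). Call a linear map `δ : V → H` on an `H`-module twisted if
`h δ(v) = δ(h₁ v) h₂`. Then `f ↦ U ∘ f` is a bijection from the `H`-linear maps `V → 𝐀` to the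
twisted maps `V → H`, with inverse `δ ↦ (v ↦ δ(pᴿ₁ v) pᴿ₂)` (`IsTwisted.U_twistEval_pR`,
`IsTwisted.act_twistEval_pR`). So an equality of `H`-linear maps into `𝐀` may be checked after
applying `U` (`ext_of_U`), and an equality of compatible maps into `B ⊗ 𝐀` after applying
`b ⊗ a ↦ φ₁ b ⊗ U(φ₂ ▷ a) φ₃` (`ext_of_uTail`).

Under this translation the structure of `𝐀` becomes that of `H` itself. The multiplication satisfies
`U(a ⋆ b) = U(φ₁ ▷ a) U(φ₂ ▷ b) φ₃` (`U_starMul`), and the coaction of the first kind `adCoact`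
satisfies `φ₁ a_[-1] ⊗ U(φ₂ ▷ a_[0]) φ₃ = Δ(U(φ₁ ▷ a)) (φ₂ ⊗ φ₃)` (`uTail_φ_adCoact`).
Associativity of `⋆`, coassociativity of the coaction and colinearity of `⋆` then express that the
product of `H` is associative, that `Δ` is coassociative up to `φ`, and that `Δ` is multiplicative;
what remains in each case is an instance of the pentagon (`starMul_assoc`, `iterCoactψ_adCoact`,
`adCoact_starMul`).

Drinfeld's gauge transformation enters through the notion of an antipode along an algebra
homomorphism `g : H → B` (`IsAntipodeAlong`). Two such antipodes are conjugate by a canonical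
invertible element (`IsAntipodeAlong.compare_mul_compare`). Along `Δ : H → H ⊗ H` there are two:
`(Δ S, Δ(α), Δ(β))`, and `((S ⊗ S) Δᶜᵒᵖ, 𝕒, 𝕓)` (`isAntipodeAlong_comul_SSΔcop`). The element that
compares them is `𝕗`, which gives the invertibility of `𝕗` together with `Δ(β) 𝕗⁻¹ = 𝕓` and
`Δ(S(h)) 𝕗⁻¹ = 𝕗⁻¹ (S ⊗ S)(Δᶜᵒᵖ(h))`. These two rules yield the formula
`φ_mul_comulHead_pR_mul_pR` for `φ (Δ ⊗ id)(pᴿ) (pᴿ ⊗ 1)`. It has two uses: it identifies the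
coaction of the second kind that corresponds to `adCoact` with the explicit formula
(`toSecond_adCoact`), and it shows that the passage from the first to the second kind turns
Yetter–Drinfeld modules of the first kind into those of the second kind (`IsYD₁.toSecond`).

It remains to compare with `R(𝟙) = H ⊗ k`. All constructions are natural in the module, so the
structure of `R(𝟙)` can be transported along `H ⊗ k ≅ H`, where the free coaction of the second kind
becomes the explicit one (`lTensor_rid_RCoact₂`). As `toFirst` undoes `toSecond`
(`toFirst_toSecond`), the coactions of the first kind agree as well. The product
`(id ⊗ ε ⊗ ε) ∘ η` of `R(𝟙)` is computed from `(id ⊗ ε) adCoact = U` (`counitTail₂_tensorCoact₁`).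
In the universal property, `G = (id ⊗ g) δ²` is colinear by the coassociativity of `δ²`, and it is
the only possibility because `(id ⊗ ε) δ²_𝐀 = id` (`counitTail_coactFormula₂`).

Identities between sums over legs are stated as identities between linear maps on tensor powers of
`H` and are checked on pure tensors. In this language the pentagon reads
`d₃ φ * d₁ φ = padL φ * d₂ φ * padR φ`, and the antipode axioms enter as the collapse of a factor
`Δ(h)` on two legs that meet at `α` or at `β`.
-/

noncomputable section

set_option maxSynthPendingDepth 3

namespace QHopf

open Algebra.TensorProduct (includeLeft includeRight)

section Shortcuts

/-! These instances spare `map_add` and `map_zero` a search through the classes of bundled maps. -/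

variable {k V W : Type*} [Field k] [AddCommGroup V] [Module k V] [AddCommGroup W] [Module k W]
  {A B : Type*} [Ring A] [Algebra k A] [Ring B] [Algebra k B]

instance : AddHomClass (V →ₗ[k] W) V W := inferInstance
instance : ZeroHomClass (V →ₗ[k] W) V W := inferInstance
instance : AddHomClass (V ≃ₗ[k] W) V W := inferInstance
instance : ZeroHomClass (V ≃ₗ[k] W) V W := inferInstance
instance : AddHomClass (A →ₐ[k] B) A B := inferInstance
instance : ZeroHomClass (A →ₐ[k] B) A B := inferInstance

end Shortcuts

theorem tensor₃_induction {k : Type*} [Field k] {A B C : Type*} [AddCommGroup A] [Module k A]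
    [AddCommGroup B] [Module k B] [AddCommGroup C] [Module k C] {P : A ⊗[k] (B ⊗[k] C) → Prop}
    (t : A ⊗[k] (B ⊗[k] C)) (zero : P 0)
    (tmul : ∀ x y z, P (x ⊗ₜ (y ⊗ₜ z))) (add : ∀ s t, P s → P t → P (s + t)) : P t := by
  induction t with
  | zero => exact zero
  | add s t hs ht => exact add s t hs ht
  | tmul x w =>
    induction w with
    | zero => simpa using zero
    | add s t hs ht => rw [TensorProduct.tmul_add]; exact add _ _ hs ht
    | tmul y z => exact tmul x y z

theorem tensor₄_induction {k : Type*} [Field k] {A B C D : Type*} [AddCommGroup A] [Module k A]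
    [AddCommGroup B] [Module k B] [AddCommGroup C] [Module k C] [AddCommGroup D] [Module k D]
    {P : A ⊗[k] (B ⊗[k] (C ⊗[k] D)) → Prop}
    (t : A ⊗[k] (B ⊗[k] (C ⊗[k] D))) (zero : P 0)
    (tmul : ∀ x y z w, P (x ⊗ₜ (y ⊗ₜ (z ⊗ₜ w)))) (add : ∀ s t, P s → P t → P (s + t)) : P t := by
  induction t with
  | zero => exact zero
  | add s t hs ht => exact add s t hs ht
  | tmul x w =>
    induction w using tensor₃_induction with
    | zero => simpa using zero
    | add s t hs ht => rw [TensorProduct.tmul_add]; exact add _ _ hs ht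
    | tmul y z w => exact tmul x y z w

/-- The product of two linear maps into an algebra: `x ⊗ y ↦ f(x) g(y)`. -/
def mulMap {k B : Type*} [Field k] [Ring B] [Algebra k B] {M N : Type*} [AddCommGroup M]
    [Module k M] [AddCommGroup N] [Module k N] (f : M →ₗ[k] B) (g : N →ₗ[k] B) :
    M ⊗[k] N →ₗ[k] B :=
  LinearMap.mul' k B ∘ₗ TensorProduct.map f g

@[simp] theorem mulMap_tmul {k B : Type*} [Field k] [Ring B] [Algebra k B] {M N : Type*}
    [AddCommGroup M] [Module k M] [AddCommGroup N] [Module k N] (f : M →ₗ[k] B) (g : N →ₗ[k] B)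
    (x : M) (y : N) : mulMap f g (x ⊗ₜ y) = f x * g y := by
  simp [mulMap]

namespace QuasiHopfAlgebra

variable {k : Type u} {H : Type v} [Field k] [Ring H] [Algebra k H] (Q : QuasiHopfAlgebra k H)

/-! ### Legs of tensor powers -/

/-- `x ⊗ b ↦ x₁ ⊗ x₂ ⊗ b`, for `b` in an arbitrary algebra. -/
def comulHead (B : Type*) [Ring B] [Algebra k B] : H ⊗[k] B →ₐ[k] H ⊗[k] (H ⊗[k] B) :=
  (Algebra.TensorProduct.assoc k k k H H B).toAlgHom.comp
    (Algebra.TensorProduct.map Q.comul (AlgHom.id k B))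

/-- `u ⊗ b ↦ u₁ ⊗ u₂ ⊗ b` for `u ∈ H ⊗ H`. -/
def app {B : Type*} [AddCommGroup B] [Module k B] (u : H ⊗[k] H) (b : B) :
    H ⊗[k] (H ⊗[k] B) :=
  TensorProduct.assoc k H H B (u ⊗ₜ b)

section app

variable {B : Type*} [AddCommGroup B] [Module k B]

@[simp] theorem app_zero (b : B) : app (0 : H ⊗[k] H) b = 0 := by simp [app]
theorem app_add (u u' : H ⊗[k] H) (b : B) : app (u + u') b = app u b + app u' b := by
  simp [app, TensorProduct.add_tmul]
@[simp] theorem app_tmul (x y : H) (b : B) : app (x ⊗ₜ[k] y) b = x ⊗ₜ (y ⊗ₜ b) := by simp [app]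

end app

@[simp] theorem comulHead_tmul {B : Type*} [Ring B] [Algebra k B] (x : H) (b : B) :
    Q.comulHead B (x ⊗ₜ b) = app (Q.Δ x) b := by
  simp only [comulHead, Δ]
  rfl

/-- `x ⊗ b ↦ ε(x) b`. -/
def counitHead (B : Type*) [Ring B] [Algebra k B] : H ⊗[k] B →ₐ[k] B :=
  (Algebra.TensorProduct.lid k B).toAlgHom.comp
    (Algebra.TensorProduct.map Q.counit (AlgHom.id k B))

@[simp] theorem counitHead_tmul {B : Type*} [Ring B] [Algebra k B] (x : H) (b : B) :
    Q.counitHead B (x ⊗ₜ b) = Q.counit x • b := by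
  simp [counitHead]

/-- `x ⊗ y ↦ ε(y) x`. -/
def counitTail : H ⊗[k] H →ₐ[k] H :=
  (Algebra.TensorProduct.rid k k H).toAlgHom.comp
    (Algebra.TensorProduct.map (AlgHom.id k H) Q.counit)

@[simp] theorem counitTail_tmul (x y : H) : Q.counitTail (x ⊗ₜ y) = Q.counit y • x := by
  simp [counitTail]

/-- An algebra homomorphism applied to all legs but the first. -/
abbrev onTail {B C : Type*} [Ring B] [Algebra k B] [Ring C] [Algebra k C] (F : B →ₐ[k] C) :
    H ⊗[k] B →ₐ[k] H ⊗[k] C := Algebra.TensorProduct.map (AlgHom.id k H) F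

/-- `(Δ ⊗ id ⊗ id)`, as an algebra homomorphism. -/
def d₁ : H ⊗[k] (H ⊗[k] H) →ₐ[k] H ⊗[k] (H ⊗[k] (H ⊗[k] H)) := Q.comulHead (H ⊗[k] H)

/-- `(id ⊗ Δ ⊗ id)`, as an algebra homomorphism. -/
def d₂ : H ⊗[k] (H ⊗[k] H) →ₐ[k] H ⊗[k] (H ⊗[k] (H ⊗[k] H)) := onTail (Q.comulHead H)

/-- `(id ⊗ id ⊗ Δ)`, as an algebra homomorphism. -/
def d₃ : H ⊗[k] (H ⊗[k] H) →ₐ[k] H ⊗[k] (H ⊗[k] (H ⊗[k] H)) := onTail (onTail Q.comul)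

/-- `t ↦ 1 ⊗ t`. -/
def padL : H ⊗[k] (H ⊗[k] H) →ₐ[k] H ⊗[k] (H ⊗[k] (H ⊗[k] H)) := includeRight

/-- `t ↦ t ⊗ 1`. -/
def padR : H ⊗[k] (H ⊗[k] H) →ₐ[k] H ⊗[k] (H ⊗[k] (H ⊗[k] H)) := onTail (onTail includeLeft)

theorem d₁_tmul (x : H) (t : H ⊗[k] H) : Q.d₁ (x ⊗ₜ t) = app (Q.Δ x) t := by simp [d₁]
theorem d₂_tmul (x y z : H) : Q.d₂ (x ⊗ₜ (y ⊗ₜ z)) = x ⊗ₜ app (Q.Δ y) z := by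
  simp [d₂]
theorem d₃_tmul (x y z : H) : Q.d₃ (x ⊗ₜ (y ⊗ₜ z)) = x ⊗ₜ (y ⊗ₜ Q.Δ z) := by
  simp [d₃, Δ]
theorem padL_apply (t : H ⊗[k] (H ⊗[k] H)) : padL t = (1 : H) ⊗ₜ[k] t := rfl
theorem padR_tmul (x y z : H) : padR (k := k) (x ⊗ₜ (y ⊗ₜ z)) = x ⊗ₜ (y ⊗ₜ (z ⊗ₜ 1)) := by
  simp [padR]

theorem pad_eq (t : H ⊗[k] (H ⊗[k] H)) : pad t = padR t := by
  induction t using tensor₃_induction with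
  | zero => simp [pad]
  | add s t hs ht => rw [map_add, ← hs, ← ht]; simp only [pad, TensorProduct.add_tmul, map_add]
  | tmul x y z => rw [padR_tmul]; simp [pad]

theorem Δ1_eq (t : H ⊗[k] (H ⊗[k] H)) : Q.Δ1 t = Q.d₁ t := by
  induction t with
  | zero => simp [Δ1]
  | add s t hs ht => rw [map_add, ← hs, ← ht]; simp only [Δ1, map_add]
  | tmul x y => rw [d₁_tmul]; simp [Δ1, app]

theorem Δ3_eq (t : H ⊗[k] (H ⊗[k] H)) : Q.Δ3 t = Q.d₃ t := by
  induction t using tensor₃_induction with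
  | zero => simp [Δ3]
  | add s t hs ht => rw [map_add, ← hs, ← ht]; simp only [Δ3, map_add]
  | tmul x y z => rw [d₃_tmul]; simp [Δ3]

/-- The associator, as an element. -/
abbrev φ : H ⊗[k] (H ⊗[k] H) := Q.phi.val

/-- The inverse of the associator, as an element. -/
abbrev ψ : H ⊗[k] (H ⊗[k] H) := Q.phiInv

@[simp] theorem φ_mul_ψ : Q.φ * Q.ψ = 1 := Q.phi.val_inv
@[simp] theorem ψ_mul_φ : Q.ψ * Q.φ = 1 := Q.phi.inv_val

/-- The pentagon axiom in terms of the algebra homomorphisms `d₁`, `d₂`, `d₃`, `padL`, `padR`. -/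
theorem pentagon' : Q.d₃ Q.φ * Q.d₁ Q.φ = padL Q.φ * Q.d₂ Q.φ * padR Q.φ := by
  have h := Q.pentagon
  rw [← pad_eq, padL_apply]
  rw [← Q.Δ1_eq, ← Q.Δ3_eq]
  exact h

section Pentagons

variable {R : Type*} [Ring R] [Algebra k R] (F : (H ⊗[k] (H ⊗[k] H)) →ₐ[k] R)

@[simp] theorem map_φ_ψ : F Q.φ * F Q.ψ = 1 := by rw [← map_mul, φ_mul_ψ, map_one]
@[simp] theorem map_ψ_φ : F Q.ψ * F Q.φ = 1 := by rw [← map_mul, ψ_mul_φ, map_one]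
@[simp] theorem map_φ_ψ_assoc (x : R) : F Q.φ * (F Q.ψ * x) = x := by
  rw [← mul_assoc, map_φ_ψ, one_mul]
@[simp] theorem map_ψ_φ_assoc (x : R) : F Q.ψ * (F Q.φ * x) = x := by
  rw [← mul_assoc, map_ψ_φ, one_mul]

end Pentagons

theorem d₁_φ_padR_ψ : Q.d₁ Q.φ * padR Q.ψ = Q.d₃ Q.ψ * padL Q.φ * Q.d₂ Q.φ := by
  have h := Q.pentagon'
  calc Q.d₁ Q.φ * padR Q.ψ = Q.d₃ Q.ψ * (Q.d₃ Q.φ * Q.d₁ Q.φ) * padR Q.ψ := by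
        simp
    _ = _ := by rw [h]; simp [mul_assoc]

theorem padL_ψ_d₃_φ : padL Q.ψ * Q.d₃ Q.φ = Q.d₂ Q.φ * padR Q.φ * Q.d₁ Q.ψ := by
  have h := Q.pentagon'
  calc padL Q.ψ * Q.d₃ Q.φ = padL Q.ψ * (Q.d₃ Q.φ * Q.d₁ Q.φ) * Q.d₁ Q.ψ := by
        simp [mul_assoc]
    _ = _ := by rw [h]; simp [mul_assoc]

theorem pentagon_inv : Q.d₁ Q.ψ * Q.d₃ Q.ψ = padR Q.ψ * Q.d₂ Q.ψ * padL Q.ψ := by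
  have h := Q.pentagon'
  calc Q.d₁ Q.ψ * Q.d₃ Q.ψ =
        padR Q.ψ * Q.d₂ Q.ψ * padL Q.ψ * (padL Q.φ * Q.d₂ Q.φ * padR Q.φ) *
          (Q.d₁ Q.ψ * Q.d₃ Q.ψ) := by
        simp [mul_assoc]
    _ = _ := by rw [← h]; simp [mul_assoc]

theorem padR_φ_d₁_ψ : padR Q.φ * Q.d₁ Q.ψ = Q.d₂ Q.ψ * padL Q.ψ * Q.d₃ Q.φ := by
  rw [mul_assoc (Q.d₂ Q.ψ), padL_ψ_d₃_φ]; simp [mul_assoc]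

theorem d₁_ψ_d₃_ψ_padL_φ : Q.d₁ Q.ψ * Q.d₃ Q.ψ * padL Q.φ = padR Q.ψ * Q.d₂ Q.ψ := by
  rw [pentagon_inv]; simp [mul_assoc]

/-! ### The counit and the antipode -/

theorem counitHead_comul (h : H) : Q.counitHead H (Q.comul h) = h := Q.counit_left h

theorem counitTail_comul (h : H) : Q.counitTail (Q.comul h) = h := Q.counit_right h

theorem counitHead_app (u : H ⊗[k] H) {B : Type*} [Ring B] [Algebra k B] (b : B) :
    Q.counitHead (H ⊗[k] B) (app u b) = Q.counitHead H u ⊗ₜ b := by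
  induction u with
  | zero => simp
  | add x y hx hy => simp only [app_add, TensorProduct.add_tmul, map_add, hx, hy]
  | tmul x y => simp [TensorProduct.smul_tmul']

theorem onTail_counitHead_app (u : H ⊗[k] H) {B : Type*} [Ring B] [Algebra k B] (b : B) :
    onTail (Q.counitHead B) (app u b) = Q.counitTail u ⊗ₜ b := by
  induction u with
  | zero => simp
  | add x y hx hy => simp only [app_add, TensorProduct.add_tmul, map_add, hx, hy]
  | tmul x y => simp [TensorProduct.smul_tmul']

theorem counitHead_Δ (h : H) : Q.counitHead H (Q.Δ h) = h := Q.counitHead_comul h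
theorem counitTail_Δ (h : H) : Q.counitTail (Q.Δ h) = h := Q.counitTail_comul h

theorem counit₂_φ : onTail (Q.counitHead H) Q.φ = 1 := by
  refine Eq.trans ?_ Q.counit_phi
  rfl

/-- The axioms contain only `(id ⊗ ε ⊗ id)(φ) = 1`; the counit identities for the outer legs follow
from it by applying `ε` to a middle leg of the pentagon. -/
theorem counit₁_φ : Q.counitHead (H ⊗[k] H) Q.φ = 1 := by
  have h := congrArg (onTail (Q.counitHead (H ⊗[k] H))) Q.pentagon'
  have h1 : ∀ t, onTail (Q.counitHead (H ⊗[k] H)) (Q.d₃ t) =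
      onTail Q.comul (onTail (Q.counitHead H) t) := by
    intro t
    induction t using tensor₃_induction with
    | zero => simp
    | add s t hs ht => simp only [map_add, hs, ht]
    | tmul x y z => rw [d₃_tmul]; simp [Δ]
  have h2 : ∀ t, onTail (Q.counitHead (H ⊗[k] H)) (Q.d₁ t) = t := by
    intro t
    induction t with
    | zero => simp
    | add s t hs ht => simp only [map_add, hs, ht]
    | tmul x y => rw [d₁_tmul, onTail_counitHead_app, counitTail_Δ]
  have h3 : ∀ t, onTail (Q.counitHead (H ⊗[k] H)) (Q.d₂ t) = t := by
    intro t
    induction t using tensor₃_induction with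
    | zero => simp
    | add s t hs ht => simp only [map_add, hs, ht]
    | tmul x y z =>
      rw [d₂_tmul, Algebra.TensorProduct.map_tmul, counitHead_app, counitHead_Δ]; rfl
  have h4 : ∀ t, onTail (Q.counitHead (H ⊗[k] H)) (padR t) =
      onTail includeLeft (onTail (Q.counitHead H) t) := by
    intro t
    induction t using tensor₃_induction with
    | zero => simp
    | add s t hs ht => simp only [map_add, hs, ht]
    | tmul x y z => rw [padR_tmul]; simp
  -- the pentagon becomes `φ = (1 ⊗ (ε ⊗ id ⊗ id)(φ)) φ`
  rw [map_mul, map_mul, map_mul, h1, h2, h3, h4, counit₂_φ, map_one, map_one, one_mul, mul_one,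
    padL_apply, Algebra.TensorProduct.map_tmul] at h
  have h5 : includeRight (R := k) (A := H) (Q.counitHead (H ⊗[k] H) Q.φ) = 1 := by
    have := congrArg (· * Q.ψ) h
    simpa [mul_assoc] using this.symm
  have h6 := congrArg (Q.counitHead (H ⊗[k] H)) h5
  simpa using h6

theorem counit₃_φ : onTail Q.counitTail Q.φ = 1 := by
  have h := congrArg (onTail (onTail (Q.counitHead H))) Q.pentagon'
  have h1 : ∀ t, onTail (onTail (Q.counitHead H)) (Q.d₃ t) = t := by
    intro t
    induction t using tensor₃_induction with
    | zero => simp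
    | add s t hs ht => simp only [map_add, hs, ht]
    | tmul x y z => rw [d₃_tmul]; simp [counitHead_Δ]
  have h2 : ∀ t, onTail (onTail (Q.counitHead H)) (Q.d₁ t) =
      Q.comulHead H (onTail (Q.counitHead H) t) := by
    intro t
    induction t using tensor₃_induction with
    | zero => simp
    | add s t hs ht => simp only [map_add, hs, ht]
    | tmul x y z =>
      rw [d₁_tmul]
      simp only [Algebra.TensorProduct.map_tmul, counitHead_tmul, AlgHom.coe_id, id_eq,
        TensorProduct.tmul_smul, map_smul, comulHead_tmul]
      induction Q.Δ x with
      | zero => simp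
      | add s t hs ht => simp only [app_add, map_add, hs, ht, smul_add]
      | tmul x x' => simp
  have h3 : ∀ t, onTail (onTail (Q.counitHead H)) (Q.d₂ t) = t := by
    intro t
    induction t using tensor₃_induction with
    | zero => simp
    | add s t hs ht => simp only [map_add, hs, ht]
    | tmul x y z =>
      rw [d₂_tmul, Algebra.TensorProduct.map_tmul, onTail_counitHead_app, counitTail_Δ]; rfl
  have h4 : ∀ t, onTail (onTail (Q.counitHead H)) (padR t) =
      onTail includeLeft (onTail Q.counitTail t) := by
    intro t
    induction t using tensor₃_induction with
    | zero => simp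
    | add s t hs ht => simp only [map_add, hs, ht]
    | tmul x y z => rw [padR_tmul]; simp
  -- the pentagon becomes `φ = φ ((id ⊗ id ⊗ ε)(φ) ⊗ 1)`
  rw [map_mul, map_mul, map_mul, h1, h2, h3, h4, counit₂_φ, map_one, mul_one,
    padL_apply, Algebra.TensorProduct.map_tmul, counit₂_φ] at h
  have h5 : (onTail includeLeft (onTail Q.counitTail Q.φ) : H ⊗[k] (H ⊗[k] H)) = 1 := by
    have := congrArg (Q.ψ * ·) h
    simpa [← mul_assoc, ← Algebra.TensorProduct.one_def] using this.symm
  have h6 := congrArg (onTail Q.counitTail) h5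
  have h7 : ∀ t : H ⊗[k] H, onTail Q.counitTail (onTail includeLeft t : H ⊗[k] (H ⊗[k] H)) = t := by
    intro t
    induction t with
    | zero => simp
    | add s t hs ht => simp only [map_add, hs, ht]
    | tmul x y => simp
  rw [h7, map_one] at h6
  exact h6

theorem counit₁_ψ : Q.counitHead (H ⊗[k] H) Q.ψ = 1 := by
  have := map_φ_ψ Q (Q.counitHead (H ⊗[k] H)); rwa [counit₁_φ, one_mul] at this
theorem counit₂_ψ : onTail (Q.counitHead H) Q.ψ = 1 := by
  have := map_φ_ψ Q (onTail (Q.counitHead H)); rwa [counit₂_φ, one_mul] at this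
theorem counit₃_ψ : onTail Q.counitTail Q.ψ = 1 := by
  have := map_φ_ψ Q (onTail Q.counitTail); rwa [counit₃_φ, one_mul] at this

@[simp] theorem S_mul (x y : H) : Q.S (x * y) = Q.S y * Q.S x := by simp [S, antiLin]
@[simp] theorem S_one : Q.S 1 = 1 := by simp [S, antiLin]
@[simp] theorem S_Sinv (x : H) : Q.S (Q.Sinv x) = x := by simp [S, Sinv, antiLin]

@[simp] theorem Δ_mul (x y : H) : Q.Δ (x * y) = Q.Δ x * Q.Δ y := map_mul Q.comul x y
@[simp] theorem Δ_one : Q.Δ 1 = 1 := map_one Q.comul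

theorem counit_S (h : H) : Q.counit (Q.S h) = Q.counit h := by
  have h1 : ∀ u : H ⊗[k] H, Q.counit (contrA Q.S Q.alpha u) =
      Q.counit (Q.S (Q.counitTail u)) := by
    intro u
    induction u with
    | zero => simp
    | add x y hx hy => simp only [map_add, hx, hy]
    | tmul x y => simp [contrA_tmul, Q.counit_alpha, mul_comm]
  have h2 := h1 (Q.comul h)
  rw [counitTail_comul] at h2
  rw [← h2]
  have := Q.antipode_alpha h
  unfold S
  rw [this]; simp [Q.counit_alpha]

theorem contrA_Δ (h : H) : contrA Q.S Q.alpha (Q.Δ h) = Q.counit h • Q.alpha :=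
  Q.antipode_alpha h
theorem contrB_Δ (h : H) : contrB Q.S Q.beta (Q.Δ h) = Q.counit h • Q.beta :=
  Q.antipode_beta h

/-- `(Δ ⊗ id)(Δ(h))` -/
def Δ21 (h : H) : H ⊗[k] (H ⊗[k] H) := Q.comulHead H (Q.Δ h)

/-- `(id ⊗ Δ)(Δ(h))` -/
def Δ12 (h : H) : H ⊗[k] (H ⊗[k] H) := onTail Q.comul (Q.Δ h)

theorem Δ12_mul_φ (h : H) : Q.Δ12 h * Q.φ = Q.φ * Q.Δ21 h := by
  have h1 : Q.Δ12 h = Q.φ * Q.Δ21 h * Q.ψ := Q.quasi_coassoc h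
  rw [h1]; simp [mul_assoc]

theorem ψ_mul_Δ12 (h : H) : Q.ψ * Q.Δ12 h = Q.Δ21 h * Q.ψ := by
  have h1 : Q.Δ12 h = Q.φ * Q.Δ21 h * Q.ψ := Q.quasi_coassoc h
  rw [h1]; simp [← mul_assoc]

/-! ### The elements `pᴿ` and `qᴸ` -/

open TensorProduct (map_tmul)

/-- The operator attached to `x ⊗ y ⊗ z`: `r ↦ (x ⊗ y) r (1 ⊗ S(z))`, on `H ⊗ H`. -/
def ract : H ⊗[k] (H ⊗[k] H) →ₐ[k] Module.End k (H ⊗[k] H) := boxAct lreg Q.sandwich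

theorem ract_tmul (x y z : H) (r : H ⊗[k] H) :
    Q.ract (x ⊗ₜ (y ⊗ₜ z)) r = (x ⊗ₜ y) * r * (1 ⊗ₜ Q.S z) := by
  induction r with
  | zero => simp
  | add r s hr hs => simp only [map_add, mul_add, add_mul, hr, hs]
  | tmul r s => simp [ract, boxAct_tmul, sandwich_tmul]

theorem ract_app (u : H ⊗[k] H) (z : H) (r : H ⊗[k] H) :
    Q.ract (app u z) r = u * r * (1 ⊗ₜ Q.S z) := by
  induction u with
  | zero => simp
  | add x y hx hy => simp only [app_add, map_add, LinearMap.add_apply, add_mul, hx, hy]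
  | tmul x y => rw [app_tmul, ract_tmul]

theorem ract_mul_left_tmul (t : H ⊗[k] (H ⊗[k] H)) (r : H ⊗[k] H) (c : H) :
    Q.ract t (r * (c ⊗ₜ 1)) = Q.ract t r * (c ⊗ₜ 1) := by
  induction t using tensor₃_induction with
  | zero => simp
  | add s t hs ht => simp only [map_add, LinearMap.add_apply, add_mul, hs, ht]
  | tmul x y z => simp only [ract_tmul, mul_assoc]; simp

theorem contrB_mul_tmul (u : H ⊗[k] H) (x y : H) :
    contrB Q.S Q.beta ((x ⊗ₜ y) * u) = x * contrB Q.S Q.beta u * Q.S y := by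
  induction u with
  | zero => simp
  | add u v hu hv => simp only [mul_add, add_mul, map_add, hu, hv]
  | tmul a b => simp [contrB_tmul, mul_assoc]

theorem contrA_mul_tmul (u : H ⊗[k] H) (x y : H) :
    contrA Q.S Q.alpha (u * (x ⊗ₜ y)) = Q.S x * contrA Q.S Q.alpha u * y := by
  induction u with
  | zero => simp
  | add u v hu hv => simp only [mul_add, add_mul, map_add, hu, hv]
  | tmul a b => simp [contrA_tmul, mul_assoc]

theorem sandwich_apply_beta (u : H ⊗[k] H) : Q.sandwich u Q.beta = contrB Q.S Q.beta u := by
  induction u with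
  | zero => simp
  | add u v hu hv => simp only [map_add, LinearMap.add_apply, hu, hv]
  | tmul a b => simp [contrB_tmul, sandwich_tmul]

theorem pR_eq : Q.pR = Q.ract Q.ψ (1 ⊗ₜ Q.beta) := by
  have h : ∀ t, TensorProduct.map LinearMap.id (contrB Q.S Q.beta) t =
      Q.ract t (1 ⊗ₜ Q.beta) := by
    intro t
    induction t using tensor₃_induction with
    | zero => simp
    | add s t hs ht => simp only [map_add, LinearMap.add_apply, hs, ht]
    | tmul x y z => simp [ract_tmul, contrB_tmul]
  exact h _

/-- `x ⊗ y ↦ Δ(x) pᴿ (1 ⊗ S(y))` -/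
def pRMap : H ⊗[k] H →ₗ[k] H ⊗[k] H :=
  mulMap (LinearMap.mulRight k Q.pR ∘ₗ Q.Δ) (TensorProduct.mk k H H 1 ∘ₗ Q.S)

theorem pRMap_tmul (x y : H) : Q.pRMap (x ⊗ₜ y) = Q.Δ x * Q.pR * (1 ⊗ₜ Q.S y) := by
  simp [pRMap]

theorem ract_comulHead_pR (u : H ⊗[k] H) : Q.ract (Q.comulHead H u) Q.pR = Q.pRMap u := by
  induction u with
  | zero => simp
  | add u v hu hv => simp only [map_add, LinearMap.add_apply, hu, hv]
  | tmul x y => rw [comulHead_tmul, ract_app, pRMap_tmul]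

theorem ract_onTail_comul (u : H ⊗[k] H) :
    Q.ract (onTail Q.comul u) (1 ⊗ₜ Q.beta) = (Q.counitTail u) ⊗ₜ Q.beta := by
  induction u with
  | zero => simp
  | add u v hu hv => simp only [map_add, LinearMap.add_apply, TensorProduct.add_tmul, hu, hv]
  | tmul x y =>
    have := Q.contrB_Δ y
    simp only [Δ, AlgHom.toLinearMap_apply] at this
    simp [ract, boxAct_tmul, sandwich_apply_beta, this, TensorProduct.smul_tmul]

/-- `Δ(h₁) pᴿ (1 ⊗ S(h₂)) = pᴿ (h ⊗ 1)` -/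
theorem pRMap_Δ (h : H) : Q.pRMap (Q.Δ h) = Q.pR * (h ⊗ₜ 1) := by
  rw [← ract_comulHead_pR, pR_eq, ← Module.End.mul_apply, ← map_mul]
  change Q.ract (Q.Δ21 h * Q.ψ) _ = _
  rw [← ψ_mul_Δ12, map_mul, Module.End.mul_apply, Δ12, ract_onTail_comul, counitTail_Δ,
    ← ract_mul_left_tmul]
  simp

/-- The operator attached to `x ⊗ y ⊗ z ⊗ w`: `r ⊗ s ↦ x r ⊗ (y ⊗ z) s (1 ⊗ S(w))`. -/
def ract' : H ⊗[k] (H ⊗[k] (H ⊗[k] H)) →ₐ[k] Module.End k (H ⊗[k] (H ⊗[k] H)) :=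
  boxAct lreg Q.ract

theorem ract'_tmul (x : H) (t : H ⊗[k] (H ⊗[k] H)) (r : H) (s : H ⊗[k] H) :
    Q.ract' (x ⊗ₜ t) (r ⊗ₜ s) = (x * r) ⊗ₜ Q.ract t s := by
  simp [ract', boxAct_tmul]

/-- `φ₁ pᴿ₁₍₁₎ ⊗ φ₂ pᴿ₁₍₂₎ ⊗ φ₃ pᴿ₂ = φ̄₁ ⊗ Δ(φ̄₂) pᴿ (1 ⊗ S(φ̄₃))` -/
theorem φ_mul_comulHead_pR :
    Q.φ * Q.comulHead H Q.pR = LinearMap.lTensor H Q.pRMap Q.ψ := by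
  have h1 : ∀ t, Q.comulHead H (Q.ract t (1 ⊗ₜ Q.beta)) =
      Q.ract' (Q.d₁ t) (1 ⊗ₜ (1 ⊗ₜ Q.beta)) := by
    intro t
    induction t using tensor₃_induction with
    | zero => simp
    | add s t hs ht => simp only [map_add, LinearMap.add_apply, hs, ht]
    | tmul x y z =>
      rw [ract_tmul, d₁_tmul]
      simp only [Algebra.TensorProduct.tmul_mul_tmul, mul_one, comulHead_tmul]
      induction Q.Δ x with
      | zero => simp
      | add u v hu hv => simp only [app_add, map_add, LinearMap.add_apply, hu, hv]
      | tmul a b => simp [ract'_tmul, ract_tmul]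
  have h2 : ∀ (t : H ⊗[k] (H ⊗[k] H)) r, t * r = Q.ract' (padR t) r := by
    intro t r
    induction t using tensor₃_induction with
    | zero => simp
    | add s t hs ht => simp only [map_add, LinearMap.add_apply, add_mul, hs, ht]
    | tmul x y z =>
      rw [padR_tmul]
      induction r with
      | zero => simp
      | add u v hu hv => simp only [map_add, mul_add, hu, hv]
      | tmul a b => simp [ract'_tmul, ract_tmul, ← Algebra.TensorProduct.one_def]
  have h3 : ∀ t, Q.ract' (Q.d₃ t) (1 ⊗ₜ (1 ⊗ₜ Q.beta)) =
      Q.ract' (onTail includeLeft (onTail Q.counitTail t)) (1 ⊗ₜ (1 ⊗ₜ Q.beta)) := by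
    intro t
    induction t using tensor₃_induction with
    | zero => simp
    | add s t hs ht => simp only [map_add, LinearMap.add_apply, hs, ht]
    | tmul x y z =>
      have := Q.ract_onTail_comul (y ⊗ₜ z)
      simp only [Algebra.TensorProduct.map_tmul, AlgHom.coe_id, id_eq] at this
      rw [d₃_tmul, ract'_tmul]
      change (x * 1) ⊗ₜ[k] Q.ract (y ⊗ₜ Q.comul z) (1 ⊗ₜ Q.beta) = _
      rw [this]
      simp [ract'_tmul, Algebra.TensorProduct.one_def, ract_tmul, ← TensorProduct.smul_tmul']
  have h4 : ∀ t, Q.ract' (Q.d₂ t) (1 ⊗ₜ Q.pR) = LinearMap.lTensor H Q.pRMap t := by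
    intro t
    induction t using tensor₃_induction with
    | zero => simp
    | add s t hs ht => simp only [map_add, LinearMap.add_apply, hs, ht]
    | tmul x y z =>
      rw [d₂_tmul, ract'_tmul, ract_app, LinearMap.lTensor_tmul, pRMap_tmul, mul_one]
  -- both sides are values of `ract'` on `1 ⊗ 1 ⊗ β`; by the pentagon the left one is taken at
  -- `(φ ⊗ 1) (Δ ⊗ id ⊗ id)(φ⁻¹) = (id ⊗ Δ ⊗ id)(φ⁻¹) (1 ⊗ φ⁻¹) (id ⊗ id ⊗ Δ)(φ)`, whose last
  -- factor acts trivially because `h₁ β S(h₂) = ε(h) β`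
  rw [← h4, h2, pR_eq, h1, ← Module.End.mul_apply, ← map_mul, padR_φ_d₁_ψ, map_mul, map_mul,
    Module.End.mul_apply, Module.End.mul_apply, h3, counit₃_φ, map_one, map_one, padL_apply]
  rw [Module.End.one_apply, ract'_tmul, mul_one]

/-- `x ⊗ y ⊗ z ↦ x β S(y) α z` -/
def zig : H ⊗[k] (H ⊗[k] H) →ₗ[k] H :=
  mulMap (LinearMap.mulRight k Q.beta) (contrA Q.S Q.alpha)

theorem zig_tmul (x : H) (u : H ⊗[k] H) :
    Q.zig (x ⊗ₜ u) = x * Q.beta * contrA Q.S Q.alpha u := by simp [zig]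

theorem zig_φ : Q.zig Q.φ = 1 := Q.phi_antipode

/-- `x ⊗ y ⊗ z ↦ S(x) α y β S(z)` -/
def zag : H ⊗[k] (H ⊗[k] H) →ₗ[k] H :=
  mulMap (LinearMap.mulRight k Q.alpha ∘ₗ Q.S) (contrB Q.S Q.beta)

theorem zag_tmul (x : H) (u : H ⊗[k] H) :
    Q.zag (x ⊗ₜ u) = Q.S x * Q.alpha * contrB Q.S Q.beta u := by simp [zag]

theorem zag_ψ : Q.zag Q.ψ = 1 := Q.phi_inv_antipode

theorem zig_onTail_comul_mul (u : H ⊗[k] H) (t : H ⊗[k] (H ⊗[k] H)) :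
    Q.zig (onTail Q.comul u * t) = Q.counitTail u * Q.zig t := by
  induction u with
  | zero => simp
  | add u v hu hv => simp only [map_add, add_mul, hu, hv]
  | tmul x y =>
    induction t using tensor₃_induction with
    | zero => simp
    | add s t hs ht => simp only [map_add, mul_add, hs, ht]
    | tmul a b c =>
      have := Q.contrA_Δ y
      simp only [Δ, AlgHom.toLinearMap_apply] at this
      simp [zig_tmul, contrA_mul_tmul, this, contrA_tmul, mul_assoc]

theorem zig_mul_comulHead (u : H ⊗[k] H) (t : H ⊗[k] (H ⊗[k] H)) :
    Q.zig (t * Q.comulHead H u) = Q.zig t * Q.counitHead H u := by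
  induction u with
  | zero => simp
  | add u v hu hv => simp only [map_add, mul_add, hu, hv]
  | tmul x y =>
    induction t using tensor₃_induction with
    | zero => simp
    | add s t hs ht => simp only [map_add, add_mul, hs, ht]
    | tmul a b c =>
      have key : ∀ u : H ⊗[k] H, Q.zig ((a ⊗ₜ (b ⊗ₜ c)) * app u y) =
          a * contrB Q.S Q.beta u * Q.S b * Q.alpha * c * y := by
        intro u
        induction u with
        | zero => simp
        | add u v hu hv => simp only [app_add, map_add, mul_add, add_mul, hu, hv]
        | tmul p q => simp [zig_tmul, contrA_tmul, contrB_tmul, mul_assoc]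
      rw [comulHead_tmul, key, contrB_Δ]
      simp [zig_tmul, contrA_tmul, mul_assoc]

/-- `x ⊗ y ⊗ z ↦ Δ(x) pᴿ (1 ⊗ S(y) α z)` -/
def pRAlphaMap : H ⊗[k] (H ⊗[k] H) →ₗ[k] H ⊗[k] H :=
  mulMap (LinearMap.mulRight k Q.pR ∘ₗ Q.Δ) (TensorProduct.mk k H H 1 ∘ₗ contrA Q.S Q.alpha)

theorem pRAlphaMap_tmul (x : H) (u : H ⊗[k] H) :
    Q.pRAlphaMap (x ⊗ₜ u) = Q.Δ x * Q.pR * (1 ⊗ₜ contrA Q.S Q.alpha u) := by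
  simp [pRAlphaMap]

/-- `Δ(φ₁) pᴿ (1 ⊗ S(φ₂) α φ₃) = 1` -/
theorem pRAlphaMap_φ : Q.pRAlphaMap Q.φ = 1 := by
  have h1 : ∀ t, Q.pRAlphaMap t = LinearMap.lTensor H Q.zig (Q.d₁ t * padR Q.ψ) := by
    intro t
    induction t using tensor₃_induction with
    | zero => simp
    | add s t hs ht => simp only [map_add, add_mul, hs, ht]
    | tmul x y z =>
      rw [d₁_tmul, pRAlphaMap_tmul, pR_eq]
      induction Q.ψ using tensor₃_induction with
      | zero => simp
      | add r s hr hs =>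
        simp only [map_add, LinearMap.add_apply, mul_add, add_mul, hr, hs]
      | tmul a b c =>
        induction Q.Δ x with
        | zero => simp
        | add u v hu hv => simp only [app_add, map_add, add_mul, hu, hv]
        | tmul p q => simp [ract_tmul, padR_tmul, zig_tmul, contrA_tmul, mul_assoc]
  have h2 : ∀ s t, LinearMap.lTensor H Q.zig (Q.d₃ s * t) =
      onTail Q.counitTail s * LinearMap.lTensor H Q.zig t := by
    intro s t
    induction s with
    | zero => simp
    | add r s hr hs => simp only [map_add, add_mul, hr, hs]
    | tmul x u =>
      induction t with
      | zero => simp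
      | add r s hr hs => simp only [map_add, mul_add, hr, hs]
      | tmul a t => simp [d₃, zig_onTail_comul_mul]
  have h3 : ∀ s t, LinearMap.lTensor H Q.zig (t * Q.d₂ s) =
      LinearMap.lTensor H Q.zig t * onTail (Q.counitHead H) s := by
    intro s t
    induction s with
    | zero => simp
    | add r s hr hs => simp only [map_add, mul_add, hr, hs]
    | tmul x u =>
      induction t with
      | zero => simp
      | add r s hr hs => simp only [map_add, add_mul, hr, hs]
      | tmul a t => simp [d₂, zig_mul_comulHead]
  -- the outer factors of `(id ⊗ id ⊗ Δ)(φ⁻¹) (1 ⊗ φ) (id ⊗ Δ ⊗ id)(φ)` collapse, and `1 ⊗ φ`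
  -- contributes `φ₁ β S(φ₂) α φ₃ = 1`
  rw [h1, d₁_φ_padR_ψ, h3, h2, counit₃_ψ, counit₂_φ, padL_apply, LinearMap.lTensor_tmul, zig_φ]
  simp [Algebra.TensorProduct.one_def]

theorem tmul_mul_tmul_assoc (a b c d : H) (X : H ⊗[k] H) :
    (a ⊗ₜ[k] b) * ((c ⊗ₜ[k] d) * X) = ((a * c) ⊗ₜ[k] (b * d)) * X := by
  rw [← mul_assoc, Algebra.TensorProduct.tmul_mul_tmul]

/-- `x ⊗ y ⊗ z ↦ S(x) α y ⊗ z` -/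
def contrAHead : H ⊗[k] (H ⊗[k] H) →ₗ[k] H ⊗[k] H :=
  TensorProduct.map (contrA Q.S Q.alpha) LinearMap.id ∘ₗ
    (TensorProduct.assoc k H H H).symm.toLinearMap

theorem contrAHead_tmul (x y z : H) :
    Q.contrAHead (x ⊗ₜ (y ⊗ₜ z)) = (Q.S x * Q.alpha * y) ⊗ₜ z := by
  simp [contrAHead, contrA_tmul]

theorem qL_eq : Q.qL = Q.contrAHead Q.ψ := rfl

theorem contrAHead_mul (t : H ⊗[k] (H ⊗[k] H)) (x : H) (u : H ⊗[k] H) :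
    Q.contrAHead (t * (x ⊗ₜ u)) = (Q.S x ⊗ₜ 1) * Q.contrAHead t * u := by
  induction u with
  | zero => simp
  | add u v hu hv => simp only [TensorProduct.tmul_add, map_add, mul_add, hu, hv]
  | tmul y z =>
    induction t using tensor₃_induction with
    | zero => simp
    | add s t hs ht => simp only [map_add, add_mul, mul_add, hs, ht]
    | tmul a b c => simp [contrAHead_tmul, mul_assoc]

theorem contrAHead_comulHead_mul (u : H ⊗[k] H) (t : H ⊗[k] (H ⊗[k] H)) :
    Q.contrAHead (Q.comulHead H u * t) = (1 ⊗ₜ Q.counitHead H u) * Q.contrAHead t := by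
  induction u with
  | zero => simp
  | add u v hu hv => simp only [TensorProduct.tmul_add, map_add, add_mul, hu, hv]
  | tmul x y =>
    induction t using tensor₃_induction with
    | zero => simp
    | add s t hs ht => simp only [map_add, mul_add, hs, ht]
    | tmul a b c =>
      have key : ∀ u : H ⊗[k] H, Q.contrAHead (app u y * (a ⊗ₜ (b ⊗ₜ c))) =
          (Q.S a * contrA Q.S Q.alpha u * b) ⊗ₜ (y * c) := by
        intro u
        induction u with
        | zero => simp
        | add u v hu hv =>
          simp only [app_add, map_add, mul_add, add_mul, hu, hv, TensorProduct.add_tmul]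
        | tmul p q => simp [contrAHead_tmul, contrA_tmul, mul_assoc]
      rw [comulHead_tmul, key, contrA_Δ]
      simp [contrAHead_tmul, mul_assoc, ← TensorProduct.smul_tmul']

/-- `x ⊗ y ↦ (S(x) ⊗ 1) qᴸ Δ(y)` -/
def qLMap : H ⊗[k] H →ₗ[k] H ⊗[k] H :=
  mulMap ((TensorProduct.mk k H H).flip 1 ∘ₗ Q.S) (LinearMap.mulLeft k Q.qL ∘ₗ Q.Δ)

theorem qLMap_tmul (x y : H) : Q.qLMap (x ⊗ₜ y) = (Q.S x ⊗ₜ 1) * Q.qL * Q.Δ y := by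
  simp [qLMap, mul_assoc]

/-- `(S(h₁) ⊗ 1) qᴸ Δ(h₂) = (1 ⊗ h) qᴸ` -/
theorem qLMap_Δ (h : H) : Q.qLMap (Q.Δ h) = (1 ⊗ₜ h) * Q.qL := by
  have h1 : ∀ u, Q.qLMap u = Q.contrAHead (Q.ψ * onTail Q.comul u) := by
    intro u
    induction u with
    | zero => simp
    | add u v hu hv => simp only [map_add, mul_add, hu, hv]
    | tmul x y =>
      simp only [qLMap_tmul, Algebra.TensorProduct.map_tmul, AlgHom.coe_id, id_eq,
        contrAHead_mul, qL_eq]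
      rfl
  rw [h1]
  change Q.contrAHead (Q.ψ * Q.Δ12 h) = _
  rw [ψ_mul_Δ12, Δ21, contrAHead_comulHead_mul, counitHead_Δ, qL_eq]

/-- `x ⊗ y ⊗ z ↦ (x β S(y) ⊗ 1) qᴸ Δ(z)` -/
def betaQLMap : H ⊗[k] (H ⊗[k] H) →ₗ[k] H ⊗[k] H :=
  mulMap ((TensorProduct.mk k H H).flip 1 ∘ₗ LinearMap.mulRight k Q.beta) Q.qLMap

theorem betaQLMap_tmul (x : H) (u : H ⊗[k] H) :
    Q.betaQLMap (x ⊗ₜ u) = ((x * Q.beta) ⊗ₜ 1) * Q.qLMap u := by simp [betaQLMap]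

/-- `x ⊗ y ⊗ z ⊗ w ↦ x β S(y) α z ⊗ w` -/
def zigHead : H ⊗[k] (H ⊗[k] (H ⊗[k] H)) →ₗ[k] H ⊗[k] H :=
  mulMap ((TensorProduct.mk k H H).flip 1 ∘ₗ LinearMap.mulRight k Q.beta) Q.contrAHead

theorem zigHead_tmul (x : H) (u : H ⊗[k] (H ⊗[k] H)) :
    Q.zigHead (x ⊗ₜ u) = ((x * Q.beta) ⊗ₜ 1) * Q.contrAHead u := by simp [zigHead]

theorem zigHead_d₂_mul (s : H ⊗[k] (H ⊗[k] H)) (t : H ⊗[k] (H ⊗[k] (H ⊗[k] H))) :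
    Q.zigHead (Q.d₂ s * t) = onTail (Q.counitHead H) s * Q.zigHead t := by
  induction s with
  | zero => simp
  | add r s hr hs => simp only [map_add, add_mul, hr, hs]
  | tmul x u =>
    induction t with
    | zero => simp
    | add r s hr hs => simp only [map_add, mul_add, hr, hs]
    | tmul a t =>
      simp [d₂, zigHead_tmul, contrAHead_comulHead_mul, tmul_mul_tmul_assoc, mul_assoc]

theorem zigHead_mul_d₁ (s : H ⊗[k] (H ⊗[k] H)) (t : H ⊗[k] (H ⊗[k] (H ⊗[k] H))) :
    Q.zigHead (t * Q.d₁ s) = Q.zigHead t * Q.counitHead (H ⊗[k] H) s := by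
  induction s with
  | zero => simp
  | add r s hr hs => simp only [map_add, mul_add, hr, hs]
  | tmul x w =>
    induction t using tensor₄_induction with
    | zero => simp
    | add r s hr hs => simp only [map_add, add_mul, hr, hs]
    | tmul a b c d =>
      have key : ∀ u : H ⊗[k] H, Q.zigHead ((a ⊗ₜ (b ⊗ₜ (c ⊗ₜ d))) * app u w) =
          ((a * contrB Q.S Q.beta u * Q.S b * Q.alpha * c) ⊗ₜ d) * w := by
        intro u
        induction u with
        | zero => simp
        | add u v hu hv =>
          simp only [app_add, map_add, mul_add, add_mul, hu, hv, TensorProduct.add_tmul]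
        | tmul p q =>
          induction w with
          | zero => simp
          | add u v hu hv => simp only [TensorProduct.tmul_add, map_add, mul_add, app_tmul] at *
                             rw [hu, hv]
          | tmul y z => simp [zigHead_tmul, contrAHead_tmul, contrB_tmul, mul_assoc]
      rw [d₁_tmul, key, contrB_Δ]
      simp [zigHead_tmul, contrAHead_tmul, mul_assoc, ← TensorProduct.smul_tmul']

theorem zigHead_padR (t : H ⊗[k] (H ⊗[k] H)) : Q.zigHead (padR t) = Q.zig t ⊗ₜ 1 := by
  induction t using tensor₃_induction with
  | zero => simp
  | add s t hs ht => simp only [map_add, TensorProduct.add_tmul, hs, ht]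
  | tmul x y z => simp [padR_tmul, zigHead_tmul, contrAHead_tmul, zig_tmul, contrA_tmul, mul_assoc]

/-- The zig-zag map on the first three legs of
`(1 ⊗ φ⁻¹) (id ⊗ id ⊗ Δ)(φ) = (id ⊗ Δ ⊗ id)(φ) (φ ⊗ 1) (Δ ⊗ id ⊗ id)(φ⁻¹)`: the outer factors
collapse and the inner one is undone by the axiom `zig_φ`. -/
theorem zigHead_tauA : Q.zigHead (padL Q.ψ * Q.d₃ Q.φ) = 1 := by
  rw [padL_ψ_d₃_φ, zigHead_mul_d₁, counit₁_ψ, mul_one, zigHead_d₂_mul, counit₂_φ, one_mul,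
    zigHead_padR, zig_φ, Algebra.TensorProduct.one_def]

/-- `(φ₁ β S(φ₂) ⊗ 1) qᴸ Δ(φ₃) = 1` -/
theorem betaQLMap_φ : Q.betaQLMap Q.φ = 1 := by
  have h1 : ∀ t, Q.betaQLMap t = Q.zigHead (padL Q.ψ * Q.d₃ t) := by
    intro t
    induction t using tensor₃_induction with
    | zero => simp
    | add s t hs ht => simp only [map_add, mul_add, hs, ht]
    | tmul x y z =>
      rw [d₃_tmul, padL_apply, betaQLMap_tmul, qLMap_tmul, Algebra.TensorProduct.tmul_mul_tmul,
        zigHead_tmul, contrAHead_mul, one_mul, qL_eq]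
  rw [h1, zigHead_tauA]

/-! ### The elements `𝕒` and `𝕓` -/

/-- `x ⊗ y ⊗ z ↦ (S(y) ⊗ S(x) α) qᴸ Δ(z)` -/
def aMap : H ⊗[k] (H ⊗[k] H) →ₗ[k] H ⊗[k] H :=
  mulMap (TensorProduct.mk k H H 1 ∘ₗ LinearMap.mulRight k Q.alpha ∘ₗ Q.S) Q.qLMap

theorem aMap_tmul (x : H) (u : H ⊗[k] H) :
    Q.aMap (x ⊗ₜ u) = (1 ⊗ₜ (Q.S x * Q.alpha)) * Q.qLMap u := by simp [aMap]

/-- `𝕒 = (S(φ₂) ⊗ S(φ₁) α) qᴸ Δ(φ₃)` -/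
theorem aElt_eq : Q.aElt = Q.aMap Q.φ := by
  have h1 : ∀ t, Q.aMap t = TensorProduct.map (contrA Q.S Q.alpha) (contrA Q.S Q.alpha)
      (TensorProduct.comm k (H ⊗[k] H) (H ⊗[k] H) (outerInner (padL Q.ψ * Q.d₃ t))) := by
    intro t
    induction t using tensor₃_induction with
    | zero => simp
    | add s t hs ht => simp only [map_add, mul_add, hs, ht]
    | tmul x y z =>
      rw [d₃_tmul, padL_apply, aMap_tmul, qLMap_tmul, Algebra.TensorProduct.tmul_mul_tmul, qL_eq]
      induction Q.ψ using tensor₃_induction with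
      | zero => simp
      | add s t hs ht =>
        simp only [map_add, mul_add, add_mul, TensorProduct.tmul_add, hs, ht]
      | tmul a b c =>
        induction Q.Δ z with
        | zero => simp
        | add s t hs ht => simp only [map_add, mul_add, TensorProduct.tmul_add, hs, ht]
        | tmul p q => simp [outerInner_tmul, contrAHead_tmul, contrA_tmul, mul_assoc]
  rw [h1, aElt, tauA, Δ3_eq]
  rfl

/-- `x ⊗ y ⊗ z ↦ Δ(x) pᴿ (β S(z) ⊗ S(y))` -/
def bMap : H ⊗[k] (H ⊗[k] H) →ₗ[k] H ⊗[k] H :=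
  mulMap (LinearMap.mulRight k Q.pR ∘ₗ Q.Δ) (mulMap (TensorProduct.mk k H H 1 ∘ₗ Q.S)
    ((TensorProduct.mk k H H).flip 1 ∘ₗ LinearMap.mulLeft k Q.beta ∘ₗ Q.S))

theorem bMap_tmul (x y z : H) :
    Q.bMap (x ⊗ₜ (y ⊗ₜ z)) = Q.Δ x * Q.pR * ((Q.beta * Q.S z) ⊗ₜ Q.S y) := by simp [bMap]

/-- `𝕓 = Δ(φ₁) pᴿ (β S(φ₃) ⊗ S(φ₂))` -/
theorem bElt_eq : Q.bElt = Q.bMap Q.φ := by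
  have h1 : ∀ t, Q.bMap t = TensorProduct.map (contrB Q.S Q.beta) (contrB Q.S Q.beta)
      (outerInner (Q.d₁ t * padR Q.ψ)) := by
    intro t
    induction t using tensor₃_induction with
    | zero => simp
    | add s t hs ht => simp only [map_add, add_mul, hs, ht]
    | tmul x y z =>
      rw [d₁_tmul, bMap_tmul, pR_eq]
      induction Q.ψ using tensor₃_induction with
      | zero => simp
      | add s t hs ht =>
        simp only [map_add, LinearMap.add_apply, mul_add, add_mul, hs, ht]
      | tmul a b c =>
        induction Q.Δ x with
        | zero => simp
        | add s t hs ht => simp only [app_add, map_add, add_mul, hs, ht]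
        | tmul p q => simp [outerInner_tmul, ract_tmul, padR_tmul, contrB_tmul, mul_assoc]
  rw [h1, bElt, Δ1_eq, pad_eq]

theorem SSΔcop_mul (x y : H) : Q.SSΔcop (x * y) = Q.SSΔcop y * Q.SSΔcop x := by
  simp only [SSΔcop, LinearMap.comp_apply, Δ_mul]
  induction Q.Δ x with
  | zero => simp
  | add s t hs ht => simp only [map_add, add_mul, mul_add, hs, ht]
  | tmul a b =>
    induction Q.Δ y with
    | zero => simp
    | add s t hs ht => simp only [map_add, add_mul, mul_add, hs, ht]
    | tmul c d => simp

theorem SSΔcop_one : Q.SSΔcop 1 = 1 := by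
  simp [SSΔcop, Algebra.TensorProduct.one_def]

/-- The linear map `x ⊗ y ↦ S(y) ⊗ S(x)`, so that `(S ⊗ S) Δᶜᵒᵖ = SScop ∘ Δ`. -/
def SScop : H ⊗[k] H →ₗ[k] H ⊗[k] H :=
  TensorProduct.map Q.S Q.S ∘ₗ (TensorProduct.comm k H H).toLinearMap

theorem SScop_tmul (x y : H) : Q.SScop (x ⊗ₜ y) = Q.S y ⊗ₜ Q.S x := by simp [SScop]

theorem SSΔcop_apply (x : H) : Q.SSΔcop x = Q.SScop (Q.Δ x) := rfl

/-- `Δ12 h` collapses in two steps: on the last two legs by `qLMap_Δ`, then by the axiom for `α`. -/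
theorem aMap_onTail_comul_mul (h : H) (t : H ⊗[k] (H ⊗[k] H)) :
    Q.aMap (Q.Δ12 h * t) = Q.counit h • Q.aMap t := by
  induction t using tensor₃_induction with
  | zero => simp
  | add s t hs ht => simp only [map_add, mul_add, smul_add, hs, ht]
  | tmul x y z =>
    have h0 : ∀ v : H ⊗[k] H, Q.qLMap (v * (y ⊗ₜ z)) =
        (Q.S y ⊗ₜ 1) * Q.qLMap v * Q.Δ z := by
      intro v
      induction v with
      | zero => simp
      | add u v hu hv => simp only [map_add, mul_add, add_mul, hu, hv]
      | tmul a b => simp [qLMap_tmul, mul_assoc, tmul_mul_tmul_assoc]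
    have h1 : ∀ u, Q.aMap (onTail Q.comul u * (x ⊗ₜ (y ⊗ₜ z))) =
        (Q.S y ⊗ₜ (Q.S x * contrA Q.S Q.alpha u)) * Q.qL * Q.Δ z := by
      intro u
      induction u with
      | zero => simp
      | add u v hu hv => simp only [map_add, mul_add, add_mul, TensorProduct.tmul_add, hu, hv]
      | tmul a b =>
        simp only [Algebra.TensorProduct.map_tmul, AlgHom.coe_id, id_eq,
          Algebra.TensorProduct.tmul_mul_tmul, aMap_tmul]
        change _ * Q.qLMap (Q.Δ b * _) = _
        rw [h0, qLMap_Δ]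
        simp [contrA_tmul, mul_assoc, tmul_mul_tmul_assoc]
    rw [Δ12, h1, contrA_Δ]
    simp [aMap_tmul, qLMap_tmul, mul_assoc, tmul_mul_tmul_assoc]

/-- `Δ21 h` collapses in two steps: on the first two legs by `pRMap_Δ`, then by the axiom for
`β`. -/
theorem bMap_mul_Δ21 (h : H) (t : H ⊗[k] (H ⊗[k] H)) :
    Q.bMap (t * Q.Δ21 h) = Q.counit h • Q.bMap t := by
  induction t using tensor₃_induction with
  | zero => simp
  | add s t hs ht => simp only [map_add, add_mul, smul_add, hs, ht]
  | tmul x y z =>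
    have h0 : ∀ (v : H ⊗[k] H) b, Q.bMap ((x ⊗ₜ (y ⊗ₜ z)) * app v b) =
        Q.Δ x * Q.pRMap v * ((Q.beta * Q.S b * Q.S z) ⊗ₜ Q.S y) := by
      intro v b
      induction v with
      | zero => simp
      | add u v hu hv => simp only [app_add, map_add, mul_add, add_mul, hu, hv]
      | tmul a b => simp [bMap_tmul, pRMap_tmul, mul_assoc]
    have h1 : ∀ u, Q.bMap ((x ⊗ₜ (y ⊗ₜ z)) * Q.comulHead H u) =
        Q.Δ x * Q.pR * ((contrB Q.S Q.beta u * Q.S z) ⊗ₜ Q.S y) := by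
      intro u
      induction u with
      | zero => simp
      | add u v hu hv => simp only [map_add, mul_add, add_mul, TensorProduct.add_tmul, hu, hv]
      | tmul a b =>
        rw [comulHead_tmul, h0, pRMap_Δ]
        simp [contrB_tmul, mul_assoc]
    rw [Δ21, h1, contrB_Δ]
    simp [bMap_tmul, ← TensorProduct.smul_tmul']

/-- `(S ⊗ S)(Δᶜᵒᵖ(h₁)) 𝕒 Δ(h₂) = ε(h) 𝕒` -/
theorem aElt_Δ (h : H) : mulMap (LinearMap.mulRight k Q.aElt ∘ₗ Q.SSΔcop) Q.Δ (Q.Δ h) =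
    Q.counit h • Q.aElt := by
  have h1 : ∀ u, mulMap (LinearMap.mulRight k Q.aElt ∘ₗ Q.SSΔcop) Q.Δ u =
      Q.aMap (Q.φ * Q.comulHead H u) := by
    intro u
    induction u with
    | zero => simp
    | add u v hu hv => simp only [map_add, mul_add, hu, hv]
    | tmul x y =>
      rw [mulMap_tmul, comulHead_tmul, aElt_eq]
      simp only [LinearMap.comp_apply, LinearMap.mulRight_apply, SSΔcop_apply]
      induction Q.φ using tensor₃_induction with
      | zero => simp
      | add s t hs ht => simp only [map_add, mul_add, add_mul, hs, ht]
      | tmul a b c =>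
        induction Q.Δ x with
        | zero => simp
        | add s t hs ht => simp only [app_add, map_add, mul_add, add_mul, hs, ht]
        | tmul p q =>
          simp [aMap_tmul, qLMap_tmul, SScop_tmul, mul_assoc, tmul_mul_tmul_assoc]
  rw [h1]
  change Q.aMap (Q.φ * Q.Δ21 h) = _
  rw [← Δ12_mul_φ, aMap_onTail_comul_mul, aElt_eq]

/-- `Δ(h₁) 𝕓 (S ⊗ S)(Δᶜᵒᵖ(h₂)) = ε(h) 𝕓` -/
theorem bElt_Δ (h : H) : mulMap (LinearMap.mulRight k Q.bElt ∘ₗ Q.Δ) Q.SSΔcop (Q.Δ h) =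
    Q.counit h • Q.bElt := by
  have h1 : ∀ u, mulMap (LinearMap.mulRight k Q.bElt ∘ₗ Q.Δ) Q.SSΔcop u =
      Q.bMap (onTail Q.comul u * Q.φ) := by
    intro u
    induction u with
    | zero => simp
    | add u v hu hv => simp only [map_add, add_mul, hu, hv]
    | tmul x y =>
      rw [mulMap_tmul, Algebra.TensorProduct.map_tmul, bElt_eq]
      simp only [LinearMap.comp_apply, LinearMap.mulRight_apply, SSΔcop_apply, AlgHom.coe_id,
        id_eq]
      change _ = Q.bMap ((x ⊗ₜ[k] Q.Δ y) * _)
      induction Q.φ using tensor₃_induction with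
      | zero => simp
      | add s t hs ht => simp only [map_add, mul_add, add_mul, hs, ht]
      | tmul a b c =>
        induction Q.Δ y with
        | zero => simp
        | add s t hs ht => simp only [TensorProduct.tmul_add, map_add, mul_add, add_mul, hs, ht]
        | tmul p q => simp [bMap_tmul, SScop_tmul, mul_assoc]
  rw [h1]
  change Q.bMap (Q.Δ12 h * Q.φ) = _
  rw [Δ12_mul_φ, bMap_mul_Δ21, bElt_eq]

/-! ### Antipodes along an algebra homomorphism -/

section AntipodeAlong

variable {B : Type*} [Ring B] [Algebra k B]

/-- `(T, a, b)` is an antipode along the algebra homomorphism `g : H → B`: it satisfies the axioms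
of the antipode `(S, α, β)` with `H` acting through `g`. For `g = id` this is the antipode of
`H`. -/
structure IsAntipodeAlong (g : H →ₐ[k] B) (T : H →ₗ[k] B) (a b : B) : Prop where
  map_mul : ∀ x y, T (x * y) = T y * T x
  map_one : T 1 = 1
  alpha : ∀ h, mulMap (LinearMap.mulRight k a ∘ₗ T) g.toLinearMap (Q.Δ h) = Q.counit h • a
  beta : ∀ h, mulMap (LinearMap.mulRight k b ∘ₗ g.toLinearMap) T (Q.Δ h) = Q.counit h • b
  zig : mulMap (LinearMap.mulRight k b ∘ₗ g.toLinearMap)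
    (mulMap (LinearMap.mulRight k a ∘ₗ T) g.toLinearMap) Q.φ = 1
  zag : mulMap (LinearMap.mulRight k a ∘ₗ T)
    (mulMap (LinearMap.mulRight k b ∘ₗ g.toLinearMap) T) Q.ψ = 1

/-- `x ⊗ y ⊗ z ↦ T'(x) a' g(y) b T(z)` -/
def compareMap (g : H →ₐ[k] B) (T' : H →ₗ[k] B) (a' b : B) (T : H →ₗ[k] B) :
    H ⊗[k] (H ⊗[k] H) →ₗ[k] B :=
  mulMap (LinearMap.mulRight k a' ∘ₗ T') (mulMap (LinearMap.mulRight k b ∘ₗ g.toLinearMap) T)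

theorem compareMap_tmul (g : H →ₐ[k] B) (T' : H →ₗ[k] B) (a' b : B) (T : H →ₗ[k] B) (x y z : H) :
    compareMap g T' a' b T (x ⊗ₜ (y ⊗ₜ z)) = T' x * a' * (g y * b * T z) := by
  simp [compareMap]

variable {Q} {g : H →ₐ[k] B} {T T' : H →ₗ[k] B} {a a' b b' : B}

theorem IsAntipodeAlong.alpha_mul (hT : Q.IsAntipodeAlong g T a b) (x y : H) (u : H ⊗[k] H) :
    mulMap (LinearMap.mulRight k a ∘ₗ T) g.toLinearMap (u * (x ⊗ₜ y)) =
      T x * mulMap (LinearMap.mulRight k a ∘ₗ T) g.toLinearMap u * g y := by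
  induction u with
  | zero => simp
  | add u v hu hv => simp only [_root_.map_add, mul_add, add_mul, hu, hv]
  | tmul p q => simp [hT.map_mul, mul_assoc]

theorem IsAntipodeAlong.beta_mul (hT : Q.IsAntipodeAlong g T a b) (x y : H) (u : H ⊗[k] H) :
    mulMap (LinearMap.mulRight k b ∘ₗ g.toLinearMap) T ((x ⊗ₜ y) * u) =
      g x * mulMap (LinearMap.mulRight k b ∘ₗ g.toLinearMap) T u * T y := by
  induction u with
  | zero => simp
  | add u v hu hv => simp only [_root_.map_add, mul_add, add_mul, hu, hv]
  | tmul p q => simp [hT.map_mul, mul_assoc]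

/-- The comparison element `T'(φ̄₁) a' g(φ̄₂) b T(φ̄₃)` intertwines `T` and `T'`. -/
theorem IsAntipodeAlong.compare_intertwines (hT : Q.IsAntipodeAlong g T a b)
    (hT' : Q.IsAntipodeAlong g T' a' b') (h : H) :
    T' h * compareMap g T' a' b T Q.ψ = compareMap g T' a' b T Q.ψ * T h := by
  -- a factor `Δ` on the last two legs meets `b` and collapses; one on the first two legs meets `a'`
  have h1 : ∀ (u : H ⊗[k] H) t, compareMap g T' a' b T (t * onTail Q.comul u) =
      T' (Q.counitTail u) * compareMap g T' a' b T t := by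
    intro u t
    induction u with
    | zero => simp
    | add u v hu hv => simp only [_root_.map_add, mul_add, add_mul, hu, hv]
    | tmul x y =>
      induction t using tensor₃_induction with
      | zero => simp
      | add s t hs ht => simp only [_root_.map_add, mul_add, add_mul, hs, ht]
      | tmul p q r =>
        have := hT.beta_mul q r (Q.Δ y)
        rw [hT.beta] at this
        simp only [Algebra.TensorProduct.map_tmul, Algebra.TensorProduct.tmul_mul_tmul, compareMap,
          mulMap_tmul (k := k) (N := H ⊗[k] H)]
        change _ * mulMap _ _ ((q ⊗ₜ[k] r) * Q.Δ y) = _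
        rw [this]
        simp [hT'.map_mul, mul_assoc]
  have h2 : ∀ (u : H ⊗[k] H) t, compareMap g T' a' b T (Q.comulHead H u * t) =
      compareMap g T' a' b T t * T (Q.counitHead H u) := by
    intro u t
    induction u with
    | zero => simp
    | add u v hu hv => simp only [_root_.map_add, mul_add, add_mul, hu, hv]
    | tmul x y =>
      induction t using tensor₃_induction with
      | zero => simp
      | add s t hs ht => simp only [_root_.map_add, mul_add, add_mul, hs, ht]
      | tmul p q r =>
        have key : ∀ u : H ⊗[k] H, compareMap g T' a' b T (app u y * (p ⊗ₜ (q ⊗ₜ r))) =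
            mulMap (LinearMap.mulRight k a' ∘ₗ T') g.toLinearMap (u * (p ⊗ₜ q)) *
              (b * T (y * r)) := by
          intro u
          induction u with
          | zero => simp
          | add u v hu hv => simp only [app_add, _root_.map_add, add_mul, hu, hv]
          | tmul c d => simp [compareMap_tmul, mul_assoc]
        rw [comulHead_tmul, key, hT'.alpha_mul, hT'.alpha]
        simp [compareMap_tmul, hT.map_mul, mul_assoc]
  have h3 := h1 (Q.Δ h) Q.ψ
  rw [counitTail_Δ] at h3
  have h4 := h2 (Q.Δ h) Q.ψ
  rw [counitHead_Δ] at h4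
  rw [← h3, ← h4]
  exact congrArg _ (Q.ψ_mul_Δ12 h)

/-- `b' F = b` for the comparison element `F` -/
theorem IsAntipodeAlong.beta_mul_compare (hT : Q.IsAntipodeAlong g T a b)
    (hT' : Q.IsAntipodeAlong g T' a' b') :
    b' * compareMap g T' a' b T Q.ψ = b := by
  -- `W c d (x ⊗ y ⊗ z ⊗ w) = g(x) c T'(y) a' g(z) d T(w)`, so that `W b' b (1 ⊗ φ⁻¹)` is the
  -- left-hand side; the pentagon rewrites `1 ⊗ φ⁻¹` as a product in which every factor but one
  -- collapses
  let W (c d : B) : H ⊗[k] (H ⊗[k] (H ⊗[k] H)) →ₗ[k] B :=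
    mulMap (LinearMap.mulRight k c ∘ₗ g.toLinearMap) (compareMap g T' a' d T)
  have hW : ∀ c d x y z w, W c d (x ⊗ₜ (y ⊗ₜ (z ⊗ₜ w))) =
      g x * c * (T' y * a' * (g z * d * T w)) := by
    intro c d x y z w; simp [W, compareMap_tmul]
  let c : H ⊗[k] H →ₗ[k] B := mulMap (LinearMap.mulRight k b' ∘ₗ g.toLinearMap) T'
  let d : H ⊗[k] H →ₗ[k] B := mulMap (LinearMap.mulRight k b ∘ₗ g.toLinearMap) T
  have hc : c 1 = b' := by simp [c, Algebra.TensorProduct.one_def, hT'.map_one]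
  have hd : d 1 = b := by simp [d, Algebra.TensorProduct.one_def, hT.map_one]
  have h0 : W b' b (padL Q.ψ) = b' * compareMap g T' a' b T Q.ψ := by simp [W, padL_apply]
  have h1 : ∀ s t, W b' b (Q.d₂ s * t) =
      mulMap (LinearMap.mulRight k (W b' b t) ∘ₗ g.toLinearMap) T
        (onTail (Q.counitHead H) s) := by
    intro s t
    induction s using tensor₃_induction with
    | zero => simp
    | add r s hr hs => simp only [_root_.map_add, add_mul, hr, hs]
    | tmul x y z =>
      induction t using tensor₄_induction with
      | zero => simp
      | add r s hr hs =>
        rw [mul_add, _root_.map_add, hr, hs]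
        simp [mul_add, add_mul]
      | tmul c d e f =>
        have key : ∀ u : H ⊗[k] H, W b' b ((x ⊗ₜ app u z) * (c ⊗ₜ (d ⊗ₜ (e ⊗ₜ f)))) =
            g (x * c) * b' * mulMap (LinearMap.mulRight k a' ∘ₗ T') g.toLinearMap (u * (d ⊗ₜ e)) *
              (b * T (z * f)) := by
          intro u
          induction u with
          | zero => simp
          | add u v hu hv =>
            simp only [app_add, TensorProduct.tmul_add, _root_.map_add, add_mul, mul_add, hu, hv]
          | tmul c d => simp [hW, mul_assoc]
        rw [d₂_tmul, key, hT'.alpha_mul, hT'.alpha]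
        simp [hW, hT.map_mul, mul_assoc]
  have h2 : ∀ s t, W b' b (t * Q.d₃ s) = W (c (onTail Q.counitTail s)) b t := by
    intro s t
    induction t using tensor₄_induction with
    | zero => simp
    | add r s hr hs => simp only [_root_.map_add, add_mul, hr, hs]
    | tmul p q r w =>
      induction s using tensor₃_induction with
      | zero => simp [hW]
      | add r s hr hs => simp only [_root_.map_add, hW, mul_add, add_mul] at *; rw [hr, hs]
      | tmul x y z =>
        have key : ∀ u : H ⊗[k] H, W b' b ((p ⊗ₜ (q ⊗ₜ (r ⊗ₜ w))) * (x ⊗ₜ (y ⊗ₜ u))) =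
            g (p * x) * b' * (T' (q * y) * a' * d ((r ⊗ₜ w) * u)) := by
          intro u
          induction u with
          | zero => simp
          | add u v hu hv =>
            simp only [TensorProduct.tmul_add, _root_.map_add, mul_add, hu, hv]
          | tmul c e => simp [hW, d]
        rw [d₃_tmul, key, hT.beta_mul, hT.beta]
        simp [hW, hT'.map_mul, mul_assoc, c]
  have h3 : ∀ s t, W b' b (t * Q.d₁ s) = W b' (d (Q.counitHead _ s)) t := by
    intro s t
    induction t using tensor₄_induction with
    | zero => simp
    | add r s hr hs => simp only [_root_.map_add, add_mul, hr, hs]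
    | tmul p q r w =>
      induction s using tensor₃_induction with
      | zero => simp [hW]
      | add r s hr hs => simp only [_root_.map_add, hW, mul_add, add_mul] at *; rw [hr, hs]
      | tmul x y z =>
        have key : ∀ u : H ⊗[k] H,
            W b' b ((p ⊗ₜ (q ⊗ₜ (r ⊗ₜ w))) * app u (y ⊗ₜ z)) =
            c ((p ⊗ₜ q) * u) * a' * (g (r * y) * b * T (w * z)) := by
          intro u
          induction u with
          | zero => simp
          | add u v hu hv => simp only [app_add, _root_.map_add, mul_add, add_mul, hu, hv]
          | tmul e f => simp [hW, c, mul_assoc]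
        rw [d₁_tmul, key, hT'.beta_mul, hT'.beta]
        simp [hW, hT.map_mul, mul_assoc, d]
  have h4 : ∀ t, W b' b (padR t) = mulMap (LinearMap.mulRight k b' ∘ₗ g.toLinearMap)
      (mulMap (LinearMap.mulRight k a' ∘ₗ T') g.toLinearMap) t * b := by
    intro t
    induction t using tensor₃_induction with
    | zero => simp
    | add r s hr hs => simp only [_root_.map_add, add_mul, hr, hs]
    | tmul x y z => simp [padR_tmul, hW, hT.map_one, mul_assoc]
  have h5 : padL Q.ψ = Q.d₂ Q.φ * padR Q.φ * Q.d₁ Q.ψ * Q.d₃ Q.ψ := by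
    rw [← padL_ψ_d₃_φ]; simp [mul_assoc]
  -- the surviving factor `φ ⊗ 1` contributes the zig-zag axiom of `T'`, times `b`
  rw [← h0, h5, h2, counit₃_ψ, hc, h3, counit₁_ψ, hd, h1, counit₂_φ, h4,
    hT'.zig]
  simp [Algebra.TensorProduct.one_def, hT.map_one]

/-- Two antipodes along `g` are related by an invertible element: the comparison elements in the
two directions are inverse to each other. -/
theorem IsAntipodeAlong.compare_mul_compare (hT : Q.IsAntipodeAlong g T a b)
    (hT' : Q.IsAntipodeAlong g T' a' b') :
    compareMap g T' a' b T Q.ψ * compareMap g T a b' T' Q.ψ = 1 := by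
  have h1 : ∀ t, compareMap g T' a' b T t * compareMap g T a b' T' Q.ψ =
      compareMap g T' a' b' T' t := by
    intro t
    induction t using tensor₃_induction with
    | zero => simp
    | add r s hr hs => simp only [_root_.map_add, add_mul, hr, hs]
    | tmul x y z =>
      have e1 := hT'.compare_intertwines hT z
      have e2 := hT'.beta_mul_compare hT
      simp only [compareMap_tmul, mul_assoc]
      rw [e1, ← mul_assoc b, e2]
  rw [h1]
  exact hT'.zag

end AntipodeAlong

/-! ### Drinfeld's gauge transformation -/

/-- The image of `(S, α, β)` under `Δ` is an antipode along `Δ`. -/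
theorem isAntipodeAlong_comul_S :
    Q.IsAntipodeAlong Q.comul (Q.Δ ∘ₗ Q.S) (Q.Δ Q.alpha) (Q.Δ Q.beta) where
  map_mul x y := by simp
  map_one := by simp
  alpha h := by
    rw [← _root_.map_smul, ← contrA_Δ]
    induction Q.Δ h with
    | zero => simp
    | add x y hx hy => simp only [_root_.map_add, hx, hy]
    | tmul x y => simp [contrA_tmul]; rfl
  beta h := by
    rw [← _root_.map_smul, ← contrB_Δ]
    induction Q.Δ h with
    | zero => simp
    | add x y hx hy => simp only [_root_.map_add, hx, hy]
    | tmul x y => simp [contrB_tmul]; rfl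
  zig := by
    refine Eq.trans ?_ ((congrArg Q.comul Q.zig_φ).trans (_root_.map_one _))
    induction Q.φ using tensor₃_induction with
    | zero => simp
    | add x y hx hy => simp only [_root_.map_add, hx, hy]
    | tmul x y z => simp [zig_tmul, contrA_tmul, mul_assoc, Δ]
  zag := by
    refine Eq.trans ?_ ((congrArg Q.comul Q.zag_ψ).trans (_root_.map_one _))
    induction Q.ψ using tensor₃_induction with
    | zero => simp
    | add x y hx hy => simp only [_root_.map_add, hx, hy]
    | tmul x y z => simp [zag_tmul, contrB_tmul, mul_assoc, Δ]

/-- The zig-zag identity for `𝕓` and `𝕒`. By the formulas for `𝕓` and `𝕒` the left-hand side is a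
map `G` on `H^{⊗4}` at `(1 ⊗ φ) (id ⊗ Δ ⊗ id)(φ) (φ ⊗ 1)`. By the pentagon this element is
`(id ⊗ id ⊗ Δ)(φ) (Δ ⊗ id ⊗ id)(φ)`, on which `G` separates into the product of `pRAlphaMap_φ` and
`betaQLMap_φ`. -/
theorem zig_aElt_bElt : mulMap (LinearMap.mulRight k Q.bElt ∘ₗ Q.Δ)
    (mulMap (LinearMap.mulRight k Q.aElt ∘ₗ Q.SSΔcop) Q.Δ) Q.φ = 1 := by
  let G : H ⊗[k] (H ⊗[k] (H ⊗[k] H)) →ₗ[k] H ⊗[k] H :=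
    mulMap (LinearMap.mulRight k Q.pR ∘ₗ Q.Δ)
      (mulMap (TensorProduct.mk k H H 1 ∘ₗ LinearMap.mulRight k Q.alpha ∘ₗ Q.S)
        (mulMap ((TensorProduct.mk k H H).flip 1 ∘ₗ LinearMap.mulLeft k Q.beta ∘ₗ Q.S)
          (LinearMap.mulLeft k Q.qL ∘ₗ Q.Δ)))
  have hG : ∀ x y z w, G (x ⊗ₜ (y ⊗ₜ (z ⊗ₜ w))) =
      Q.Δ x * (Q.pR * (((Q.beta * Q.S z) ⊗ₜ (Q.S y * Q.alpha)) * (Q.qL * Q.Δ w))) := by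
    intro x y z w; simp [G, mul_assoc, tmul_mul_tmul_assoc]
  have h1 : ∀ r s t, mulMap (LinearMap.mulRight k (Q.bMap s) ∘ₗ Q.Δ)
      (mulMap (LinearMap.mulRight k (Q.aMap r) ∘ₗ Q.SSΔcop) Q.Δ) t =
        G (padL r * Q.d₂ t * padR s) := by
    intro r s t
    induction t using tensor₃_induction with
    | zero => simp
    | add t t' h h' => simp only [_root_.map_add, mul_add, add_mul, h, h']
    | tmul x y z =>
      rw [d₂_tmul, mulMap_tmul, mulMap_tmul, padL_apply]
      simp only [LinearMap.comp_apply, LinearMap.mulRight_apply, SSΔcop_apply]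
      induction r using tensor₃_induction with
      | zero => simp
      | add t t' h h' =>
        simp only [_root_.map_add, mul_add, add_mul, TensorProduct.tmul_add, h, h']
      | tmul r₁ r₂ r₃ =>
        induction s using tensor₃_induction with
        | zero => simp
        | add t t' h h' => simp only [_root_.map_add, mul_add, add_mul, h, h']
        | tmul s₁ s₂ s₃ =>
          induction Q.Δ y with
          | zero => simp
          | add u v hu hv =>
            simp only [app_add, TensorProduct.tmul_add, _root_.map_add, mul_add, add_mul, hu, hv]
          | tmul p q =>
            simp [hG, bMap_tmul, aMap_tmul, qLMap_tmul, SScop_tmul, padR_tmul, mul_assoc,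
              tmul_mul_tmul_assoc]
  have h2 : ∀ s t, G (Q.d₃ s * Q.d₁ t) = Q.pRAlphaMap s * Q.betaQLMap t := by
    intro s t
    induction s using tensor₃_induction with
    | zero => simp
    | add t t' h h' => simp only [_root_.map_add, add_mul, h, h']
    | tmul a b c =>
      induction t using tensor₃_induction with
      | zero => simp
      | add t t' h h' => simp only [_root_.map_add, mul_add, h, h']
      | tmul x y z =>
        have key : ∀ u v : H ⊗[k] H, G ((a ⊗ₜ (b ⊗ₜ u)) * app v (y ⊗ₜ z)) =
            Q.Δ a * (Q.pRMap v * (((Q.beta * Q.S y) ⊗ₜ (Q.S b * Q.alpha)) *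
              (Q.qLMap u * Q.Δ z))) := by
          intro u v
          induction u with
          | zero => simp
          | add u u' hu hu' =>
            simp only [TensorProduct.tmul_add, _root_.map_add, mul_add, add_mul, hu, hu']
          | tmul p q =>
            induction v with
            | zero => simp
            | add u u' hu hu' => simp only [app_add, _root_.map_add, mul_add, add_mul, hu, hu']
            | tmul c d =>
              simp [hG, pRMap_tmul, qLMap_tmul, mul_assoc, tmul_mul_tmul_assoc]
        rw [d₃_tmul, d₁_tmul, key, pRMap_Δ, qLMap_Δ, pRAlphaMap_tmul, betaQLMap_tmul, qLMap_tmul]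
        simp [contrA_tmul, mul_assoc, tmul_mul_tmul_assoc]
  rw [aElt_eq, bElt_eq, h1, ← pentagon', h2, pRAlphaMap_φ, betaQLMap_φ, one_mul]

theorem pRMap_mul (x y : H) (u : H ⊗[k] H) :
    Q.pRMap ((x ⊗ₜ y) * u) = Q.Δ x * Q.pRMap u * (1 ⊗ₜ Q.S y) := by
  induction u with
  | zero => simp
  | add u v hu hv => simp only [map_add, mul_add, add_mul, hu, hv]
  | tmul a b => simp [pRMap_tmul, mul_assoc]

/-- `x ⊗ y ⊗ z ↦ (S(x) ⊗ 1) qᴸ Δ(y) pᴿ (1 ⊗ S(z))` -/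
def qLpRMap : H ⊗[k] (H ⊗[k] H) →ₗ[k] H ⊗[k] H :=
  mulMap ((TensorProduct.mk k H H).flip 1 ∘ₗ Q.S) (LinearMap.mulLeft k Q.qL ∘ₗ Q.pRMap)

theorem qLpRMap_tmul (x : H) (u : H ⊗[k] H) :
    Q.qLpRMap (x ⊗ₜ u) = (Q.S x ⊗ₜ 1) * (Q.qL * Q.pRMap u) := by simp [qLpRMap]

/-- `(S(φ̄₁) ⊗ 1) qᴸ Δ(φ̄₂) pᴿ (1 ⊗ S(φ̄₃)) = α ⊗ β` -/
theorem qLpRMap_ψ : Q.qLpRMap Q.ψ = Q.alpha ⊗ₜ Q.beta := by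
  -- `E` sends `x ⊗ y ⊗ z ⊗ w` to `S(x) α y ⊗ z β S(w)`; the left-hand side is its value at
  -- `(φ⁻¹ ⊗ 1) (id ⊗ Δ ⊗ id)(φ⁻¹) (1 ⊗ φ⁻¹)`, and by the pentagon also at
  -- `(Δ ⊗ id ⊗ id)(φ⁻¹) (id ⊗ id ⊗ Δ)(φ⁻¹)`, where both factors collapse
  let E : H ⊗[k] (H ⊗[k] (H ⊗[k] H)) →ₗ[k] H ⊗[k] H :=
    TensorProduct.map (contrA Q.S Q.alpha) (contrB Q.S Q.beta) ∘ₗ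
      (TensorProduct.assoc k H H (H ⊗[k] H)).symm.toLinearMap
  have hE : ∀ x y w, E (x ⊗ₜ (y ⊗ₜ w)) =
      (Q.S x * Q.alpha * y) ⊗ₜ contrB Q.S Q.beta w := by
    intro x y w; simp [E, contrA_tmul]
  have h1 : ∀ t, Q.qLpRMap t = E (padR Q.ψ * Q.d₂ t * padL Q.ψ) := by
    intro t
    induction t using tensor₃_induction with
    | zero => simp
    | add t t' h h' => simp only [map_add, mul_add, add_mul, h, h']
    | tmul x y z =>
      rw [d₂_tmul, qLpRMap_tmul, padL_apply, pRMap_tmul, qL_eq, pR_eq]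
      have : ∀ r s : H ⊗[k] (H ⊗[k] H), (Q.S x ⊗ₜ 1) *
          (Q.contrAHead r * (Q.Δ y * Q.ract s (1 ⊗ₜ Q.beta) * (1 ⊗ₜ[k] Q.S z))) =
          E (padR r * x ⊗ₜ[k] app (Q.Δ y) z * 1 ⊗ₜ[k] s) := by
        intro r s
        induction r using tensor₃_induction with
        | zero => simp
        | add t t' h h' =>
          simp only [map_add, mul_add, add_mul, h, h']
        | tmul r₁ r₂ r₃ =>
          induction s using tensor₃_induction with
          | zero => simp
          | add t t' h h' =>
            simp only [map_add, LinearMap.add_apply, mul_add, add_mul,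
              TensorProduct.tmul_add, h, h']
          | tmul s₁ s₂ s₃ =>
            induction Q.Δ y with
            | zero => simp
            | add u v hu hv =>
              simp only [app_add, TensorProduct.tmul_add, map_add, mul_add, add_mul, hu, hv]
            | tmul p q =>
              simp [hE, contrAHead_tmul, ract_tmul, padR_tmul, contrB_tmul, mul_assoc]
      exact this _ _
  have h2 : ∀ s t, E (Q.d₁ s * t) =
      mulMap (LinearMap.mulRight k (E t) ∘ₗ TensorProduct.mk k H H 1)
        (TensorProduct.mk k H H 1 ∘ₗ Q.S) (Q.counitHead _ s) := by
    intro s t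
    induction s using tensor₃_induction with
    | zero => simp
    | add r s hr hs => simp only [map_add, add_mul, hr, hs]
    | tmul x y z =>
      induction t using tensor₄_induction with
      | zero => simp
      | add r s hr hs => rw [mul_add, map_add, hr, hs]; simp [mul_add, add_mul]
      | tmul c d e f =>
        have key : ∀ u : H ⊗[k] H, E (app u (y ⊗ₜ z) * (c ⊗ₜ (d ⊗ₜ (e ⊗ₜ f)))) =
            contrA Q.S Q.alpha (u * (c ⊗ₜ d)) ⊗ₜ contrB Q.S Q.beta ((y * e) ⊗ₜ (z * f)) := by
          intro u
          induction u with
          | zero => simp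
          | add u v hu hv =>
            simp only [app_add, TensorProduct.add_tmul, map_add, add_mul, hu, hv]
          | tmul c d => simp [hE, contrA_tmul, mul_assoc]
        rw [d₁_tmul, key, contrA_mul_tmul, contrA_Δ]
        simp [hE, contrB_tmul, mul_assoc, ← TensorProduct.smul_tmul']
  have h3 : ∀ t, E (Q.d₃ t) = contrA Q.S Q.alpha (onTail Q.counitTail t) ⊗ₜ Q.beta := by
    intro t
    induction t using tensor₃_induction with
    | zero => simp
    | add r s hr hs => simp only [map_add, TensorProduct.add_tmul, hr, hs]
    | tmul x y z =>
      rw [d₃_tmul, hE, contrB_Δ]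
      simp [contrA_tmul, ← TensorProduct.smul_tmul']
  rw [h1, ← pentagon_inv, h2, h3, counit₁_ψ, counit₃_ψ]
  simp [Algebra.TensorProduct.one_def, contrA_tmul]

/-- The second zig-zag identity for `𝕒` and `𝕓`. The pentagon is applied three times, each time to
rewrite the argument of a map on `H^{⊗4}` as a product whose outer factors collapse; what is left in
the end is `S(φ̄₁) α φ̄₂ β S(φ̄₃) = 1`. -/
theorem zag_aElt_bElt : mulMap (LinearMap.mulRight k Q.aElt ∘ₗ Q.SSΔcop)
    (mulMap (LinearMap.mulRight k Q.bElt ∘ₗ Q.Δ) Q.SSΔcop) Q.ψ = 1 := by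
  let N (b : H ⊗[k] H) : H ⊗[k] (H ⊗[k] H) →ₗ[k] H ⊗[k] H :=
    mulMap ((TensorProduct.mk k H H).flip 1 ∘ₗ Q.S)
      (mulMap (LinearMap.mulRight k b ∘ₗ LinearMap.mulLeft k Q.qL ∘ₗ Q.Δ) Q.SSΔcop)
  have hN : ∀ b x y z, N b (x ⊗ₜ (y ⊗ₜ z)) =
      (Q.S x ⊗ₜ 1) * (Q.qL * (Q.Δ y * (b * Q.SSΔcop z))) := by
    intro b x y z; simp [N, mul_assoc]
  let Z : H ⊗[k] (H ⊗[k] (H ⊗[k] H)) →ₗ[k] H ⊗[k] H :=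
    mulMap (TensorProduct.mk k H H 1 ∘ₗ LinearMap.mulRight k Q.alpha ∘ₗ Q.S) (N Q.bElt)
  have hZ : ∀ x t, Z (x ⊗ₜ t) = (1 ⊗ₜ (Q.S x * Q.alpha)) * N Q.bElt t := by
    intro x t; simp [Z]
  -- the left-hand side is the value of `Z` at `(φ ⊗ 1) (Δ ⊗ id ⊗ id)(φ⁻¹)`
  have hZ1 : ∀ r t, mulMap (LinearMap.mulRight k (Q.aMap r) ∘ₗ Q.SSΔcop)
      (mulMap (LinearMap.mulRight k Q.bElt ∘ₗ Q.Δ) Q.SSΔcop) t = Z (padR r * Q.d₁ t) := by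
    intro r t
    induction t using tensor₃_induction with
    | zero => simp
    | add t t' h h' => simp only [map_add, mul_add, h, h']
    | tmul x y z =>
      rw [d₁_tmul, mulMap_tmul, mulMap_tmul]
      simp only [LinearMap.comp_apply, LinearMap.mulRight_apply, SSΔcop_apply Q x]
      induction r using tensor₃_induction with
      | zero => simp
      | add t t' h h' => simp only [map_add, mul_add, add_mul, h, h']
      | tmul r₁ r₂ r₃ =>
        induction Q.Δ x with
        | zero => simp
        | add u v hu hv => simp only [app_add, map_add, mul_add, add_mul, hu, hv]
        | tmul p q =>
          simp [hZ, hN, aMap_tmul, qLMap_tmul, SScop_tmul, padR_tmul, mul_assoc,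
            tmul_mul_tmul_assoc]
  -- in `(id ⊗ Δ ⊗ id)(φ⁻¹) (1 ⊗ φ⁻¹) (id ⊗ id ⊗ Δ)(φ)` the last factor collapses on `𝕓`, and the
  -- `Δ` of the first one is absorbed by `qᴸ`; the rest is expressed by `N 𝕓` at `φ⁻¹`
  have hZ2 : ∀ s t, Z (t * Q.d₃ s) = Q.SScop (onTail Q.counitTail s) * Z t := by
    intro s t
    induction t using tensor₄_induction with
    | zero => simp
    | add r s hr hs => simp only [map_add, add_mul, mul_add, hr, hs]
    | tmul p q r w =>
      induction s using tensor₃_induction with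
      | zero => simp
      | add r s hr hs => simp only [map_add, mul_add, add_mul, hr, hs]
      | tmul x y z =>
        have key : ∀ u : H ⊗[k] H, Z ((p ⊗ₜ (q ⊗ₜ (r ⊗ₜ w))) * (x ⊗ₜ (y ⊗ₜ u))) =
            (Q.S (q * y) ⊗ₜ (Q.S (p * x) * Q.alpha)) * (Q.qL * (Q.Δ r *
              (mulMap (LinearMap.mulRight k Q.bElt ∘ₗ Q.Δ) Q.SSΔcop u * Q.SSΔcop w))) := by
          intro u
          induction u with
          | zero => simp
          | add u v hu hv =>
            simp only [TensorProduct.tmul_add, map_add, mul_add, add_mul, hu, hv]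
          | tmul c e => simp [hZ, hN, SSΔcop_mul, mul_assoc, tmul_mul_tmul_assoc]
        rw [d₃_tmul, key, bElt_Δ]
        simp [hZ, hN, SScop_tmul, mul_assoc, tmul_mul_tmul_assoc]
  have hZ3 : ∀ s t, Z (Q.d₂ s * padL t) =
      mulMap (TensorProduct.mk k H H 1 ∘ₗ LinearMap.mulRight k Q.alpha ∘ₗ Q.S)
        (mulMap (TensorProduct.mk k H H 1) (LinearMap.mulLeft k (N Q.bElt t) ∘ₗ Q.SSΔcop)) s := by
    intro s t
    induction s using tensor₃_induction with
    | zero => simp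
    | add r s hr hs => simp only [map_add, add_mul, hr, hs]
    | tmul x y z =>
      induction t using tensor₃_induction with
      | zero => simp
      | add r s hr hs => rw [map_add, mul_add, map_add, hr, hs]; simp [mul_add, add_mul]
      | tmul a b c =>
        have key : ∀ u : H ⊗[k] H, Z ((x ⊗ₜ app u z) * (1 ⊗ₜ (a ⊗ₜ (b ⊗ₜ c)))) =
            (Q.S a ⊗ₜ (Q.S x * Q.alpha)) * (Q.qLMap u * (Q.Δ b * (Q.bElt * Q.SSΔcop (z * c)))) := by
          intro u
          induction u with
          | zero => simp
          | add u v hu hv =>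
            simp only [app_add, TensorProduct.tmul_add, map_add, mul_add, add_mul, hu, hv]
          | tmul c e => simp [hZ, hN, qLMap_tmul, mul_assoc, tmul_mul_tmul_assoc]
        rw [d₂_tmul, padL_apply, key, qLMap_Δ]
        simp [hN, SSΔcop_mul, mul_assoc, tmul_mul_tmul_assoc]
  -- `N 𝕓` at `φ⁻¹` is the value of `Y` at `(id ⊗ id ⊗ Δ)(φ⁻¹) (1 ⊗ φ)`
  let Y : H ⊗[k] (H ⊗[k] (H ⊗[k] H)) →ₗ[k] H ⊗[k] H :=
    mulMap ((TensorProduct.mk k H H).flip 1 ∘ₗ Q.S) (LinearMap.mulLeft k Q.qL ∘ₗ Q.bMap)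
  have hY : ∀ x t, Y (x ⊗ₜ t) = (Q.S x ⊗ₜ 1) * (Q.qL * Q.bMap t) := by
    intro x t; simp [Y]
  have hY1 : ∀ s t, N (Q.bMap s) t = Y (Q.d₃ t * padL s) := by
    intro s t
    induction t using tensor₃_induction with
    | zero => simp
    | add t t' h h' => simp only [map_add, add_mul, h, h']
    | tmul x y z =>
      rw [d₃_tmul, padL_apply, hN, SSΔcop_apply]
      induction s using tensor₃_induction with
      | zero => simp
      | add t t' h h' => simp only [map_add, mul_add, add_mul, TensorProduct.tmul_add, h, h']
      | tmul s₁ s₂ s₃ =>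
        induction Q.Δ z with
        | zero => simp
        | add u v hu hv => simp only [map_add, mul_add, add_mul, TensorProduct.tmul_add, hu, hv]
        | tmul p q => simp [hY, bMap_tmul, SScop_tmul, mul_assoc]
  have hY2 : ∀ r₁ r₂ r₃ s₁ s₂ s₃ q, Y (Q.d₁ (r₁ ⊗ₜ (r₂ ⊗ₜ r₃)) * padR q *
      Q.d₂ (s₁ ⊗ₜ (s₂ ⊗ₜ s₃))) = (Q.S s₁ ⊗ₜ r₁) * (Q.qLpRMap q *
        ((s₂ * (Q.beta * (Q.S s₃ * Q.S r₃))) ⊗ₜ Q.S r₂)) := by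
    intro r₁ r₂ r₃ s₁ s₂ s₃ q
    induction q using tensor₃_induction with
    | zero => simp
    | add t t' h h' => simp only [map_add, mul_add, add_mul, h, h']
    | tmul a b c =>
      have key : ∀ u v : H ⊗[k] H, Y (app u (r₂ ⊗ₜ r₃) * (a ⊗ₜ (b ⊗ₜ (c ⊗ₜ 1))) *
          (s₁ ⊗ₜ app v s₃)) = ((Q.S s₁ * Q.S a) ⊗ₜ 1) * (Q.qLMap u * (Q.Δ b * (Q.pRMap v *
            ((Q.beta * (Q.S s₃ * Q.S r₃)) ⊗ₜ (Q.S c * Q.S r₂))))) := by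
        intro u v
        induction u with
        | zero => simp
        | add u u' hu hu' =>
          simp only [app_add, map_add, mul_add, add_mul, hu, hu']
        | tmul p q =>
          induction v with
          | zero => simp
          | add u u' hu hu' =>
            simp only [app_add, TensorProduct.tmul_add, map_add, mul_add, add_mul, hu, hu']
          | tmul c d =>
            simp [hY, pRMap_tmul, qLMap_tmul, bMap_tmul, mul_assoc, tmul_mul_tmul_assoc]
      rw [d₁_tmul, d₂_tmul, padR_tmul, key, pRMap_Δ, qLMap_Δ, qLpRMap_tmul, pRMap_tmul]
      simp [mul_assoc, tmul_mul_tmul_assoc]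
  let n : H ⊗[k] (H ⊗[k] H) →ₗ[k] H ⊗[k] H :=
    mulMap (TensorProduct.mk k H H 1 ∘ₗ LinearMap.mulRight k Q.beta) Q.SScop
  have hn : ∀ x y z, n (x ⊗ₜ (y ⊗ₜ z)) = Q.S z ⊗ₜ (x * (Q.beta * Q.S y)) := by
    intro x y z; simp [n, SScop_tmul, mul_assoc]
  have hY3 : ∀ r s, Y (Q.d₁ r * padR Q.ψ * Q.d₂ s) = (Q.zag s ⊗ₜ 1) * n r := by
    intro r s
    induction r using tensor₃_induction with
    | zero => simp
    | add t t' h h' => simp only [map_add, mul_add, add_mul, h, h']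
    | tmul r₁ r₂ r₃ =>
      induction s using tensor₃_induction with
      | zero => simp
      | add t t' h h' => simp only [map_add, mul_add, add_mul, TensorProduct.add_tmul, h, h']
      | tmul s₁ s₂ s₃ =>
        rw [hY2, qLpRMap_ψ]
        simp [hn, zag_tmul, contrB_tmul, mul_assoc]
  -- by the pentagon `Y` is taken at `(Δ ⊗ id ⊗ id)(φ) (φ⁻¹ ⊗ 1) (id ⊗ Δ ⊗ id)(φ⁻¹)`, and there
  -- `qLpRMap_ψ` applies to the middle factor
  have hN' : N Q.bElt Q.ψ = n Q.φ := by
    have : Q.d₃ Q.ψ * padL Q.φ = Q.d₁ Q.φ * padR Q.ψ * Q.d₂ Q.ψ := by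
      rw [mul_assoc, ← d₁_ψ_d₃_ψ_padL_φ]; simp [mul_assoc]
    rw [bElt_eq, hY1, this, hY3, zag_ψ, ← Algebra.TensorProduct.one_def, one_mul]
  -- the same product of three factors is met once more, now as the argument of `X`; here the first
  -- and the last factor collapse
  let X : H ⊗[k] (H ⊗[k] (H ⊗[k] H)) →ₗ[k] H ⊗[k] H :=
    mulMap (TensorProduct.mk k H H 1 ∘ₗ LinearMap.mulRight k Q.alpha ∘ₗ Q.S) n
  have hX : ∀ x t, X (x ⊗ₜ t) = (1 ⊗ₜ (Q.S x * Q.alpha)) * n t := by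
    intro x t; simp [X]
  have hX1 : ∀ s t, mulMap (TensorProduct.mk k H H 1 ∘ₗ LinearMap.mulRight k Q.alpha ∘ₗ Q.S)
        (mulMap (TensorProduct.mk k H H 1) (LinearMap.mulLeft k (n t) ∘ₗ Q.SSΔcop)) s =
      X (Q.d₃ s * padL t) := by
    intro s t
    induction s using tensor₃_induction with
    | zero => simp
    | add r s hr hs => simp only [map_add, add_mul, hr, hs]
    | tmul x y z =>
      rw [d₃_tmul, padL_apply]
      induction t using tensor₃_induction with
      | zero => simp
      | add r s hr hs =>
        rw [TensorProduct.tmul_add, mul_add, map_add X, ← hr, ← hs]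
        simp [mul_add, add_mul]
      | tmul a b c =>
        simp only [mulMap_tmul, LinearMap.comp_apply, SSΔcop_apply]
        induction Q.Δ z with
        | zero => simp
        | add u v hu hv => simp only [map_add, mul_add, add_mul, TensorProduct.tmul_add, hu, hv]
        | tmul p q => simp [hX, hn, SScop_tmul, mul_assoc]
  have hX2 : ∀ s t, X (Q.d₁ s * t) = X t * Q.SScop (Q.counitHead _ s) := by
    intro s t
    induction s using tensor₃_induction with
    | zero => simp
    | add r s hr hs => simp only [map_add, add_mul, mul_add, hr, hs]
    | tmul x y z =>
      induction t using tensor₄_induction with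
      | zero => simp
      | add r s hr hs => simp only [map_add, add_mul, mul_add, hr, hs]
      | tmul c d e f =>
        have key : ∀ u : H ⊗[k] H, X (app u (y ⊗ₜ z) * (c ⊗ₜ (d ⊗ₜ (e ⊗ₜ f)))) =
            Q.S (z * f) ⊗ₜ (contrA Q.S Q.alpha (u * (c ⊗ₜ d)) * (Q.beta * Q.S (y * e))) := by
          intro u
          induction u with
          | zero => simp
          | add u v hu hv =>
            simp only [app_add, TensorProduct.tmul_add, map_add, add_mul, hu, hv]
          | tmul c d => simp [hX, hn, contrA_tmul, mul_assoc]
        rw [d₁_tmul, key, contrA_mul_tmul, contrA_Δ]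
        simp [hX, hn, SScop_tmul, mul_assoc]
  have hX3 : ∀ s t, X (t * Q.d₂ s) = Q.SScop (onTail (Q.counitHead H) s) * X t := by
    intro s t
    induction t using tensor₄_induction with
    | zero => simp
    | add r s hr hs => simp only [map_add, add_mul, mul_add, hr, hs]
    | tmul c d e f =>
      induction s using tensor₃_induction with
      | zero => simp
      | add r s hr hs => simp only [map_add, add_mul, mul_add, hr, hs]
      | tmul x y z =>
        have key : ∀ u : H ⊗[k] H, X ((c ⊗ₜ (d ⊗ₜ (e ⊗ₜ f))) * (x ⊗ₜ app u z)) =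
            Q.S (f * z) ⊗ₜ (Q.S (c * x) * (Q.alpha * contrB Q.S Q.beta ((d ⊗ₜ e) * u))) := by
          intro u
          induction u with
          | zero => simp
          | add u v hu hv =>
            simp only [app_add, TensorProduct.tmul_add, map_add, mul_add, hu, hv]
          | tmul c d => simp [hX, hn, contrB_tmul, mul_assoc]
        rw [d₂_tmul, key, contrB_mul_tmul, contrB_Δ]
        simp [hX, hn, SScop_tmul, mul_assoc]
  have hX4 : ∀ t, X (padR t) = 1 ⊗ₜ Q.zag t := by
    intro t
    induction t using tensor₃_induction with
    | zero => simp
    | add r s hr hs => simp only [map_add, TensorProduct.tmul_add, hr, hs]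
    | tmul x y z => simp [padR_tmul, hX, hn, zag_tmul, contrB_tmul, mul_assoc]
  have hone : Q.SScop 1 = 1 := by simp [Algebra.TensorProduct.one_def, SScop_tmul]
  have h5 : Q.d₃ Q.ψ * padL Q.φ = Q.d₁ Q.φ * (padR Q.ψ * Q.d₂ Q.ψ) := by
    rw [← d₁_ψ_d₃_ψ_padL_φ]; simp [mul_assoc]
  rw [aElt_eq, hZ1, padR_φ_d₁_ψ, hZ2, counit₃_φ, hone, one_mul, hZ3, hN', hX1, h5, hX2,
    counit₁_φ, hone, mul_one, hX3, counit₂_ψ, hone, one_mul, hX4, zag_ψ,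
    Algebra.TensorProduct.one_def]

/-- `((S ⊗ S) Δᶜᵒᵖ, 𝕒, 𝕓)` is a second antipode along `Δ`. -/
theorem isAntipodeAlong_comul_SSΔcop :
    Q.IsAntipodeAlong Q.comul Q.SSΔcop Q.aElt Q.bElt where
  map_mul := Q.SSΔcop_mul
  map_one := Q.SSΔcop_one
  alpha := Q.aElt_Δ
  beta := Q.bElt_Δ
  zig := Q.zig_aElt_bElt
  zag := Q.zag_aElt_bElt

/-- Drinfeld's gauge transformation compares the two antipodes along `Δ`. -/
theorem drinfeldTwist_eq :
    Q.drinfeldTwist = compareMap Q.comul Q.SSΔcop Q.aElt (Q.Δ Q.beta) (Q.Δ ∘ₗ Q.S) Q.ψ := by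
  unfold drinfeldTwist pR
  generalize Q.aElt = a
  change _ = compareMap Q.comul Q.SSΔcop a (Q.Δ Q.beta) (Q.Δ ∘ₗ Q.S) Q.phiInv
  induction Q.phiInv using tensor₃_induction with
  | zero => simp
  | add s t hs ht => simp only [map_add, hs, ht]
  | tmul x y z => simp [compareMap_tmul, contrB_tmul, mul_assoc, Δ]

/-- The element `𝕗⁻¹` compares the two antipodes along `Δ` in the opposite direction. -/
theorem drinfeldTwistInv_eq :
    Q.drinfeldTwistInv =
      compareMap Q.comul (Q.Δ ∘ₗ Q.S) (Q.Δ Q.alpha) Q.bElt Q.SSΔcop Q.ψ := by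
  unfold drinfeldTwistInv
  rw [qL_eq]
  generalize Q.bElt = b
  induction Q.ψ using tensor₃_induction with
  | zero => simp
  | add s t hs ht => simp only [map_add, hs, ht]
  | tmul x y z => simp [compareMap_tmul, contrAHead_tmul, mul_assoc, Δ]

theorem drinfeldTwist_mul_inv : Q.drinfeldTwist * Q.drinfeldTwistInv = 1 := by
  rw [drinfeldTwist_eq, drinfeldTwistInv_eq]
  exact Q.isAntipodeAlong_comul_S.compare_mul_compare Q.isAntipodeAlong_comul_SSΔcop

theorem drinfeldTwistInv_mul : Q.drinfeldTwistInv * Q.drinfeldTwist = 1 := by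
  rw [drinfeldTwist_eq, drinfeldTwistInv_eq]
  exact Q.isAntipodeAlong_comul_SSΔcop.compare_mul_compare Q.isAntipodeAlong_comul_S

/-- `Δ(β) 𝕗⁻¹ = 𝕓` -/
theorem Δ_beta_mul_drinfeldTwistInv : Q.Δ Q.beta * Q.drinfeldTwistInv = Q.bElt := by
  rw [drinfeldTwistInv_eq]
  exact Q.isAntipodeAlong_comul_SSΔcop.beta_mul_compare Q.isAntipodeAlong_comul_S

/-- `Δ(S(h)) 𝕗⁻¹ = 𝕗⁻¹ (S ⊗ S)(Δᶜᵒᵖ(h))` -/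
theorem Δ_S_mul_drinfeldTwistInv (h : H) :
    Q.Δ (Q.S h) * Q.drinfeldTwistInv = Q.drinfeldTwistInv * Q.SSΔcop h := by
  rw [drinfeldTwistInv_eq]
  exact Q.isAntipodeAlong_comul_SSΔcop.compare_intertwines Q.isAntipodeAlong_comul_S h

/-! ### The elements `pᴿ` and `𝕗⁻¹` together -/

theorem bMap_mul (x y z : H) (t : H ⊗[k] (H ⊗[k] H)) :
    Q.bMap ((x ⊗ₜ (y ⊗ₜ z)) * t) = Q.Δ x * Q.bMap t * (Q.S z ⊗ₜ Q.S y) := by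
  induction t using tensor₃_induction with
  | zero => simp
  | add s t hs ht => simp only [map_add, mul_add, add_mul, hs, ht]
  | tmul a b c => simp [bMap_tmul, mul_assoc]

/-- `x ⊗ y ⊗ z ↦ Δ(x) 𝕗⁻¹ (S(z) ⊗ S(y))` -/
def fInvMap : H ⊗[k] (H ⊗[k] H) →ₗ[k] H ⊗[k] H :=
  mulMap (LinearMap.mulRight k Q.drinfeldTwistInv ∘ₗ Q.Δ) Q.SScop

theorem fInvMap_tmul (x : H) (u : H ⊗[k] H) :
    Q.fInvMap (x ⊗ₜ u) = Q.Δ x * Q.drinfeldTwistInv * Q.SScop u := by simp [fInvMap]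

/-- `x ⊗ u ↦ x₁ pᴿ₁ ⊗ Δ(x₂ pᴿ₂) 𝕗⁻¹ (S ⊗ S)(u₂ ⊗ u₁)` -/
def pRfInvMap : H ⊗[k] (H ⊗[k] H) →ₗ[k] H ⊗[k] (H ⊗[k] H) :=
  mulMap (LinearMap.mulRight k (onTail Q.comul Q.pR) ∘ₗ (onTail Q.comul).toLinearMap ∘ₗ Q.Δ)
    (TensorProduct.mk k H (H ⊗[k] H) 1 ∘ₗ LinearMap.mulLeft k Q.drinfeldTwistInv ∘ₗ Q.SScop)

theorem pRfInvMap_tmul (x : H) (u : H ⊗[k] H) :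
    Q.pRfInvMap (x ⊗ₜ u) = Q.Δ12 x * onTail Q.comul Q.pR *
      (1 ⊗ₜ (Q.drinfeldTwistInv * Q.SScop u)) := by
  simp [pRfInvMap, Δ12]
  rfl

/-- `pᴿ₁ ⊗ Δ(pᴿ₂) 𝕗⁻¹`, with `Δ(β) 𝕗⁻¹` replaced by `𝕓` and `𝕗⁻¹` moved past `Δ ∘ S`. -/
theorem onTail_comul_pR_mul_drinfeldTwistInv :
    onTail Q.comul Q.pR * (1 ⊗ₜ Q.drinfeldTwistInv) =
      LinearMap.lTensor H Q.bMap (Q.d₃ Q.ψ * padL Q.φ) := by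
  rw [pR_eq]
  have h : ∀ t, onTail Q.comul (Q.ract t (1 ⊗ₜ Q.beta)) * (1 ⊗ₜ Q.drinfeldTwistInv) =
      LinearMap.lTensor H Q.bMap (Q.d₃ t * padL Q.φ) := by
    intro t
    induction t using tensor₃_induction with
    | zero => simp
    | add s t hs ht => simp only [map_add, LinearMap.add_apply, add_mul, hs, ht]
    | tmul x y z =>
      have h1 : Q.comul (y * Q.beta * Q.S z) * Q.drinfeldTwistInv =
          Q.Δ y * Q.bElt * Q.SScop (Q.Δ z) := by
        change Q.Δ _ * _ = _
        rw [Δ_mul, Δ_mul, mul_assoc, Δ_S_mul_drinfeldTwistInv, ← Δ_beta_mul_drinfeldTwistInv,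
          SSΔcop_apply]
        simp only [mul_assoc]
      have h2 : ∀ v : H ⊗[k] H, Q.bMap ((y ⊗ₜ v) * Q.φ) = Q.Δ y * Q.bElt * Q.SScop v := by
        intro v
        induction v with
        | zero => simp
        | add u v hu hv => simp only [TensorProduct.tmul_add, map_add, mul_add, add_mul, hu, hv]
        | tmul a b => rw [bMap_mul, bElt_eq, SScop_tmul]
      rw [d₃_tmul, padL_apply, ract_tmul]
      simp only [Algebra.TensorProduct.tmul_mul_tmul, mul_one, Algebra.TensorProduct.map_tmul,
        AlgHom.coe_id, id_eq, LinearMap.lTensor_tmul, h1, h2]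
  exact h _

/-- `φ̄₁ pᴿ₁ ⊗ Δ(φ̄₂) p'ᴿ (pᴿ₂ ⊗ S(φ̄₃))`, with `p'ᴿ = pᴿ`, equals
`φ̄₁₍₁₎ pᴿ₁ ⊗ Δ(φ̄₁₍₂₎ pᴿ₂) 𝕗⁻¹ (S(φ̄₃) ⊗ S(φ̄₂))`. -/
theorem φ_mul_comulHead_pR_mul_pR :
    Q.φ * Q.comulHead H Q.pR * onTail includeLeft Q.pR = Q.pRfInvMap Q.ψ := by
  have h1 : ∀ t, Q.pRfInvMap t = LinearMap.lTensor H Q.bMap (Q.d₁ t * (Q.d₃ Q.ψ * padL Q.φ)) := by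
    intro t
    induction t using tensor₃_induction with
    | zero => simp
    | add s t hs ht => simp only [map_add, add_mul, hs, ht]
    | tmul x y z =>
      have h2 : ∀ (v : H ⊗[k] H) (t : H ⊗[k] (H ⊗[k] (H ⊗[k] H))),
          LinearMap.lTensor H Q.bMap (app v (y ⊗ₜ z) * t) =
            onTail Q.comul v * LinearMap.lTensor H Q.bMap t * (1 ⊗ₜ (Q.S z ⊗ₜ Q.S y)) := by
        intro v t
        induction v with
        | zero => simp
        | add u v hu hv => simp only [app_add, map_add, add_mul, hu, hv]
        | tmul a b =>
          induction t with
          | zero => simp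
          | add s t hs ht => simp only [map_add, mul_add, add_mul, hs, ht]
          | tmul c t =>
            simp [bMap_mul, Δ]
      rw [d₁_tmul, h2, ← onTail_comul_pR_mul_drinfeldTwistInv, pRfInvMap_tmul, SScop_tmul, Δ12]
      simp [mul_assoc]
  have h3 : ∀ s t, LinearMap.lTensor H Q.bMap (padR s * Q.d₂ t) =
      LinearMap.lTensor H Q.pRMap s * onTail includeLeft (Q.ract t (1 ⊗ₜ Q.beta)) := by
    intro s t
    induction s using tensor₃_induction with
    | zero => simp
    | add r s hr hs => simp only [map_add, add_mul, hr, hs]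
    | tmul a b c =>
      induction t using tensor₃_induction with
      | zero => simp
      | add r s hr hs => simp only [map_add, LinearMap.add_apply, mul_add, hr, hs]
      | tmul x y z =>
        have key : ∀ v : H ⊗[k] H, Q.bMap ((b ⊗ₜ (c ⊗ₜ 1)) * app v z) =
            Q.Δ b * Q.pRMap v * ((Q.beta * Q.S z) ⊗ₜ Q.S c) := by
          intro v
          induction v with
          | zero => simp
          | add u v hu hv => simp only [app_add, map_add, mul_add, add_mul, hu, hv]
          | tmul p q => simp [bMap_tmul, pRMap_tmul, mul_assoc]
        rw [padR_tmul, d₂_tmul, Algebra.TensorProduct.tmul_mul_tmul, LinearMap.lTensor_tmul, key,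
          pRMap_Δ, ract_tmul, LinearMap.lTensor_tmul, pRMap_tmul]
        simp [mul_assoc]
  -- the right-hand side is `id ⊗ bMap` at `(Δ ⊗ id ⊗ id)(φ⁻¹) (id ⊗ id ⊗ Δ)(φ⁻¹) (1 ⊗ φ)`, which by
  -- the pentagon is `(φ⁻¹ ⊗ 1) (id ⊗ Δ ⊗ id)(φ⁻¹)`
  rw [h1, ← mul_assoc, d₁_ψ_d₃_ψ_padL_φ, h3, φ_mul_comulHead_pR, pR_eq]

/-! ### Twisted linear maps and the map `U` -/

theorem onTail_id (u : H ⊗[k] H) : onTail (AlgHom.id k H) u = u := by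
  simp [onTail]

section TwistEval

variable {V : Type*} [AddCommGroup V] [Module k V] (ρ : H →ₐ[k] Module.End k V)
  {B : Type*} [Ring B] [Algebra k B]

/-- `x ⊗ b ↦ δ(x m) b` -/
def twistEval (δ : V →ₗ[k] B) (m : V) : H ⊗[k] B →ₗ[k] B :=
  mulMap (δ ∘ₗ ρ.toLinearMap.flip m) LinearMap.id

theorem twistEval_tmul (δ : V →ₗ[k] B) (m : V) (x : H) (b : B) :
    twistEval ρ δ m (x ⊗ₜ b) = δ (ρ x m) * b := by simp [twistEval]

theorem twistEval_add_right (δ : V →ₗ[k] B) (m n : V) (t : H ⊗[k] B) :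
    twistEval ρ δ (m + n) t = twistEval ρ δ m t + twistEval ρ δ n t := by
  induction t with
  | zero => simp
  | add s t hs ht => simp only [map_add, hs, ht]; abel
  | tmul x b => simp [twistEval_tmul, add_mul]

theorem twistEval_mul_tmul (δ : V →ₗ[k] B) (m : V) (t : H ⊗[k] B) (c : H) (b : B) :
    twistEval ρ δ m (t * (c ⊗ₜ b)) = twistEval ρ δ (ρ c m) t * b := by
  induction t with
  | zero => simp
  | add s t hs ht => simp only [map_add, add_mul, hs, ht]
  | tmul x y => simp [twistEval_tmul, mul_assoc]

/-- Linear maps `δ : V → B`, along an algebra map `F : H → B`, with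
`F(h) δ(m) = δ(h₁ m) F(h₂)`; they are the `H`-linear maps `V ⊗ H → B`. -/
def IsTwisted (F : H →ₐ[k] B) (δ : V →ₗ[k] B) : Prop :=
  ∀ h m, F h * δ m = twistEval ρ δ m (onTail F (Q.Δ h))

variable {Q ρ} in
theorem IsTwisted.mul_twistEval {F : H →ₐ[k] B} {δ : V →ₗ[k] B} (hδ : Q.IsTwisted ρ F δ) (h : H)
    (m : V) (t : H ⊗[k] B) :
    twistEval ρ δ m (onTail F (Q.Δ h) * t) = F h * twistEval ρ δ m t := by
  induction t with
  | zero => simp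
  | add s t hs ht => simp only [map_add, mul_add, hs, ht]
  | tmul x y => rw [twistEval_mul_tmul, twistEval_tmul, ← hδ, mul_assoc]

theorem twistEval_map {C : Type*} [Ring C] [Algebra k C] (F : B →ₐ[k] C) (δ : V →ₗ[k] B) (m : V)
    (t : H ⊗[k] B) :
    twistEval ρ (F.toLinearMap ∘ₗ δ) m (onTail F t) = F (twistEval ρ δ m t) := by
  induction t with
  | zero => simp
  | add s t hs ht => simp only [map_add, hs, ht]
  | tmul x b => simp [twistEval_tmul]

end TwistEval

/-- `x ⊗ y ⊗ z ↦ x a S(y) α z` -/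
def uEval (a : H) : H ⊗[k] (H ⊗[k] H) →ₗ[k] H :=
  mulMap (LinearMap.mulRight k a) (contrA Q.S Q.alpha)

theorem uEval_tmul (a x : H) (u : H ⊗[k] H) :
    Q.uEval a (x ⊗ₜ u) = x * a * contrA Q.S Q.alpha u := by simp [uEval]

theorem uEval_add_left (a b : H) (t : H ⊗[k] (H ⊗[k] H)) :
    Q.uEval (a + b) t = Q.uEval a t + Q.uEval b t := by
  induction t with
  | zero => simp
  | add s t hs ht => simp only [map_add, hs, ht]; abel
  | tmul x u => simp [uEval_tmul, mul_add, add_mul]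

theorem uEval_smul_left (c : k) (a : H) (t : H ⊗[k] (H ⊗[k] H)) :
    Q.uEval (c • a) t = c • Q.uEval a t := by
  induction t with
  | zero => simp
  | add s t hs ht => simp only [map_add, hs, ht, smul_add]
  | tmul x u => simp [uEval_tmul]

/-- `U(a) = φ₁ a S(φ₂) α φ₃` -/
def U : H →ₗ[k] H where
  toFun a := Q.uEval a Q.φ
  map_add' a b := Q.uEval_add_left a b _
  map_smul' c a := Q.uEval_smul_left c a _

theorem U_apply (a : H) : Q.U a = Q.uEval a Q.φ := rfl

theorem adAct_apply (h a : H) : Q.adAct h a = Q.sandwich (Q.Δ h) a := rfl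

theorem uEval_mul_app (t : H ⊗[k] (H ⊗[k] H)) (u : H ⊗[k] H) (b a : H) :
    Q.uEval a (t * app u b) = Q.uEval (Q.sandwich u a) t * b := by
  induction u with
  | zero =>
    have : Q.uEval 0 t = 0 := by simpa using Q.uEval_smul_left 0 0 t
    simp [this]
  | add u v hu hv =>
    simp only [app_add, map_add, mul_add, LinearMap.add_apply, uEval_add_left, add_mul, hu, hv]
  | tmul x y =>
    induction t using tensor₃_induction with
    | zero => simp
    | add s t hs ht => simp only [map_add, add_mul, hs, ht]
    | tmul p q r => simp [uEval_tmul, contrA_tmul, sandwich_tmul, mul_assoc]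

theorem uEval_φ_mul_comulHead (u : H ⊗[k] H) (a : H) :
    Q.uEval a (Q.φ * Q.comulHead H u) = twistEval Q.adAct Q.U a u := by
  induction u with
  | zero => simp
  | add u v hu hv => simp only [map_add, mul_add, hu, hv]
  | tmul x y => rw [comulHead_tmul, uEval_mul_app, twistEval_tmul, U_apply, adAct_apply]

theorem uEval_onTail_comul_mul (u : H ⊗[k] H) (t : H ⊗[k] (H ⊗[k] H)) (a : H) :
    Q.uEval a (onTail Q.comul u * t) = Q.counitTail u * Q.uEval a t := by
  induction u with
  | zero => simp
  | add u v hu hv => simp only [map_add, add_mul, hu, hv]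
  | tmul x y =>
    induction t using tensor₃_induction with
    | zero => simp
    | add s t hs ht => simp only [map_add, mul_add, hs, ht]
    | tmul p q r =>
      have := Q.contrA_Δ y
      simp only [Δ, AlgHom.toLinearMap_apply] at this
      simp [uEval_tmul, contrA_mul_tmul, this, contrA_tmul, mul_assoc]

/-- `h U(a) = U(h₁ ▷ a) h₂` -/
theorem isTwisted_U : Q.IsTwisted Q.adAct (AlgHom.id k H) Q.U := by
  intro h a
  rw [onTail_id, ← uEval_φ_mul_comulHead]
  change _ = Q.uEval a (Q.φ * Q.Δ21 h)
  rw [← Δ12_mul_φ, Δ12, uEval_onTail_comul_mul, counitTail_Δ]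
  rfl

theorem contrA_Δ_mul (y : H) (u : H ⊗[k] H) :
    contrA Q.S Q.alpha (Q.Δ y * u) = Q.counit y • contrA Q.S Q.alpha u := by
  induction u with
  | zero => simp
  | add s t hs ht => simp only [map_add, mul_add, hs, ht, smul_add]
  | tmul p q => rw [contrA_mul_tmul, contrA_Δ]; simp [contrA_tmul]

/-- `S(pᴿ₁) α pᴿ₂ = 1` -/
theorem contrA_pR : contrA Q.S Q.alpha Q.pR = 1 := by
  refine Eq.trans ?_ Q.zag_ψ
  rw [pR_eq]
  induction Q.ψ using tensor₃_induction with
  | zero => simp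
  | add s t hs ht => simp only [map_add, LinearMap.add_apply, hs, ht]
  | tmul p q r => simp [ract_tmul, contrA_tmul, zag_tmul, contrB_tmul, mul_assoc]

/-- `U(pᴿ₁ ▷ a) pᴿ₂ = a` -/
theorem twistEval_U_pR (a : H) : twistEval Q.adAct Q.U a Q.pR = a := by
  rw [← uEval_φ_mul_comulHead, φ_mul_comulHead_pR]
  have h1 : ∀ t, Q.uEval a (LinearMap.lTensor H Q.pRMap t) =
      mulMap (LinearMap.mulRight k a) Q.S (onTail (Q.counitHead H) t) := by
    intro t
    induction t using tensor₃_induction with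
    | zero => simp
    | add s t hs ht => simp only [map_add, hs, ht]
    | tmul x y z =>
      have h2 : contrA Q.S Q.alpha (Q.pR * (1 ⊗ₜ[k] Q.S z)) = Q.S z := by
        rw [contrA_mul_tmul, contrA_pR]; simp
      rw [LinearMap.lTensor_tmul, uEval_tmul, pRMap_tmul, mul_assoc, mul_assoc (Q.Δ y),
        contrA_Δ_mul, h2]
      simp [mul_assoc]
  rw [h1, counit₂_ψ, Algebra.TensorProduct.one_def]
  simp

/-- For twisted `δ`, `U(δ(pᴿ₁ m) pᴿ₂) = δ(m)`. -/
theorem IsTwisted.U_twistEval_pR {V : Type*} [AddCommGroup V] [Module k V]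
    {ρ : H →ₐ[k] Module.End k V} {δ : V →ₗ[k] H} (hδ : Q.IsTwisted ρ (AlgHom.id k H) δ) (m : V) :
    Q.U (twistEval ρ δ m Q.pR) = δ m := by
  rw [U_apply]
  have h1 : ∀ t, Q.uEval (twistEval ρ δ m Q.pR) t = twistEval ρ δ m (Q.pRAlphaMap t) := by
    intro t
    induction t with
    | zero => simp
    | add s t hs ht => simp only [map_add, hs, ht]
    | tmul x u =>
      have h2 := hδ.mul_twistEval x m (Q.pR * (1 ⊗ₜ[k] contrA Q.S Q.alpha u))
      rw [twistEval_mul_tmul] at h2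
      rw [uEval_tmul, pRAlphaMap_tmul, mul_assoc (Q.Δ x)]
      simpa [mul_assoc] using h2.symm
  rw [h1, pRAlphaMap_φ, Algebra.TensorProduct.one_def, twistEval_tmul]
  simp

/-! ### The coaction of the first kind on `𝐀` -/

/-- `Δ ∘ U`, which is twisted along `Δ`. -/
def ΔU : H →ₗ[k] H ⊗[k] H := Q.Δ ∘ₗ Q.U

theorem isTwisted_ΔU : Q.IsTwisted Q.adAct Q.comul Q.ΔU := by
  intro h a
  have h1 := Q.isTwisted_U h a
  rw [onTail_id] at h1
  have h3 := congrArg Q.comul h1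
  rw [← twistEval_map, map_mul] at h3
  exact h3

/-- `x ⊗ y ⊗ z ↦ Δ(U(x ▷ a) y) pᴿ (1 ⊗ S(z))` -/
def coactKernel (a : H) : H ⊗[k] (H ⊗[k] H) →ₗ[k] H ⊗[k] H :=
  twistEval Q.adAct Q.ΔU a ∘ₗ LinearMap.lTensor H Q.pRMap

theorem coactKernel_Δ21_mul (a h : H) (t : H ⊗[k] (H ⊗[k] H)) :
    Q.ract (Q.Δ21 h) (Q.coactKernel a t) = Q.coactKernel a (Q.Δ21 h * t) := by
  have h1 : ∀ (u : H ⊗[k] H) (b : H), LinearMap.lTensor H Q.pRMap (app u b * t) =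
      onTail Q.comul u * LinearMap.lTensor H Q.pRMap t * (1 ⊗ₜ (1 ⊗ₜ Q.S b)) := by
    intro u b
    induction u with
    | zero => simp
    | add u v hu hv => simp only [app_add, map_add, add_mul, hu, hv]
    | tmul x y =>
      induction t with
      | zero => simp
      | add s t hs ht => simp only [map_add, mul_add, add_mul, hs, ht]
      | tmul p w => simp [pRMap_mul, Δ]
  rw [Δ21]
  induction Q.Δ h with
  | zero => simp
  | add u v hu hv => simp only [map_add, LinearMap.add_apply, add_mul, hu, hv]
  | tmul x y =>
    rw [comulHead_tmul, ract_app, coactKernel, LinearMap.comp_apply, LinearMap.comp_apply, h1,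
      twistEval_mul_tmul, Q.isTwisted_ΔU.mul_twistEval]
    simp [Δ]

theorem pRMap_mul_Δ (u : H ⊗[k] H) (h : H) : Q.pRMap (u * Q.Δ h) = Q.pRMap u * (h ⊗ₜ 1) := by
  induction u with
  | zero => simp
  | add s t hs ht => simp only [map_add, add_mul, hs, ht]
  | tmul x y => simp [pRMap_mul, pRMap_Δ, pRMap_tmul, mul_assoc]

theorem coactKernel_mul (a x y : H) (t : H ⊗[k] (H ⊗[k] H)) :
    Q.coactKernel a (t * (x ⊗ₜ Q.Δ y)) = Q.coactKernel (Q.adAct x a) t * (y ⊗ₜ 1) := by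
  induction t with
  | zero => simp
  | add s t hs ht => simp only [map_add, add_mul, hs, ht]
  | tmul p w => simp [coactKernel, pRMap_mul_Δ, twistEval_tmul, mul_assoc]

theorem coactKernel_add (a b : H) (t : H ⊗[k] (H ⊗[k] H)) :
    Q.coactKernel (a + b) t = Q.coactKernel a t + Q.coactKernel b t :=
  twistEval_add_right ..

theorem twistEval_smul_right {V : Type*} [AddCommGroup V] [Module k V]
    (ρ : H →ₐ[k] Module.End k V) {B : Type*} [Ring B] [Algebra k B] (δ : V →ₗ[k] B) (c : k)
    (m : V) (t : H ⊗[k] B) : twistEval ρ δ (c • m) t = c • twistEval ρ δ m t := by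
  induction t with
  | zero => simp
  | add s t hs ht => simp only [map_add, hs, ht, smul_add]
  | tmul x b => simp [twistEval_tmul]

/-- The coaction of the first kind on `𝐀`, in the form
`a ↦ (φ₁ ⊗ φ₂) Δ(U(φ̄₁ ▷ a) φ̄₂) pᴿ (1 ⊗ S(φ₃ φ̄₃))`. -/
def adCoact : H →ₗ[k] H ⊗[k] H where
  toFun a := Q.ract Q.φ (Q.coactKernel a Q.ψ)
  map_add' a b := by rw [coactKernel_add, map_add]
  map_smul' c a := by
    have : Q.coactKernel (c • a) Q.ψ = c • Q.coactKernel a Q.ψ := twistEval_smul_right ..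
    simp [this]

theorem adCoact_apply (a : H) : Q.adCoact a = Q.ract Q.φ (Q.coactKernel a Q.ψ) := rfl

theorem rTensor_mulRight_eq_mul {B C : Type*} [Ring B] [Algebra k B] [Ring C] [Algebra k C]
    (y : B) (r : B ⊗[k] C) :
    LinearMap.rTensor C (LinearMap.mulRight k y) r = r * (y ⊗ₜ 1) := by
  induction r with
  | zero => simp
  | add r s hr hs => simp only [map_add, add_mul, hr, hs]
  | tmul a b => simp

theorem boxAct_lreg_adAct (u : H ⊗[k] H) (r : H ⊗[k] H) :
    boxAct lreg Q.adAct u r = Q.ract (onTail Q.comul u) r := by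
  induction u with
  | zero => simp
  | add u v hu hv => simp only [map_add, LinearMap.add_apply, hu, hv]
  | tmul x y =>
    induction r with
    | zero => simp
    | add r s hr hs => simp only [map_add, hr, hs]
    | tmul a b => simp [ract, boxAct_tmul, adAct_apply, Δ]

/-- `h₁ a_[-1] ⊗ h₂ ▷ a_[0] = (h₁ ▷ a)_[-1] h₂ ⊗ (h₁ ▷ a)_[0]` -/
theorem adCoact_compat (h a : H) :
    boxAct lreg Q.adAct (Q.Δ h) (Q.adCoact a) = coactTwist Q.adAct Q.adCoact (Q.Δ h) a := by
  rw [boxAct_lreg_adAct]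
  change Q.ract (Q.Δ12 h) _ = _
  rw [adCoact_apply, ← Module.End.mul_apply, ← map_mul, Δ12_mul_φ, map_mul, Module.End.mul_apply,
    coactKernel_Δ21_mul, ← ψ_mul_Δ12, Δ12]
  induction Q.Δ h with
  | zero => simp
  | add u v hu hv => simp only [map_add, LinearMap.add_apply, mul_add, hu, hv]
  | tmul x y =>
    rw [coactTwist_tmul, Algebra.TensorProduct.map_tmul, rTensor_mulRight_eq_mul, adCoact_apply,
      ← ract_mul_left_tmul]
    exact congrArg _ (Q.coactKernel_mul a x y Q.ψ)

/-- The coaction of the second kind that corresponds to `adCoact`. -/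
theorem toSecond_adCoact : Q.toSecond Q.adAct Q.adCoact = Q.coactFormula₂ := by
  ext a
  -- both sides are `ract φ` of the vector `Δ(φ̄₁ a) 𝕗⁻¹ (S(φ̄₃) ⊗ S(φ̄₂))`
  have h1 : ∀ u, coactTwist Q.adAct Q.adCoact u a = Q.ract Q.φ
      (twistEval Q.adAct Q.ΔU a (Q.φ * Q.comulHead H Q.pR * onTail includeLeft u)) := by
    intro u
    induction u with
    | zero => simp
    | add u v hu hv => simp only [map_add, LinearMap.add_apply, mul_add, hu, hv]
    | tmul x y =>
      rw [coactTwist_tmul, rTensor_mulRight_eq_mul, adCoact_apply, ← ract_mul_left_tmul,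
        coactKernel, LinearMap.comp_apply, ← φ_mul_comulHead_pR]
      simp [twistEval_mul_tmul]
  have h2 : ∀ t, twistEval Q.adAct Q.ΔU a (Q.pRfInvMap t) =
      Q.fInvMap (t * (a ⊗ₜ 1)) := by
    intro t
    induction t with
    | zero => simp
    | add s t hs ht => simp only [map_add, add_mul, hs, ht]
    | tmul x u =>
      have h3 := twistEval_map (B := H) Q.adAct Q.comul Q.U a Q.pR
      rw [twistEval_U_pR] at h3
      change twistEval Q.adAct Q.ΔU a _ = _ at h3
      rw [pRfInvMap_tmul, twistEval_mul_tmul, Δ12, Q.isTwisted_ΔU.mul_twistEval]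
      simp only [map_one, Module.End.one_apply, h3, Algebra.TensorProduct.tmul_mul_tmul, mul_one,
        fInvMap_tmul, Δ_mul]
      simp [mul_assoc, Δ]
  have h4 : ∀ s t, Q.sandwichOI (padR s * Q.d₁ t) (Q.ΔfInv a) =
      Q.ract s (Q.fInvMap (t * (a ⊗ₜ 1))) := by
    intro s t
    induction s using tensor₃_induction with
    | zero => simp
    | add r s hr hs => simp only [map_add, LinearMap.add_apply, add_mul, hr, hs]
    | tmul x y z =>
      induction t using tensor₃_induction with
      | zero => simp
      | add r s hr hs => simp only [map_add, LinearMap.add_apply, mul_add, add_mul, hr, hs]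
      | tmul p q r =>
        have key : ∀ (u : H ⊗[k] H) (w : H ⊗[k] H),
            Q.sandwichOI ((x ⊗ₜ (y ⊗ₜ (z ⊗ₜ 1))) * app u (q ⊗ₜ r)) w =
              (x ⊗ₜ y) * (u * w * (Q.S r ⊗ₜ Q.S q)) * (1 ⊗ₜ Q.S z) := by
          intro u w
          induction u with
          | zero => simp
          | add u v hu hv =>
            simp only [app_add, map_add, LinearMap.add_apply, mul_add, add_mul, hu, hv]
          | tmul c d =>
            induction w with
            | zero => simp
            | add u v hu hv => simp only [map_add, mul_add, add_mul, hu, hv]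
            | tmul e f => simp [sandwichOI_tmul, mul_assoc]
        rw [padR_tmul, d₁_tmul, key, ract_tmul]
        simp [fInvMap_tmul, SScop_tmul, ΔfInv, mul_assoc]
  rw [coactFormula₂, LinearMap.comp_apply, pad_eq, Δ1_eq, h4, toSecond, h1,
    φ_mul_comulHead_pR_mul_pR, h2]

theorem counitHead_ract (t : H ⊗[k] (H ⊗[k] H)) (r : H ⊗[k] H) :
    Q.counitHead H (Q.ract t r) =
      Q.sandwich (Q.counitHead (H ⊗[k] H) t) (Q.counitHead H r) := by
  induction t using tensor₃_induction with
  | zero => simp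
  | add s t hs ht => simp only [map_add, LinearMap.add_apply, hs, ht]
  | tmul x y z => simp [ract_tmul, sandwich_tmul, mul_assoc]

theorem counitHead_pR : Q.counitHead H Q.pR = Q.beta := by
  rw [pR_eq, counitHead_ract, counit₁_ψ]; simp

theorem counitTail_ract (t : H ⊗[k] (H ⊗[k] H)) (r : H ⊗[k] H) :
    Q.counitTail (Q.ract t r) =
      Q.counitTail (onTail (Q.counitHead H) t) * Q.counitTail r := by
  induction t using tensor₃_induction with
  | zero => simp
  | add s t hs ht => simp only [map_add, LinearMap.add_apply, add_mul, hs, ht]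
  | tmul x y z => simp [ract_tmul, counit_S, smul_smul, mul_comm]

theorem counitTail_pR : Q.counitTail Q.pR = 1 := by
  rw [pR_eq, counitTail_ract, counit₂_ψ]; simp [Q.counit_beta]

theorem counitHead_adCoact (a : H) : Q.counitHead H (Q.adCoact a) = a := by
  rw [adCoact_apply, counitHead_ract, counit₁_φ, map_one, Module.End.one_apply]
  have h1 : ∀ t, Q.counitHead H (Q.coactKernel a t) =
      twistEval Q.adAct Q.U a (LinearMap.lTensor H (contrB Q.S Q.beta) t) := by
    intro t
    induction t using tensor₃_induction with
    | zero => simp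
    | add s t hs ht => simp only [map_add, hs, ht]
    | tmul x y z =>
      simp only [coactKernel, LinearMap.comp_apply, LinearMap.lTensor_tmul, twistEval_tmul, ΔU,
        pRMap_tmul, map_mul, counitHead_Δ, counitHead_pR, contrB_tmul]
      simp
  rw [h1]
  exact Q.twistEval_U_pR a

/-- `a_[-1] ε(a_[0]) = U(a)`: the map `U` is the coaction followed by the counit of `𝐀`. -/
theorem counitTail_adCoact (a : H) : Q.counitTail (Q.adCoact a) = Q.U a := by
  rw [adCoact_apply, counitTail_ract, counit₂_φ, map_one, one_mul]
  have h1 : ∀ t, Q.counitTail (Q.coactKernel a t) =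
      twistEval Q.adAct Q.U a (onTail Q.counitTail t) := by
    intro t
    induction t using tensor₃_induction with
    | zero => simp
    | add s t hs ht => simp only [map_add, hs, ht]
    | tmul x y z =>
      simp only [coactKernel, LinearMap.comp_apply, LinearMap.lTensor_tmul, twistEval_tmul, ΔU,
        pRMap_tmul, map_mul, counitTail_Δ, counitTail_pR]
      simp [counit_S, twistEval_tmul]
  rw [h1, counit₃_ψ, Algebra.TensorProduct.one_def, twistEval_tmul]
  simp

/-- `x ⊗ y ↦ (a ↦ U(x ▷ a) y)` -/
def uTwist : H ⊗[k] H →ₗ[k] Module.End k H :=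
  LinearMap.mul' k (Module.End k H) ∘ₗ
    TensorProduct.map (LinearMap.mul k H).flip (LinearMap.mulLeft k (Q.U : Module.End k H) ∘ₗ
      Q.adAct.toLinearMap) ∘ₗ (TensorProduct.comm k H H).toLinearMap

theorem uTwist_tmul (x y a : H) : Q.uTwist (x ⊗ₜ y) a = Q.U (Q.adAct x a) * y := by
  simp [uTwist]

theorem uTwist_apply (u : H ⊗[k] H) (a : H) : Q.uTwist u a = twistEval Q.adAct Q.U a u := by
  induction u with
  | zero => simp
  | add u v hu hv => simp only [map_add, LinearMap.add_apply, hu, hv]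
  | tmul x y => rw [uTwist_tmul, twistEval_tmul]

theorem uTwist_mul_tmul (u : H ⊗[k] H) (x y a : H) :
    Q.uTwist (u * (x ⊗ₜ y)) a = Q.uTwist u (Q.adAct x a) * y := by
  simp only [uTwist_apply, twistEval_mul_tmul]

theorem uTwist_Δ_mul (h : H) (u : H ⊗[k] H) (a : H) :
    Q.uTwist (Q.Δ h * u) a = h * Q.uTwist u a := by
  have := Q.isTwisted_U.mul_twistEval h a u
  rw [onTail_id] at this
  simp only [uTwist_apply]
  exact this

section UTail

variable {W : Type*} [AddCommGroup W] [Module k W] (σ : H →ₐ[k] Module.End k W)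

/-- The operator attached to `x ⊗ y ⊗ z`: `w ⊗ a ↦ x w ⊗ U(y ▷ a) z`. -/
def uTail : H ⊗[k] (H ⊗[k] H) →ₗ[k] W ⊗[k] H →ₗ[k] W ⊗[k] H :=
  TensorProduct.homTensorHomMap (.id k) W H W H ∘ₗ
    TensorProduct.map σ.toLinearMap Q.uTwist

theorem uTail_tmul (x : H) (u : H ⊗[k] H) (w : W) (a : H) :
    Q.uTail σ (x ⊗ₜ u) (w ⊗ₜ a) = σ x w ⊗ₜ Q.uTwist u a := by simp [uTail]

end UTail

/-- `x ⊗ u ↦ Δ(x) r (1 ⊗ S(u₁) α u₂)` -/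
def ΔAlphaMap (r : H ⊗[k] H) : H ⊗[k] (H ⊗[k] H) →ₗ[k] H ⊗[k] H :=
  mulMap (LinearMap.mulRight k r ∘ₗ Q.Δ) (TensorProduct.mk k H H 1 ∘ₗ contrA Q.S Q.alpha)

theorem ΔAlphaMap_tmul (r : H ⊗[k] H) (x : H) (u : H ⊗[k] H) :
    Q.ΔAlphaMap r (x ⊗ₜ u) = Q.Δ x * r * (1 ⊗ₜ contrA Q.S Q.alpha u) := by
  simp [ΔAlphaMap]

theorem ΔAlphaMap_add (r s : H ⊗[k] H) (t : H ⊗[k] (H ⊗[k] H)) :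
    Q.ΔAlphaMap (r + s) t = Q.ΔAlphaMap r t + Q.ΔAlphaMap s t := by
  induction t with
  | zero => simp
  | add s t hs ht => simp only [map_add, hs, ht]; abel
  | tmul x b => simp only [ΔAlphaMap_tmul, mul_add, add_mul]

theorem ΔAlphaMap_zero (t : H ⊗[k] (H ⊗[k] H)) : Q.ΔAlphaMap 0 t = 0 := by
  induction t with
  | zero => simp
  | add s t hs ht => simp only [map_add, hs, ht]; abel
  | tmul x b => simp only [ΔAlphaMap_tmul, mul_zero, zero_mul]

/-- Applying `b ⊗ a ↦ φ₁ b ⊗ U(φ₂ ▷ a) φ₃` after `r ↦ (φ₁ ⊗ φ₂) r (1 ⊗ S(φ₃))` involves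
`(1 ⊗ φ) (id ⊗ Δ ⊗ id)(φ) (φ ⊗ 1)`, hence simplifies by the pentagon. -/
theorem uTail_φ_ract (r : H ⊗[k] H) :
    Q.uTail lreg Q.φ (Q.ract Q.φ r) = Q.ΔAlphaMap r Q.φ := by
  induction r with
  | zero => simp [ΔAlphaMap_zero]
  | add r s hr hs => rw [map_add, map_add, hr, hs, ΔAlphaMap_add]
  | tmul a b =>
    let L : H ⊗[k] (H ⊗[k] (H ⊗[k] H)) →ₗ[k] H ⊗[k] H :=
      TensorProduct.map (LinearMap.mulRight k a) (Q.uEval b)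
    have hL : ∀ x t, L (x ⊗ₜ t) = (x * a) ⊗ₜ Q.uEval b t := by intro x t; simp [L]
    have h1 : ∀ s t, Q.uTail lreg s (Q.ract t (a ⊗ₜ b)) = L (padL Q.φ * Q.d₂ s * padR t) := by
      intro s t
      induction s using tensor₃_induction with
      | zero => simp
      | add r s hr hs => simp only [map_add, LinearMap.add_apply, mul_add, add_mul, hr, hs]
      | tmul x y z =>
        induction t using tensor₃_induction with
        | zero => simp
        | add r s hr hs => simp only [map_add, LinearMap.add_apply, mul_add, hr, hs]
        | tmul p q r =>
          have := Q.uEval_mul_app (Q.φ * app (Q.Δ y) z) (q ⊗ₜ r) 1 b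
          rw [d₂_tmul, padR_tmul, padL_apply, ract_tmul]
          simp only [Algebra.TensorProduct.tmul_mul_tmul, mul_one, one_mul, hL, uTail_tmul,
            uTwist_tmul, U_apply, adAct_apply]
          rw [← uEval_mul_app, ← app_tmul q r, this, sandwich_tmul]
          simp [mul_assoc]
    have h2 : ∀ s t, L (Q.d₃ s * t) = onTail Q.counitTail s * L t := by
      intro s t
      induction s with
      | zero => simp
      | add r s hr hs => simp only [map_add, add_mul, hr, hs]
      | tmul x u =>
        induction t with
        | zero => simp
        | add r s hr hs => simp only [map_add, mul_add, hr, hs]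
        | tmul y t => simp [hL, d₃, uEval_onTail_comul_mul, mul_assoc]
    have h3 : ∀ t, L (Q.d₁ t) = Q.ΔAlphaMap (a ⊗ₜ b) t := by
      intro t
      induction t with
      | zero => simp
      | add s t hs ht => simp only [map_add, hs, ht]
      | tmul x w =>
        rw [d₁_tmul, ΔAlphaMap_tmul]
        induction Q.Δ x with
        | zero => simp
        | add u v hu hv => simp only [app_add, map_add, add_mul, hu, hv]
        | tmul p q => simp [hL, uEval_tmul]
    rw [h1, ← pentagon', h2, counit₃_φ, one_mul, h3]

/-- `φ₁ a_[-1] ⊗ U(φ₂ ▷ a_[0]) φ₃ = Δ(U(φ₁ ▷ a)) (φ₂ ⊗ φ₃)`. By `ext_of_uTail` this identity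
characterises the coaction on `𝐀` among the maps compatible with the action. -/
theorem uTail_φ_adCoact (a : H) :
    Q.uTail lreg Q.φ (Q.adCoact a) = twistEval Q.adAct Q.ΔU a Q.φ := by
  rw [adCoact_apply, uTail_φ_ract]
  have h1 : ∀ s t, Q.ΔAlphaMap (Q.coactKernel a t) s =
      twistEval Q.adAct Q.ΔU a (LinearMap.lTensor H Q.pRAlphaMap (Q.d₁ s * padR t)) := by
    intro s t
    induction s with
    | zero => simp
    | add r s hr hs => simp only [map_add, add_mul, hr, hs]
    | tmul x u =>
      have h2 : ∀ v : H ⊗[k] H, LinearMap.lTensor H Q.pRAlphaMap (app v u * padR t) =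
          onTail Q.comul v * LinearMap.lTensor H Q.pRMap t *
            (1 ⊗ₜ (1 ⊗ₜ contrA Q.S Q.alpha u)) := by
        intro v
        induction v with
        | zero => simp
        | add v w hv hw => simp only [app_add, map_add, add_mul, hv, hw]
        | tmul a b =>
          induction t using tensor₃_induction with
          | zero => simp
          | add r s hr hs => simp only [map_add, mul_add, add_mul, hr, hs]
          | tmul p q r =>
            induction u with
            | zero => simp
            | add v w hv hw =>
              simp only [map_add, mul_add, add_mul, TensorProduct.tmul_add, app_tmul] at *
              rw [hv, hw]
            | tmul c d =>
              simp [padR_tmul, pRAlphaMap_tmul, pRMap_tmul, contrA_tmul, mul_assoc, Δ]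
      rw [d₁_tmul, ΔAlphaMap_tmul, h2, twistEval_mul_tmul, Q.isTwisted_ΔU.mul_twistEval]
      simp [coactKernel, Δ]
  have h2 : ∀ s t, LinearMap.lTensor H Q.pRAlphaMap (Q.d₃ s * t) =
      onTail (Q.comul.comp Q.counitTail) s * LinearMap.lTensor H Q.pRAlphaMap t := by
    intro s t
    induction s using tensor₃_induction with
    | zero => simp
    | add r s hr hs => simp only [map_add, add_mul, hr, hs]
    | tmul x y z =>
      induction t using tensor₃_induction with
      | zero => simp
      | add r s hr hs => simp only [map_add, mul_add, hr, hs]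
      | tmul a b w =>
        rw [d₃_tmul]
        simp only [Algebra.TensorProduct.tmul_mul_tmul, LinearMap.lTensor_tmul, pRAlphaMap_tmul,
          contrA_Δ_mul]
        simp [mul_assoc, Δ]
  have h3 : ∀ t, LinearMap.lTensor H Q.pRAlphaMap (padL Q.φ * Q.d₂ t) = t := by
    intro t
    induction t using tensor₃_induction with
    | zero => simp
    | add r s hr hs => simp only [map_add, mul_add, hr, hs]
    | tmul x y z =>
      have key : ∀ s (v : H ⊗[k] H), Q.pRAlphaMap (s * app v z) =
          ΔAlphaMap Q (Q.pRMap v) s * (1 ⊗ₜ z) := by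
        intro s v
        induction s using tensor₃_induction with
        | zero => simp
        | add r s hr hs => simp only [map_add, add_mul, hr, hs]
        | tmul a b c =>
          induction v with
          | zero => simp [ΔAlphaMap_zero]
          | add v w hv hw => simp only [app_add, map_add, mul_add, ΔAlphaMap_add, add_mul, hv, hw]
          | tmul p q => simp [pRAlphaMap_tmul, ΔAlphaMap_tmul, pRMap_tmul, contrA_tmul, mul_assoc]
      have key2 : ∀ s, Q.ΔAlphaMap (Q.pR * (y ⊗ₜ 1)) s = Q.pRAlphaMap s * (y ⊗ₜ 1) := by
        intro s
        induction s with
        | zero => simp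
        | add r s hr hs => simp only [map_add, add_mul, hr, hs]
        | tmul a b => simp [pRAlphaMap_tmul, ΔAlphaMap_tmul, mul_assoc]
      rw [d₂_tmul, padL_apply, Algebra.TensorProduct.tmul_mul_tmul, LinearMap.lTensor_tmul, key,
        pRMap_Δ, key2, pRAlphaMap_φ]
      simp
  -- the argument `(Δ ⊗ id ⊗ id)(φ) (φ⁻¹ ⊗ 1)` is `(id ⊗ id ⊗ Δ)(φ⁻¹) (1 ⊗ φ) (id ⊗ Δ ⊗ id)(φ)`; its
  -- first factor collapses, and the other two give back `φ`
  rw [h1, d₁_φ_padR_ψ, mul_assoc, h2, h3]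
  have h4 : onTail (Q.comul.comp Q.counitTail) Q.ψ = 1 := by
    have h5 : ∀ t : H ⊗[k] (H ⊗[k] H), onTail (Q.comul.comp Q.counitTail) t =
        onTail Q.comul (onTail Q.counitTail t) := by
      intro t
      induction t with
      | zero => simp
      | add r s hr hs => simp only [map_add, hr, hs]
      | tmul a b => simp
    rw [h5, counit₃_ψ, map_one]
  rw [h4, one_mul]

/-! ### Passing between the two kinds of coactions -/

section FirstSecond

variable {V : Type*} [AddCommGroup V] [Module k V] (ρ : H →ₐ[k] Module.End k V)

/-- The right multiplication by `y` on the first factor of `H ⊗ V`. -/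
abbrev rmul (V : Type*) [AddCommGroup V] [Module k V] (y : H) : H ⊗[k] V →ₗ[k] H ⊗[k] V :=
  LinearMap.rTensor V (LinearMap.mulRight k y)

theorem rmul_rmul (x y : H) (z : H ⊗[k] V) :
    rmul (k := k) V y (rmul V x z) = rmul V (x * y) z := by
  induction z with
  | zero => simp
  | add s t hs ht => simp only [map_add, hs, ht]
  | tmul a b => simp [mul_assoc]

theorem rmul_add (x y : H) (z : H ⊗[k] V) :
    rmul (k := k) V (x + y) z = rmul V x z + rmul V y z := by
  induction z with
  | zero => simp
  | add s t hs ht => simp only [map_add, hs, ht]; abel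
  | tmul a b => simp [mul_add, TensorProduct.add_tmul]

theorem rmul_smul (c : k) (y : H) (z : H ⊗[k] V) :
    rmul (k := k) V (c • y) z = c • rmul V y z := by
  induction z with
  | zero => simp
  | add s t hs ht => simp only [map_add, hs, ht, smul_add]
  | tmul a b => simp [TensorProduct.smul_tmul']

theorem boxAct_lreg_rmul {B : Type*} [Ring B] [Algebra k B] (τ : B →ₐ[k] Module.End k V)
    (u : H ⊗[k] B) (y : H) (z : H ⊗[k] V) :
    boxAct lreg τ u (rmul V y z) = rmul V y (boxAct lreg τ u z) := by
  induction u with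
  | zero => simp
  | add s t hs ht => simp only [map_add, LinearMap.add_apply, hs, ht]
  | tmul a b =>
    induction z with
    | zero => simp
    | add s t hs ht => simp only [map_add, hs, ht]
    | tmul c v => simp [boxAct_tmul, mul_assoc]

theorem coactTwist_mul_tmul (δ : V →ₗ[k] H ⊗[k] V) (u : H ⊗[k] H) (x y : H) (m : V) :
    coactTwist ρ δ (u * (x ⊗ₜ y)) m = rmul V y (coactTwist ρ δ u (ρ x m)) := by
  induction u with
  | zero => simp
  | add s t hs ht => simp only [map_add, LinearMap.add_apply, add_mul, hs, ht]
  | tmul a b =>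
    simp only [Algebra.TensorProduct.tmul_mul_tmul, coactTwist_tmul, map_mul,
      Module.End.mul_apply]
    exact (rmul_rmul _ _ _).symm

/-- The compatibility of a coaction of the first kind with the action. -/
def IsCompat (δ : V →ₗ[k] H ⊗[k] V) : Prop :=
  ∀ (h : H) (x : V), boxAct lreg ρ (Q.Δ h) (δ x) = coactTwist ρ δ (Q.Δ h) x

variable {Q ρ} in
theorem IsCompat.boxAct_coactTwist {δ : V →ₗ[k] H ⊗[k] V} (hδ : Q.IsCompat ρ δ) (h : H)
    (u : H ⊗[k] H) (m : V) :
    boxAct lreg ρ (Q.Δ h) (coactTwist ρ δ u m) = coactTwist ρ δ (Q.Δ h * u) m := by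
  induction u with
  | zero => simp
  | add s t hs ht => simp only [map_add, LinearMap.add_apply, mul_add, hs, ht]
  | tmul a b => rw [coactTwist_mul_tmul, coactTwist_tmul, boxAct_lreg_rmul, hδ]

/-- `x ⊗ u ↦ Δ(x) · z · (S(u₁) α u₂ ⊗ 1)` -/
def qREval (z : H ⊗[k] V) : H ⊗[k] (H ⊗[k] H) →ₗ[k] H ⊗[k] V :=
  TensorProduct.lift (LinearMap.mk₂ k
    (fun x u => boxAct lreg ρ (Q.Δ x) (rmul V (contrA Q.S Q.alpha u) z))
    (by intro x y u; simp) (by intro c x u; simp)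
    (by intro x u v; simp only [map_add, rmul_add])
    (by intro c x u; simp only [map_smul, rmul_smul]))

theorem qREval_tmul (z : H ⊗[k] V) (x : H) (u : H ⊗[k] H) :
    Q.qREval ρ z (x ⊗ₜ u) = boxAct lreg ρ (Q.Δ x) (rmul V (contrA Q.S Q.alpha u) z) := by
  simp [qREval]

/-- The inverse antipode in `qᴿ` cancels against `S`: `S(S⁻¹(α φ₃) φ₂) = S(φ₂) α φ₃`. -/
theorem adBox_qR (z : H ⊗[k] V) :
    Q.adBox ρ (TensorProduct.map Q.Δ LinearMap.id Q.qR) z = Q.qREval ρ z Q.φ := by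
  unfold qR
  change _ = Q.qREval ρ z Q.phi.val
  induction Q.phi.val using tensor₃_induction with
  | zero => simp
  | add s t hs ht => simp only [map_add, LinearMap.add_apply, hs, ht]
  | tmul a b c =>
    rw [qREval_tmul]
    simp only [TensorProduct.map_tmul, LinearMap.id_apply]
    have h1 : ∀ v : H ⊗[k] H, Q.adBox ρ (v ⊗ₜ[k] (Q.Sinv (Q.alpha * c) * b)) z =
        boxAct lreg ρ v (rmul V (contrA Q.S Q.alpha (b ⊗ₜ c)) z) := by
      intro v
      induction v with
      | zero => simp
      | add s t hs ht =>
        simp only [TensorProduct.add_tmul, map_add, LinearMap.add_apply, hs, ht]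
      | tmul x y =>
        induction z with
        | zero => simp
        | add s t hs ht => simp only [map_add, hs, ht]
        | tmul d v => simp [adBox_tmul, boxAct_tmul, contrA_tmul, mul_assoc]
    rw [← h1]
    simp

/-- The coaction of the first kind is recovered from the one of the second kind. Only compatibility
with the action is needed, not coassociativity. -/
theorem toFirst_toSecond {δ : V →ₗ[k] H ⊗[k] V} (hδ : Q.IsCompat ρ δ) :
    Q.toFirst ρ (Q.toSecond ρ δ) = δ := by
  refine LinearMap.ext fun m => ?_
  rw [toFirst, LinearMap.comp_apply, adBox_qR, toSecond]
  have h1 : ∀ t, Q.qREval ρ (coactTwist ρ δ Q.pR m) t = coactTwist ρ δ (Q.pRAlphaMap t) m := by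
    intro t
    induction t with
    | zero => simp
    | add s t hs ht => simp only [map_add, LinearMap.add_apply, hs, ht]
    | tmul x u =>
      rw [qREval_tmul, pRAlphaMap_tmul, boxAct_lreg_rmul, hδ.boxAct_coactTwist,
        coactTwist_mul_tmul, map_one, Module.End.one_apply]
  rw [h1, pRAlphaMap_φ, Algebra.TensorProduct.one_def, coactTwist_tmul]
  simp

end FirstSecond

theorem adCoact_isCompat : Q.IsCompat Q.adAct Q.adCoact := Q.adCoact_compat

theorem toFirst_coactFormula₂ : Q.toFirst Q.adAct Q.coactFormula₂ = Q.adCoact := by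
  rw [← toSecond_adCoact, toFirst_toSecond _ _ Q.adCoact_isCompat]

/-- `x ⊗ y ⊗ u ↦ Δ(x) w (S(u₁) α u₂ ⊗ S(y))` -/
def coactAlphaMap (w : H ⊗[k] H) : H ⊗[k] (H ⊗[k] (H ⊗[k] H)) →ₗ[k] H ⊗[k] H :=
  mulMap (LinearMap.mulRight k w ∘ₗ Q.Δ)
    (TensorProduct.map (contrA Q.S Q.alpha) Q.S ∘ₗ (TensorProduct.comm k H (H ⊗[k] H)).toLinearMap)

theorem coactAlphaMap_tmul (w : H ⊗[k] H) (x y : H) (u : H ⊗[k] H) :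
    Q.coactAlphaMap w (x ⊗ₜ (y ⊗ₜ u)) =
      Q.Δ x * w * (contrA Q.S Q.alpha u ⊗ₜ Q.S y) := by
  simp [coactAlphaMap]

theorem coactAlphaMap_d₃_mul (w : H ⊗[k] H) (s : H ⊗[k] (H ⊗[k] H))
    (hs : onTail Q.counitTail s = 1) (t : H ⊗[k] (H ⊗[k] (H ⊗[k] H))) :
    Q.coactAlphaMap w (Q.d₃ s * t) = Q.coactAlphaMap w t := by
  have h1 : Q.coactAlphaMap w (Q.d₃ s * t) = Q.coactAlphaMap w
      (onTail (includeLeft : H →ₐ[k] H ⊗[k] (H ⊗[k] H)) (onTail Q.counitTail s) * t) := by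
    clear hs
    induction s using tensor₃_induction with
    | zero => simp
    | add r s hr hs => simp only [map_add, add_mul, hr, hs]
    | tmul x y z =>
      induction t using tensor₄_induction with
      | zero => simp
      | add r s hr hs => simp only [map_add, mul_add, hr, hs]
      | tmul a b c d =>
        rw [d₃_tmul]
        simp only [Algebra.TensorProduct.tmul_mul_tmul, coactAlphaMap_tmul, contrA_Δ_mul]
        simp [coactAlphaMap_tmul, ← TensorProduct.smul_tmul']
  rw [h1, hs, map_one, one_mul]

theorem ract_ract (s t : H ⊗[k] (H ⊗[k] H)) (r : H ⊗[k] H) :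
    Q.ract s (Q.ract t r) = Q.ract (s * t) r := by
  rw [map_mul]; rfl

theorem ract_Δ21 (h : H) (r : H ⊗[k] H) :
    Q.ract (Q.Δ21 h) r = mulMap (LinearMap.mulRight k r ∘ₗ Q.Δ)
      (TensorProduct.mk k H H 1 ∘ₗ Q.S) (Q.Δ h) := by
  rw [Δ21]
  induction Q.Δ h with
  | zero => simp
  | add u v hu hv => simp only [map_add, LinearMap.add_apply, hu, hv]
  | tmul x y => rw [comulHead_tmul, ract_app]; simp

theorem sandwichOI_app (v w : H ⊗[k] H) (b c : H) :
    Q.sandwichOI (app v (b ⊗ₜ c)) w = v * w * (Q.S c ⊗ₜ Q.S b) := by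
  induction v with
  | zero => simp
  | add u v hu hv => simp only [app_add, map_add, LinearMap.add_apply, add_mul, hu, hv]
  | tmul c d =>
    induction w with
    | zero => simp
    | add u v hu hv => simp only [map_add, mul_add, add_mul, hu, hv]
    | tmul e f => simp [sandwichOI_tmul, mul_assoc]

/-- The explicit formula of the first kind is obtained from the one of the second kind. Both involve
an element of `H^{⊗4}`, and these elements agree by the pentagon up to a factor
`(id ⊗ id ⊗ Δ)(φ⁻¹)`, which collapses against `α`. -/
theorem coactFormula₁_eq : Q.coactFormula₁ = Q.toFirst Q.adAct Q.coactFormula₂ := by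
  refine LinearMap.ext fun a => ?_
  rw [toFirst, coactFormula₁, coactFormula₂]
  simp only [LinearMap.comp_apply]
  generalize Q.ΔfInv a = w
  rw [adBox_qR]
  have h1 : ∀ s t, Q.sandwichOI (padR s * t) w =
      Q.ract s (Q.sandwichOI t w) := by
    intro s t
    induction s using tensor₃_induction with
    | zero => simp
    | add r s hr hs => simp only [map_add, LinearMap.add_apply, add_mul, hr, hs]
    | tmul x y z =>
      induction t using tensor₄_induction with
      | zero => simp
      | add r s hr hs => simp only [map_add, LinearMap.add_apply, mul_add, hr, hs]
      | tmul a b c d =>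
        induction w with
        | zero => simp
        | add u v hu hv => simp only [map_add, hu, hv]
        | tmul e f => simp [padR_tmul, ract_tmul, sandwichOI_tmul, mul_assoc]
  have h2 : ∀ s t, Q.qREval Q.adAct (Q.ract Q.φ (Q.sandwichOI (Q.d₁ t) w)) s =
      Q.ract Q.φ (Q.coactAlphaMap w (Q.d₁ s * padR t)) := by
    intro s t
    induction s with
    | zero => simp
    | add r s hr hs => simp only [map_add, add_mul, hr, hs]
    | tmul x u =>
      rw [qREval_tmul, boxAct_lreg_rmul, boxAct_lreg_adAct]
      change rmul H _ (Q.ract (Q.Δ12 x) _) = _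
      rw [ract_ract, Δ12_mul_φ, ← ract_ract, ract_Δ21]
      change LinearMap.rTensor H (LinearMap.mulRight k _) _ = _
      rw [rTensor_mulRight_eq_mul, ← ract_mul_left_tmul, d₁_tmul]
      congr 1
      induction Q.Δ x with
      | zero => simp
      | add v v' hv hv' => simp only [app_add, map_add, add_mul, hv, hv']
      | tmul p q =>
        rw [mulMap_tmul]
        simp only [LinearMap.comp_apply, LinearMap.mulRight_apply]
        induction t using tensor₃_induction with
        | zero => simp
        | add r s hr hs => simp only [map_add, LinearMap.add_apply, mul_add, add_mul, hr, hs]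
        | tmul a b c =>
          have key2 := Q.contrA_mul_tmul u c 1
          rw [d₁_tmul, sandwichOI_app, padR_tmul, app_tmul, Algebra.TensorProduct.tmul_mul_tmul,
            Algebra.TensorProduct.tmul_mul_tmul, coactAlphaMap_tmul, key2]
          simp [mul_assoc]
  have h3 : ∀ w, Q.sandwichOI' Q.tau₁ w = Q.ract Q.φ (Q.coactAlphaMap w (padL Q.φ * Q.d₂ Q.φ)) := by
    clear h1 h2 w
    intro w
    unfold tau₁ qR
    rw [pad_eq]
    change _ = Q.ract Q.φ (Q.coactAlphaMap w (padL Q.phi.val * Q.d₂ Q.phi.val))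
    have key : ∀ r s t, Q.sandwichOI' (TensorProduct.map
        (LinearMap.mulLeft k (padR r * ((1 : H) ⊗ₜ[k] ((1 : H) ⊗ₜ[k]
          (TensorProduct.map LinearMap.id
            (LinearMap.mul' k H ∘ₗ (TensorProduct.comm k H H).toLinearMap ∘ₗ
              TensorProduct.map LinearMap.id (Q.Sinv ∘ₗ LinearMap.mulLeft k Q.alpha)) s)))) ∘ₗ
          (TensorProduct.assoc k H H (H ⊗[k] H)).toLinearMap ∘ₗ TensorProduct.map Q.Δ Q.Δ)
        LinearMap.id ((TensorProduct.assoc k H H H).symm t)) w =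
        Q.ract r (Q.coactAlphaMap w (padL s * Q.d₂ t)) := by
      intro r s t
      induction t using tensor₃_induction with
      | zero => simp
      | add r s hr hs => simp only [map_add, LinearMap.add_apply, mul_add, hr, hs]
      | tmul x y z =>
        simp only [TensorProduct.assoc_symm_tmul, TensorProduct.map_tmul, LinearMap.comp_apply,
          LinearMap.mulLeft_apply, LinearMap.id_apply, LinearEquiv.coe_coe, d₂_tmul, padL_apply,
          Algebra.TensorProduct.tmul_mul_tmul, one_mul]
        induction r using tensor₃_induction with
        | zero => simp
        | add r s hr hs =>
          simp only [map_add, LinearMap.add_apply, TensorProduct.add_tmul, add_mul, hr, hs]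
        | tmul r₁ r₂ r₃ =>
          induction s using tensor₃_induction with
          | zero => simp
          | add r s hr hs =>
            simp only [map_add, LinearMap.add_apply, TensorProduct.add_tmul,
              TensorProduct.tmul_add, mul_add, add_mul, hr, hs]
          | tmul s₁ s₂ s₃ =>
            rw [ract_tmul]
            generalize Q.Δ y = v
            induction v with
            | zero => simp
            | add u v hu hv =>
              simp only [app_add, map_add, LinearMap.add_apply, TensorProduct.add_tmul,
                TensorProduct.tmul_add, mul_add, add_mul, hu, hv]
            | tmul c d =>
              simp only [app_tmul, Algebra.TensorProduct.tmul_mul_tmul, coactAlphaMap_tmul]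
              generalize Q.Δ x = u
              induction u with
              | zero => simp
              | add u v hu hv =>
                simp only [map_add, LinearMap.add_apply, TensorProduct.add_tmul, mul_add, add_mul,
                  hu, hv]
              | tmul a b =>
                induction w with
                | zero => simp
                | add u v hu hv =>
                  rw [map_add, hu, hv]
                  simp only [mul_add, add_mul]
                | tmul e f =>
                  simp [padR_tmul, sandwichOI'_tmul, contrA_tmul, mul_assoc]
    exact key _ _ _
  have h4 := Q.d₁_φ_padR_ψ
  rw [pad_eq, Δ1_eq, h1, h2, h3, h4, mul_assoc, coactAlphaMap_d₃_mul _ _ _ Q.counit₃_ψ]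

/-! ### The multiplication of `𝐀` -/

/-- For twisted `δ`, the map `m ↦ δ(pᴿ₁ m) pᴿ₂` is `H`-linear into `𝐀`. -/
theorem IsTwisted.act_twistEval_pR {V : Type*} [AddCommGroup V] [Module k V]
    {ρ : H →ₐ[k] Module.End k V} {δ : V →ₗ[k] H} (hδ : Q.IsTwisted ρ (AlgHom.id k H) δ)
    (h : H) (m : V) :
    twistEval ρ δ (ρ h m) Q.pR = Q.adAct h (twistEval ρ δ m Q.pR) := by
  have h1 := twistEval_mul_tmul ρ δ m Q.pR h 1
  rw [mul_one] at h1
  rw [← h1, ← pRMap_Δ, adAct_apply]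
  induction Q.Δ h with
  | zero => simp
  | add u v hu hv => simp only [map_add, LinearMap.add_apply, hu, hv]
  | tmul x y =>
    have h2 := hδ.mul_twistEval x m (Q.pR * (1 ⊗ₜ[k] Q.S y))
    rw [twistEval_mul_tmul, onTail_id, map_one, Module.End.one_apply] at h2
    rw [pRMap_tmul, sandwich_tmul, mul_assoc, h2]
    simp [mul_assoc]

/-- An `H`-linear map into `𝐀` is determined by its composition with `U`. -/
theorem ext_of_U {V : Type*} [AddCommGroup V] [Module k V] {ρ : H →ₐ[k] Module.End k V}
    {f g : V →ₗ[k] H} (hf : ∀ h m, f (ρ h m) = Q.adAct h (f m))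
    (hg : ∀ h m, g (ρ h m) = Q.adAct h (g m)) (hU : ∀ m, Q.U (f m) = Q.U (g m)) : f = g := by
  refine LinearMap.ext fun m => ?_
  have h1 : ∀ u, twistEval Q.adAct Q.U (f m) u = twistEval Q.adAct Q.U (g m) u := by
    intro u
    induction u with
    | zero => simp
    | add u v hu hv => simp only [map_add, hu, hv]
    | tmul x y => rw [twistEval_tmul, twistEval_tmul, ← hf, ← hg, hU]
  rw [← Q.twistEval_U_pR (f m), h1, twistEval_U_pR]

/-- The operator attached to `x ⊗ y ⊗ z`: `a ⊗ b ↦ U(x ▷ a) U(y ▷ b) z`. -/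
def uuTwist : H ⊗[k] (H ⊗[k] H) →ₗ[k] H ⊗[k] H →ₗ[k] H :=
  LinearMap.llcomp k (H ⊗[k] H) (H ⊗[k] H) H (LinearMap.mul' k H) ∘ₗ
    TensorProduct.homTensorHomMap (.id k) H H H H ∘ₗ
      TensorProduct.map (LinearMap.mulLeft k (Q.U : Module.End k H) ∘ₗ Q.adAct.toLinearMap)
        Q.uTwist

theorem uuTwist_tmul (x : H) (u : H ⊗[k] H) (a b : H) :
    Q.uuTwist (x ⊗ₜ u) (a ⊗ₜ b) = Q.U (Q.adAct x a) * Q.uTwist u b := by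
  simp [uuTwist]

/-- The operator attached to `x ⊗ y ⊗ z ⊗ w`: `a ⊗ b ⊗ c ↦ U(x ▷ a) U(y ▷ b) U(z ▷ c) w`. -/
def uuuTwist : H ⊗[k] (H ⊗[k] (H ⊗[k] H)) →ₗ[k] H ⊗[k] (H ⊗[k] H) →ₗ[k] H :=
  LinearMap.llcomp k (H ⊗[k] (H ⊗[k] H)) (H ⊗[k] H) H (LinearMap.mul' k H) ∘ₗ
    TensorProduct.homTensorHomMap (.id k) H (H ⊗[k] H) H H ∘ₗ
      TensorProduct.map (LinearMap.mulLeft k (Q.U : Module.End k H) ∘ₗ Q.adAct.toLinearMap)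
        Q.uuTwist

theorem uuuTwist_tmul (x : H) (t : H ⊗[k] (H ⊗[k] H)) (a : H) (m : H ⊗[k] H) :
    Q.uuuTwist (x ⊗ₜ t) (a ⊗ₜ m) = Q.U (Q.adAct x a) * Q.uuTwist t m := by
  simp [uuuTwist]

theorem uTwist_comul_mul (h : H) (u : H ⊗[k] H) (a : H) :
    Q.uTwist (Q.comul h * u) a = h * Q.uTwist u a := Q.uTwist_Δ_mul h u a

theorem mul_U_mul (h a c : H) : h * (Q.U a * c) = twistEval Q.adAct Q.U a (Q.Δ h) * c := by
  have := Q.isTwisted_U h a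
  rw [onTail_id] at this
  rw [← this, ← mul_assoc]
  rfl

theorem uuTwist_Δ12_mul (h : H) (t : H ⊗[k] (H ⊗[k] H)) (m : H ⊗[k] H) :
    Q.uuTwist (Q.Δ12 h * t) m = h * Q.uuTwist t m := by
  induction m with
  | zero => simp
  | add m n hm hn => simp only [map_add, mul_add, hm, hn]
  | tmul a b =>
    induction t with
    | zero => simp
    | add s t hs ht => simp only [map_add, LinearMap.add_apply, mul_add, hs, ht]
    | tmul x u =>
      rw [uuTwist_tmul, mul_U_mul, Δ12]
      induction Q.Δ h with
      | zero => simp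
      | add u v hu hv => simp only [map_add, LinearMap.add_apply, add_mul, hu, hv]
      | tmul p q => simp [uuTwist_tmul, uTwist_comul_mul, twistEval_tmul, mul_assoc]

theorem uuTwist_mul_app (t : H ⊗[k] (H ⊗[k] H)) (u : H ⊗[k] H) (z : H) (m : H ⊗[k] H) :
    Q.uuTwist (t * app u z) m = Q.uuTwist t (boxAct Q.adAct Q.adAct u m) * z := by
  induction u with
  | zero => simp
  | add u v hu hv => simp only [app_add, map_add, LinearMap.add_apply, mul_add, add_mul, hu, hv]
  | tmul p q =>
    induction m with
    | zero => simp
    | add m n hm hn => simp only [map_add, add_mul, hm, hn]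
    | tmul a b =>
      induction t with
      | zero => simp
      | add s t hs ht => simp only [map_add, LinearMap.add_apply, add_mul, hs, ht]
      | tmul x u =>
        simp [uuTwist_tmul, uTwist_mul_tmul, boxAct_tmul, mul_assoc]

theorem tensorAct_apply {V W : Type*} [AddCommGroup V] [Module k V] [AddCommGroup W] [Module k W]
    (ρ : H →ₐ[k] Module.End k V) (σ : H →ₐ[k] Module.End k W) (h : H) (m : V ⊗[k] W) :
    Q.tensorAct ρ σ h m = boxAct ρ σ (Q.Δ h) m := rfl

theorem isTwisted_uuTwist :
    Q.IsTwisted (Q.tensorAct Q.adAct Q.adAct) (AlgHom.id k H) (Q.uuTwist Q.φ) := by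
  intro h m
  rw [onTail_id]
  have h1 := Q.uuTwist_Δ12_mul h Q.φ m
  rw [AlgHom.id_apply, ← h1, Δ12_mul_φ, Δ21]
  induction Q.Δ h with
  | zero => simp
  | add u v hu hv => simp only [map_add, LinearMap.add_apply, mul_add, hu, hv]
  | tmul p q => rw [comulHead_tmul, uuTwist_mul_app, twistEval_tmul, tensorAct_apply]

theorem starOp_zero (m : H ⊗[k] H) : Q.starOp 0 m = 0 := by simp [starOp]

theorem starOp_add (s t : H ⊗[k] (H ⊗[k] (H ⊗[k] H))) (m : H ⊗[k] H) :
    Q.starOp (s + t) m = Q.starOp s m + Q.starOp t m := by simp [starOp]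

theorem starOp_smul (c : k) (t : H ⊗[k] (H ⊗[k] (H ⊗[k] H))) (m : H ⊗[k] H) :
    Q.starOp (c • t) m = c • Q.starOp t m := by simp [starOp]

/-- `a ⋆ b = U(φ₁ pᴿ₁₍₁₎ ▷ a) U(φ₂ pᴿ₁₍₂₎ ▷ b) φ₃ pᴿ₂` -/
theorem starMul_eq (m : H ⊗[k] H) :
    Q.starMul m = twistEval (Q.tensorAct Q.adAct Q.adAct) (Q.uuTwist Q.φ) m Q.pR := by
  have h1 : ∀ u, twistEval (Q.tensorAct Q.adAct Q.adAct) (Q.uuTwist Q.φ) m u =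
      Q.uuTwist (Q.φ * Q.comulHead H u) m := by
    intro u
    induction u with
    | zero => simp
    | add u v hu hv => simp only [map_add, LinearMap.add_apply, mul_add, hu, hv]
    | tmul p q => rw [comulHead_tmul, uuTwist_mul_app, twistEval_tmul, tensorAct_apply]
  rw [h1, φ_mul_comulHead_pR]
  clear h1
  induction m with
  | zero => simp
  | add m n hm hn => rw [map_add, map_add, hm, hn]
  | tmul a b =>
    -- the right-hand side is `starOp` at `(φ ⊗ 1) (Δ ⊗ id ⊗ id)(φ⁻¹)`, the left-hand side at
    -- `(1 ⊗ φ⁻¹) (id ⊗ id ⊗ Δ)(φ)`; by the pentagon they differ by `(id ⊗ Δ ⊗ id)(φ⁻¹)`, which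
    -- collapses against `α`
    have h2 : ∀ t, Q.uuTwist (LinearMap.lTensor H Q.pRMap t) (a ⊗ₜ b) =
        Q.starOp (padR Q.φ * Q.d₁ t) (a ⊗ₜ b) := by
      intro t
      induction t using tensor₃_induction with
      | zero => simp [starOp_zero]
      | add s t hs ht => simp only [starOp_add, map_add, LinearMap.add_apply, mul_add, hs, ht]
      | tmul x y z =>
        have h3 := Q.uTwist_mul_tmul (Q.Δ y * Q.pR) 1 (Q.S z) b
        rw [LinearMap.lTensor_tmul, uuTwist_tmul, pRMap_tmul, h3, uTwist_Δ_mul, uTwist_apply,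
          map_one, Module.End.one_apply, twistEval_U_pR, d₁_tmul, U_apply, adAct_apply,
          ← mul_assoc, ← mul_assoc, mul_assoc _ y, mul_assoc _ (y * b)]
        have key : ∀ s (v : H ⊗[k] H), Q.uEval (Q.sandwich v a) s * (y * b * Q.S z) =
            Q.starOp (padR s * app v (y ⊗ₜ z)) (a ⊗ₜ b) := by
          intro s v
          rw [← mul_one (Q.uEval _ _), ← uEval_mul_app]
          induction v with
          | zero => simp [starOp_zero]
          | add u v hu hv =>
            simp only [app_add, starOp_add, map_add, mul_add, add_mul, hu, hv]
          | tmul p q =>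
            induction s using tensor₃_induction with
            | zero => simp [starOp_zero]
            | add r s hr hs => simp only [starOp_add, map_add, add_mul, hr, hs]
            | tmul c d e =>
              simp [uEval_tmul, contrA_tmul, padR_tmul, starOp_tmul, mul_assoc]
        rw [← key]
    have h4 : ∀ s t, Q.starOp (Q.d₂ s * t) (a ⊗ₜ b) = Q.starOp
        (onTail (onTail (includeRight : H →ₐ[k] H ⊗[k] H))
          (onTail (includeRight : H →ₐ[k] H ⊗[k] H) (onTail (Q.counitHead H) s)) * t)
            (a ⊗ₜ b) := by
      intro s t
      induction s using tensor₃_induction with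
      | zero => simp [starOp_zero]
      | add r s hr hs => simp only [starOp_add, map_add, add_mul, hr, hs]
      | tmul x y z =>
        induction t using tensor₄_induction with
        | zero => simp [starOp_zero]
        | add r s hr hs => simp only [starOp_add, mul_add, hr, hs]
        | tmul p q r w =>
          have key : ∀ v : H ⊗[k] H, Q.starOp ((x ⊗ₜ app v z) * (p ⊗ₜ (q ⊗ₜ (r ⊗ₜ w)))) (a ⊗ₜ b) =
              x * p * a * Q.S q * contrA Q.S Q.alpha v * r * b * Q.S (z * w) := by
            intro v
            induction v with
            | zero => simp [starOp_zero]
            | add u v hu hv =>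
              simp only [app_add, starOp_add, TensorProduct.tmul_add, map_add, mul_add,
                add_mul, hu, hv]
            | tmul c d => simp [contrA_tmul, starOp_tmul, mul_assoc]
          rw [d₂_tmul, key, contrA_Δ]
          simp [starOp_smul, starOp_tmul, mul_assoc]
    rw [h2, padR_φ_d₁_ψ, mul_assoc, h4, counit₂_ψ, starMul, tauA, Δ3_eq]
    simp only [map_one, one_mul]
    rfl

theorem starMul_act (h : H) (m : H ⊗[k] H) :
    Q.starMul (Q.tensorAct Q.adAct Q.adAct h m) = Q.adAct h (Q.starMul m) := by
  rw [starMul_eq, starMul_eq, IsTwisted.act_twistEval_pR _ Q.isTwisted_uuTwist]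

/-- `U(a ⋆ b) = U(φ₁ ▷ a) U(φ₂ ▷ b) φ₃` -/
theorem U_starMul (m : H ⊗[k] H) : Q.U (Q.starMul m) = Q.uuTwist Q.φ m := by
  rw [starMul_eq, IsTwisted.U_twistEval_pR _ Q.isTwisted_uuTwist]

theorem starMul_beta_left (a : H) : Q.starMul (Q.beta ⊗ₜ a) = a := by
  have h1 : ∀ t, Q.starOp t (Q.beta ⊗ₜ a) = Q.sandwich (Q.zigHead t) a := by
    intro t
    induction t using tensor₄_induction with
    | zero => simp [starOp_zero]
    | add s t hs ht => simp only [starOp_add, map_add, LinearMap.add_apply, hs, ht]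
    | tmul x y z w => simp [starOp_tmul, zigHead_tmul, contrAHead_tmul, sandwich_tmul, mul_assoc]
  rw [starMul, h1, tauA, Δ3_eq]
  change Q.sandwich (Q.zigHead (padL Q.ψ * Q.d₃ Q.φ)) a = a
  rw [zigHead_tauA]; simp

theorem starMul_beta_right (a : H) : Q.starMul (a ⊗ₜ Q.beta) = a := by
  have h1 : ∀ s t, Q.starOp (padL s * Q.d₃ t) (a ⊗ₜ Q.beta) =
      mulMap (LinearMap.mulRight k a) (LinearMap.mulRight k (Q.zag s) ∘ₗ Q.S)
        (onTail Q.counitTail t) := by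
    intro s t
    induction s using tensor₃_induction with
    | zero =>
      have : mulMap (LinearMap.mulRight k a) (LinearMap.mulRight k (0 : H) ∘ₗ Q.S) = 0 := by
        apply TensorProduct.ext'; simp
      simp only [map_zero, zero_mul, starOp_zero]
      rw [this]; rfl
    | add r s hr hs =>
      simp only [starOp_add, map_add, add_mul, hr, hs]
      induction onTail Q.counitTail t with
      | zero => simp
      | add u v hu hv => simp only [map_add, ← hu, ← hv]; abel
      | tmul p q => simp [mul_add]
    | tmul p q r =>
      induction t using tensor₃_induction with
      | zero => simp [starOp_zero]
      | add r s hr hs => simp only [starOp_add, map_add, mul_add, hr, hs]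
      | tmul x y z =>
        have key : ∀ v : H ⊗[k] H, Q.starOp ((1 ⊗ₜ (p ⊗ₜ (q ⊗ₜ r))) * (x ⊗ₜ (y ⊗ₜ v)))
            (a ⊗ₜ Q.beta) = x * a * Q.S y * Q.S p * Q.alpha * q * contrB Q.S Q.beta v * Q.S r := by
          intro v
          induction v with
          | zero => simp [starOp_zero]
          | add u v hu hv =>
            simp only [starOp_add, TensorProduct.tmul_add, map_add, mul_add,
              add_mul, hu, hv]
          | tmul c d => simp [contrB_tmul, starOp_tmul, mul_assoc]
        rw [padL_apply, d₃_tmul, key, contrB_Δ]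
        simp [zag_tmul, contrB_tmul, mul_assoc]
  rw [starMul, tauA, Δ3_eq]
  change Q.starOp (padL Q.ψ * Q.d₃ Q.φ) _ = a
  rw [h1, counit₃_φ, zag_ψ]
  simp [Algebra.TensorProduct.one_def]

theorem starMul_assoc (a b c : H) :
    Q.starMul (Q.starMul (a ⊗ₜ[k] b) ⊗ₜ[k] c) =
      Q.starMul (LinearMap.lTensor H Q.starMul
        (boxAct Q.adAct (boxAct Q.adAct Q.adAct) Q.φ (a ⊗ₜ[k] (b ⊗ₜ[k] c)))) := by
  let f : (H ⊗[k] (H ⊗[k] H)) →ₗ[k] H := Q.starMul ∘ₗ LinearMap.rTensor H Q.starMul ∘ₗ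
    (TensorProduct.assoc k H H H).symm.toLinearMap
  let g : (H ⊗[k] (H ⊗[k] H)) →ₗ[k] H := Q.starMul ∘ₗ LinearMap.lTensor H Q.starMul
  let ρ₃ := boxAct Q.adAct (boxAct Q.adAct Q.adAct)
  have hmul : ∀ u m, Q.starMul (boxAct Q.adAct Q.adAct (Q.Δ u) m) = Q.adAct u (Q.starMul m) :=
    Q.starMul_act
  have hf1 : ∀ (u : H ⊗[k] H) m, f (ρ₃ (Q.comulHead H u) m) =
      Q.starMul (boxAct Q.adAct Q.adAct u
        (LinearMap.rTensor H Q.starMul ((TensorProduct.assoc k H H H).symm m))) := by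
    intro u m
    induction u with
    | zero => simp
    | add u v hu hv => simp only [map_add, LinearMap.add_apply, hu, hv]
    | tmul x y =>
      induction m using tensor₃_induction with
      | zero => simp
      | add r s hr hs => simp only [map_add, hr, hs]
      | tmul a b c =>
        rw [comulHead_tmul, TensorProduct.assoc_symm_tmul, LinearMap.rTensor_tmul, boxAct_tmul,
          ← hmul]
        induction Q.Δ x with
        | zero => simp
        | add u v hu hv =>
          simp only [app_add, map_add, LinearMap.add_apply, TensorProduct.add_tmul, hu, hv]
        | tmul p q => simp [f, ρ₃, boxAct_tmul]
  have hg1 : ∀ (u : H ⊗[k] H) m, g (ρ₃ (onTail Q.comul u) m) =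
      Q.starMul (boxAct Q.adAct Q.adAct u (LinearMap.lTensor H Q.starMul m)) := by
    intro u m
    induction u with
    | zero => simp
    | add u v hu hv => simp only [map_add, LinearMap.add_apply, hu, hv]
    | tmul x y =>
      induction m with
      | zero => simp
      | add r s hr hs => simp only [map_add, hr, hs]
      | tmul a m =>
        rw [LinearMap.lTensor_tmul, boxAct_tmul, ← hmul]
        simp [g, ρ₃, boxAct_tmul, Δ]
  have hf : ∀ h m, f (ρ₃ (Q.Δ21 h) m) = Q.adAct h (f m) := by
    intro h m
    rw [Δ21, hf1, hmul]
    rfl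
  have hg : ∀ h m, g (ρ₃ (Q.Δ12 h) m) = Q.adAct h (g m) := by
    intro h m
    rw [Δ12, hg1, hmul]
    rfl
  -- the action of `H` on `(𝐀 ⊗ 𝐀) ⊗ 𝐀`
  let ρ : H →ₐ[k] Module.End k (H ⊗[k] (H ⊗[k] H)) :=
    ρ₃.comp ((Q.comulHead H).comp Q.comul)
  have hfg : f = g ∘ₗ ρ₃ Q.φ := by
    refine Q.ext_of_U (ρ := ρ) hf (fun h m => ?_) fun m => ?_
    · change g (ρ₃ Q.φ (ρ₃ (Q.Δ21 h) m)) = _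
      rw [← Module.End.mul_apply, ← map_mul, ← Δ12_mul_φ, map_mul, Module.End.mul_apply, hg]
      rfl
    -- after applying `U`, both sides are `a ⊗ b ⊗ c ↦ U(x ▷ a) U(y ▷ b) U(z ▷ c) w`, summed over
    -- the two sides `x ⊗ y ⊗ z ⊗ w` of the pentagon
    · have h1 : ∀ t m, Q.uuTwist t (LinearMap.rTensor H Q.starMul
          ((TensorProduct.assoc k H H H).symm m)) = Q.uuuTwist (Q.d₃ Q.φ * Q.d₁ t) m := by
        intro t m
        induction t with
        | zero => simp
        | add s t hs ht => simp only [map_add, LinearMap.add_apply, mul_add, hs, ht]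
        | tmul x u =>
          induction m using tensor₃_induction with
          | zero => simp
          | add s t hs ht => simp only [map_add, hs, ht]
          | tmul a b c =>
            have key : ∀ s (v : H ⊗[k] H), Q.uuTwist (s * app v 1) (a ⊗ₜ b) * Q.uTwist u c =
                Q.uuuTwist (Q.d₃ s * app v u) (a ⊗ₜ (b ⊗ₜ c)) := by
              intro s v
              induction v with
              | zero => simp
              | add v w hv hw =>
                simp only [app_add, map_add, LinearMap.add_apply, mul_add, add_mul, hv, hw]
              | tmul p q =>
                induction s using tensor₃_induction with
                | zero => simp
                | add r s hr hs => simp only [map_add, LinearMap.add_apply, add_mul, hr, hs]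
                | tmul y z w =>
                  simp [d₃_tmul, uuTwist_tmul, uuuTwist_tmul, uTwist_tmul, uTwist_Δ_mul,
                    mul_assoc]
            rw [TensorProduct.assoc_symm_tmul, LinearMap.rTensor_tmul, uuTwist_tmul, ← hmul,
              U_starMul, ← mul_one (Q.uuTwist _ _), ← uuTwist_mul_app, d₁_tmul, key]
      have h2 : ∀ t m, Q.uuTwist t (LinearMap.lTensor H Q.starMul m) =
          Q.uuuTwist (padL Q.φ * Q.d₂ t) m := by
        intro t m
        induction t using tensor₃_induction with
        | zero => simp
        | add s t hs ht => simp only [map_add, LinearMap.add_apply, mul_add, hs, ht]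
        | tmul x y z =>
          induction m with
          | zero => simp
          | add s t hs ht => simp only [map_add, hs, ht]
          | tmul a m =>
            rw [LinearMap.lTensor_tmul, uuTwist_tmul, uTwist_tmul, ← hmul, U_starMul,
              ← uuTwist_mul_app, d₂_tmul, padL_apply, Algebra.TensorProduct.tmul_mul_tmul,
              uuuTwist_tmul, one_mul]
      have h3 : ∀ s t m, Q.uuuTwist s (ρ₃ t m) = Q.uuuTwist (s * padR t) m := by
        intro s t m
        induction t using tensor₃_induction with
        | zero => simp
        | add r t hr ht => simp only [map_add, LinearMap.add_apply, mul_add, hr, ht]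
        | tmul x y z =>
          induction m using tensor₃_induction with
          | zero => simp
          | add r t hr ht => simp only [map_add, hr, ht]
          | tmul a b c =>
            induction s using tensor₄_induction with
            | zero => simp
            | add r t hr ht => simp only [map_add, LinearMap.add_apply, add_mul, hr, ht]
            | tmul p q r w =>
              simp [ρ₃, boxAct_tmul, padR_tmul, uuuTwist_tmul, uuTwist_tmul, uTwist_tmul]
      change Q.U (Q.starMul _) = Q.U (Q.starMul _)
      rw [U_starMul, U_starMul, h2, h3, ← pentagon']
      exact h1 _ _
  have h := LinearMap.congr_fun hfg (a ⊗ₜ (b ⊗ₜ c))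
  simpa [f, g, ρ₃] using h

/-! ### Linear maps into `B ⊗ 𝐀` -/

section Ext

variable {V : Type*} [AddCommGroup V] [Module k V] {W : Type*} [AddCommGroup W] [Module k W]
  (ρ : H →ₐ[k] Module.End k V) (σ : H →ₐ[k] Module.End k W)
  {B : Type*} [Ring B] [Algebra k B]

theorem uTail_mul_tmul (t : H ⊗[k] (H ⊗[k] H)) (x y z : H) (v : W ⊗[k] H) :
    Q.uTail σ (t * (x ⊗ₜ (y ⊗ₜ z))) v =
      LinearMap.lTensor W (LinearMap.mulRight k z)
        (Q.uTail σ t (boxAct σ Q.adAct (x ⊗ₜ y) v)) := by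
  induction v with
  | zero => simp
  | add v w hv hw => simp only [map_add, hv, hw]
  | tmul w a =>
    induction t with
    | zero => simp
    | add s t hs ht => simp only [map_add, LinearMap.add_apply, add_mul, hs, ht]
    | tmul c u => simp [uTail_tmul, uTwist_mul_tmul, boxAct_tmul]

theorem uTail_mul_app (t : H ⊗[k] (H ⊗[k] H)) (u : H ⊗[k] H) (z : H) (v : W ⊗[k] H) :
    Q.uTail σ (t * app u z) v =
      LinearMap.lTensor W (LinearMap.mulRight k z) (Q.uTail σ t (boxAct σ Q.adAct u v)) := by
  induction u with
  | zero => simp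
  | add u v hu hv => simp only [app_add, map_add, LinearMap.add_apply, mul_add, hu, hv]
  | tmul p q => rw [app_tmul, uTail_mul_tmul]

/-- A vector `v` of `W ⊗ 𝐀` can be recovered from the values of `w ⊗ a ↦ φ₁ w ⊗ U(φ₂ ▷ a) φ₃` at the
vectors `h v`. -/
theorem boxAct_uTail_pR (v : W ⊗[k] H) :
    boxAct σ Q.sandwich Q.φ (Q.uTail σ (Q.φ * Q.comulHead H Q.pR) v) = v := by
  rw [φ_mul_comulHead_pR]
  have h1 : ∀ t, Q.uTail σ (LinearMap.lTensor H Q.pRMap t) v = boxAct σ Q.sandwich t v := by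
    intro t
    induction t using tensor₃_induction with
    | zero => simp
    | add s t hs ht => simp only [map_add, LinearMap.add_apply, hs, ht]
    | tmul x y z =>
      induction v with
      | zero => simp
      | add v w hv hw => simp only [map_add, hv, hw]
      | tmul w a =>
        have h3 := Q.uTwist_mul_tmul (Q.Δ y * Q.pR) 1 (Q.S z) a
        rw [LinearMap.lTensor_tmul, uTail_tmul, pRMap_tmul, h3, uTwist_Δ_mul, uTwist_apply,
          map_one, Module.End.one_apply, twistEval_U_pR, boxAct_tmul, sandwich_tmul]
  rw [h1, ← Module.End.mul_apply, ← map_mul, φ_mul_ψ, map_one, Module.End.one_apply]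

/-- `x ⊗ b ↦ δ(x m) (b ⊗ 1)` -/
def rightTwist (δ : V →ₗ[k] B ⊗[k] W) (m : V) : H ⊗[k] B →ₗ[k] B ⊗[k] W :=
  TensorProduct.lift ((LinearMap.rTensorHom W ∘ₗ (LinearMap.mul k B).flip).flip ∘ₗ
    (δ ∘ₗ ρ.toLinearMap.flip m))

theorem rightTwist_tmul (δ : V →ₗ[k] B ⊗[k] W) (m : V) (x : H) (b : B) :
    rightTwist ρ δ m (x ⊗ₜ b) = LinearMap.rTensor W (LinearMap.mulRight k b) (δ (ρ x m)) := by
  simp only [rightTwist, TensorProduct.lift.tmul, LinearMap.comp_apply, LinearMap.flip_apply]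
  rfl

theorem rTensor_mulRight_mul (b c : B) (z : B ⊗[k] W) :
    LinearMap.rTensor W (LinearMap.mulRight k (b * c)) z =
      LinearMap.rTensor W (LinearMap.mulRight k c)
        (LinearMap.rTensor W (LinearMap.mulRight k b) z) := by
  induction z with
  | zero => simp
  | add v w hv hw => simp only [map_add, hv, hw]
  | tmul a w => simp [mul_assoc]

theorem rightTwist_mul_tmul (δ : V →ₗ[k] B ⊗[k] W) (m : V) (t : H ⊗[k] B) (x : H) (b : B) :
    rightTwist ρ δ m (t * (x ⊗ₜ b)) =
      LinearMap.rTensor W (LinearMap.mulRight k b) (rightTwist ρ δ (ρ x m) t) := by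
  induction t with
  | zero => simp
  | add s t hs ht => simp only [map_add, add_mul, hs, ht]
  | tmul y c =>
    rw [Algebra.TensorProduct.tmul_mul_tmul, rightTwist_tmul, rightTwist_tmul,
      rTensor_mulRight_mul]
    simp

/-- The `H`-module `B`, for an algebra map `F : H → B`. -/
abbrev lregAlong (F : H →ₐ[k] B) : H →ₐ[k] Module.End k B := (Algebra.lmul k B).comp F

theorem uTail_rTensor_mulRight (F : H →ₐ[k] B) (t : H ⊗[k] (H ⊗[k] H)) (b : B) (z : B ⊗[k] H) :
    Q.uTail (lregAlong F) t (LinearMap.rTensor H (LinearMap.mulRight k b) z) =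
      LinearMap.rTensor H (LinearMap.mulRight k b) (Q.uTail (lregAlong F) t z) := by
  induction t with
  | zero => simp
  | add s t hs ht => simp only [map_add, LinearMap.add_apply, hs, ht]
  | tmul x u =>
    induction z with
    | zero => simp
    | add v w hv hw => simp only [map_add, hv, hw]
    | tmul a w => simp [uTail_tmul, mul_assoc]

/-- Twisted linear maps `V → B ⊗ 𝐀` are determined by their images under
`b ⊗ a ↦ F(φ₁) b ⊗ U(φ₂ ▷ a) φ₃`. -/
theorem ext_of_uTail (F : H →ₐ[k] B) {f g : V →ₗ[k] B ⊗[k] H}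
    (hf : ∀ h m, boxAct (lregAlong F) Q.adAct (Q.Δ h) (f m) =
      rightTwist ρ f m (onTail F (Q.Δ h)))
    (hg : ∀ h m, boxAct (lregAlong F) Q.adAct (Q.Δ h) (g m) =
      rightTwist ρ g m (onTail F (Q.Δ h)))
    (h : ∀ m, Q.uTail (lregAlong F) Q.φ (f m) = Q.uTail (lregAlong F) Q.φ (g m)) : f = g := by
  refine LinearMap.ext fun m => ?_
  have h1 : ∀ u, Q.uTail (lregAlong F) Q.φ (rightTwist ρ f m u) =
      Q.uTail (lregAlong F) Q.φ (rightTwist ρ g m u) := by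
    intro u
    induction u with
    | zero => simp
    | add u v hu hv => simp only [map_add, hu, hv]
    | tmul x y =>
      rw [rightTwist_tmul, rightTwist_tmul, uTail_rTensor_mulRight, uTail_rTensor_mulRight, h]
  have h2 : ∀ u, Q.uTail (lregAlong F) (Q.φ * Q.comulHead H u) (f m) =
      Q.uTail (lregAlong F) (Q.φ * Q.comulHead H u) (g m) := by
    intro u
    induction u with
    | zero => simp
    | add u v hu hv => simp only [map_add, LinearMap.add_apply, mul_add, hu, hv]
    | tmul x y => rw [comulHead_tmul, uTail_mul_app, uTail_mul_app, hf, hg, h1]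
  rw [← Q.boxAct_uTail_pR (lregAlong F) (f m), h2, boxAct_uTail_pR]

end Ext

theorem uTail_φ_coactTwist (a : H) (u : H ⊗[k] H) :
    Q.uTail lreg Q.φ (coactTwist Q.adAct Q.adCoact u a) =
      twistEval Q.adAct Q.ΔU a (Q.φ * onTail includeLeft u) := by
  induction u with
  | zero => simp
  | add u v hu hv => simp only [map_add, LinearMap.add_apply, mul_add, hu, hv]
  | tmul x y =>
    have h := Q.uTail_rTensor_mulRight (AlgHom.id k H) Q.φ y (Q.adCoact (Q.adAct x a))
    change Q.uTail lreg _ _ = LinearMap.rTensor H _ (Q.uTail lreg _ _) at h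
    rw [coactTwist_tmul, h, uTail_φ_adCoact, rTensor_mulRight_eq_mul]
    simp [twistEval_mul_tmul]

/-- `β` is coinvariant. -/
theorem adCoact_beta : Q.adCoact Q.beta = 1 ⊗ₜ Q.beta := by
  have h0 : Q.U Q.beta = 1 := Q.zig_φ
  have h1 : ∀ t, Q.coactKernel Q.beta t = Q.pRMap (Q.counitHead (H ⊗[k] H) t) := by
    intro t
    induction t with
    | zero => simp
    | add s t hs ht => simp only [map_add, hs, ht]
    | tmul x u =>
      simp [coactKernel, twistEval_tmul, adAct_apply, sandwich_apply_beta, contrB_Δ, ΔU, h0]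
  have h2 : Q.pRMap 1 = Q.pR := by
    rw [Algebra.TensorProduct.one_def, pRMap_tmul]; simp [← Algebra.TensorProduct.one_def]
  rw [adCoact_apply, h1, counit₁_ψ, h2, pR_eq, ract_ract, φ_mul_ψ, map_one, Module.End.one_apply]

theorem adAct_beta (h : H) : Q.adAct h Q.beta = Q.counit h • Q.beta := by
  rw [adAct_apply, sandwich_apply_beta, contrB_Δ]

/-! ### Coassociativity of the first kind for `𝐀` -/

section Coassoc

variable {V : Type*} [AddCommGroup V] [Module k V] (ρ : H →ₐ[k] Module.End k V)

/-- The action of `H ⊗ H ⊗ H` on `(H ⊗ H) ⊗ V`. -/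
def act₃ : H ⊗[k] (H ⊗[k] H) →ₐ[k] Module.End k ((H ⊗[k] H) ⊗[k] V) :=
  (boxAct (Algebra.lmul k (H ⊗[k] H)) ρ).comp
    (Algebra.TensorProduct.assoc k k k H H H).symm.toAlgHom

theorem act₃_tmul (x y z : H) (u : H ⊗[k] H) (v : V) :
    act₃ ρ (x ⊗ₜ (y ⊗ₜ z)) (u ⊗ₜ[k] v) = ((x ⊗ₜ y) * u) ⊗ₜ ρ z v := by
  simp [act₃, boxAct_tmul]

theorem act₃_app (u : H ⊗[k] H) (z : H) (w : H ⊗[k] H) (v : V) :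
    act₃ ρ (app u z) (w ⊗ₜ[k] v) = (u * w) ⊗ₜ ρ z v := by
  induction u with
  | zero => simp
  | add u v hu hv =>
    simp only [app_add, map_add, LinearMap.add_apply, add_mul, TensorProduct.add_tmul, hu, hv]
  | tmul p q => rw [app_tmul, act₃_tmul]

theorem act₃_rTensor_mulRight (t : H ⊗[k] (H ⊗[k] H)) (b : H ⊗[k] H) (z : (H ⊗[k] H) ⊗[k] V) :
    act₃ ρ t (LinearMap.rTensor V (LinearMap.mulRight k b) z) =
      LinearMap.rTensor V (LinearMap.mulRight k b) (act₃ ρ t z) := by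
  induction t using tensor₃_induction with
  | zero => simp
  | add s t hs ht => simp only [map_add, LinearMap.add_apply, hs, ht]
  | tmul x y w =>
    induction z with
    | zero => simp
    | add v w hv hw => simp only [map_add, hv, hw]
    | tmul a v => simp [act₃_tmul, mul_assoc]

theorem act₃_comulHead (u : H ⊗[k] H) (z : (H ⊗[k] H) ⊗[k] V) :
    act₃ ρ (Q.comulHead H u) z = boxAct (lregAlong Q.comul) ρ u z := by
  induction u with
  | zero => simp
  | add u v hu hv => simp only [map_add, LinearMap.add_apply, hu, hv]
  | tmul x y =>
    induction z with
    | zero => simp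
    | add v w hv hw => simp only [map_add, hv, hw]
    | tmul a v => rw [comulHead_tmul, act₃_app, boxAct_tmul]; rfl

/-- The operator attached to `x ⊗ u`: `h ⊗ v ↦ (x h ⊗ (u₁ v)_[-1] u₂) ⊗ (u₁ v)_[0]`. -/
def iterCoact (δ : V →ₗ[k] H ⊗[k] V) :
    H ⊗[k] (H ⊗[k] H) →ₗ[k] H ⊗[k] V →ₗ[k] (H ⊗[k] H) ⊗[k] V :=
  LinearMap.llcomp k (H ⊗[k] V) _ _ (TensorProduct.assoc k H H V).symm.toLinearMap ∘ₗ
    TensorProduct.homTensorHomMap (.id k) H V H (H ⊗[k] V) ∘ₗ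
      TensorProduct.map (Algebra.lmul k H).toLinearMap (coactTwist ρ δ)

theorem iterCoact_tmul (δ : V →ₗ[k] H ⊗[k] V) (x : H) (u : H ⊗[k] H) (h : H) (v : V) :
    iterCoact ρ δ (x ⊗ₜ u) (h ⊗ₜ v) =
      (TensorProduct.assoc k H H V).symm ((x * h) ⊗ₜ coactTwist ρ δ u v) := by
  simp [iterCoact]

theorem yd1Left_eq (δ : V →ₗ[k] H ⊗[k] V) (v : V) :
    Q.yd1Left ρ δ v = TensorProduct.assoc k H H V (iterCoact ρ δ Q.φ (δ v)) := by
  simp [yd1Left, iterCoact]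

theorem iterCoact_mul_app (δ : V →ₗ[k] H ⊗[k] V) (t : H ⊗[k] (H ⊗[k] H)) (u : H ⊗[k] H) (z : H)
    (w : H ⊗[k] V) :
    iterCoact ρ δ (t * app u z) w = LinearMap.rTensor V (LinearMap.mulRight k (1 ⊗ₜ z))
      (iterCoact ρ δ t (boxAct lreg ρ u w)) := by
  induction u with
  | zero => simp
  | add u v hu hv => simp only [app_add, map_add, LinearMap.add_apply, mul_add, hu, hv]
  | tmul p q =>
    induction t with
    | zero => simp
    | add s t hs ht => simp only [map_add, LinearMap.add_apply, add_mul, hs, ht]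
    | tmul x u =>
      induction w with
      | zero => simp
      | add v w hv hw => simp only [map_add, hv, hw]
      | tmul h v =>
        have key : ∀ y (w : H ⊗[k] V), (TensorProduct.assoc k H H V).symm (y ⊗ₜ rmul V z w) =
            LinearMap.rTensor V (LinearMap.mulRight k (1 ⊗ₜ z))
              ((TensorProduct.assoc k H H V).symm (y ⊗ₜ w)) := by
          intro y w
          induction w with
          | zero => simp
          | add v w hv hw => simp only [map_add, TensorProduct.tmul_add, hv, hw]
          | tmul h v => simp
        simp [boxAct_tmul, iterCoact_tmul, coactTwist_mul_tmul, key, mul_assoc]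

theorem iterCoact_rmul (δ : V →ₗ[k] H ⊗[k] V) (t : H ⊗[k] (H ⊗[k] H)) (y : H) (w : H ⊗[k] V) :
    iterCoact ρ δ t (rmul V y w) =
      LinearMap.rTensor V (LinearMap.mulRight k (y ⊗ₜ 1)) (iterCoact ρ δ t w) := by
  induction t with
  | zero => simp
  | add s t hs ht => simp only [map_add, LinearMap.add_apply, hs, ht]
  | tmul x u =>
    induction w with
    | zero => simp
    | add v w hv hw => simp only [map_add, hv, hw]
    | tmul h v =>
      have key : ∀ x (w : H ⊗[k] V), (TensorProduct.assoc k H H V).symm ((x * y) ⊗ₜ w) =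
          LinearMap.rTensor V (LinearMap.mulRight k (y ⊗ₜ 1))
            ((TensorProduct.assoc k H H V).symm (x ⊗ₜ w)) := by
        intro x w
        induction w with
        | zero => simp
        | add v w hv hw => simp only [map_add, TensorProduct.tmul_add, hv, hw]
        | tmul h v => simp
      simp [iterCoact_tmul, ← mul_assoc, key]

variable {Q ρ} in
theorem IsCompat.act₃_iterCoact {δ : V →ₗ[k] H ⊗[k] V} (hδ : Q.IsCompat ρ δ) (h : H)
    (t : H ⊗[k] (H ⊗[k] H)) (w : H ⊗[k] V) :
    act₃ ρ (Q.Δ12 h) (iterCoact ρ δ t w) = iterCoact ρ δ (Q.Δ12 h * t) w := by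
  induction t with
  | zero => simp
  | add s t hs ht => simp only [map_add, LinearMap.add_apply, mul_add, hs, ht]
  | tmul x u =>
    induction w with
    | zero => simp
    | add v w hv hw => simp only [map_add, hv, hw]
    | tmul y v =>
      rw [Δ12, iterCoact_tmul]
      induction Q.Δ h with
      | zero => simp
      | add u v hu hv => simp only [map_add, LinearMap.add_apply, add_mul, hu, hv]
      | tmul p q =>
        have key : ∀ (s : H ⊗[k] H) (z : H) (w : H ⊗[k] V), act₃ ρ (p ⊗ₜ s)
            ((TensorProduct.assoc k H H V).symm (z ⊗ₜ w)) =
              (TensorProduct.assoc k H H V).symm ((p * z) ⊗ₜ boxAct lreg ρ s w) := by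
          intro s z w
          induction s with
          | zero => simp
          | add u v hu hv =>
            simp only [TensorProduct.tmul_add, map_add, LinearMap.add_apply, hu, hv]
          | tmul p q =>
            induction w with
            | zero => simp
            | add v w hv hw => simp only [map_add, TensorProduct.tmul_add, hv, hw]
            | tmul h v => simp [act₃_tmul, boxAct_tmul]
        have h1 := hδ.boxAct_coactTwist q u v
        simp only [Δ, AlgHom.toLinearMap_apply] at h1
        simp only [Algebra.TensorProduct.map_tmul, AlgHom.coe_id, id_eq, key,
          Algebra.TensorProduct.tmul_mul_tmul, iterCoact_tmul, h1, mul_assoc]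

end Coassoc

section Coassoc

variable {V : Type*} [AddCommGroup V] [Module k V] (ρ : H →ₐ[k] Module.End k V)

theorem rightTwist_add {W : Type*} [AddCommGroup W] [Module k W] {B : Type*} [Ring B]
    [Algebra k B] (δ : V →ₗ[k] B ⊗[k] W) (m n : V) (t : H ⊗[k] B) :
    rightTwist ρ δ (m + n) t = rightTwist ρ δ m t + rightTwist ρ δ n t := by
  induction t with
  | zero => simp
  | add s t hs ht => simp only [map_add, hs, ht]; abel
  | tmul x b => simp [rightTwist_tmul]

theorem rightTwist_smul {W : Type*} [AddCommGroup W] [Module k W] {B : Type*} [Ring B]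
    [Algebra k B] (δ : V →ₗ[k] B ⊗[k] W) (c : k) (m : V) (t : H ⊗[k] B) :
    rightTwist ρ δ (c • m) t = c • rightTwist ρ δ m t := by
  induction t with
  | zero => simp
  | add s t hs ht => simp only [map_add, hs, ht, smul_add]
  | tmul x b => simp [rightTwist_tmul]

/-- The coaction of the first kind, followed by `Δ` on `H`. -/
def comulCoact (δ : V →ₗ[k] H ⊗[k] V) : V →ₗ[k] (H ⊗[k] H) ⊗[k] V :=
  LinearMap.rTensor V Q.Δ ∘ₗ δ

theorem coactTwistΔ_eq (δ : V →ₗ[k] H ⊗[k] V) (t : H ⊗[k] (H ⊗[k] H)) (v : V) :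
    Q.coactTwistΔ ρ δ t v =
      TensorProduct.assoc k H H V (rightTwist ρ (Q.comulCoact δ) v t) := by
  induction t with
  | zero => simp
  | add s t hs ht => simp only [map_add, LinearMap.add_apply, hs, ht]
  | tmul x u =>
    rw [rightTwist_tmul, comulCoact, LinearMap.comp_apply, ← LinearMap.comp_apply (f := _),
      ← LinearMap.rTensor_comp]
    simp [coactTwistΔ]

theorem boxAct_assoc (t : H ⊗[k] (H ⊗[k] H)) (z : (H ⊗[k] H) ⊗[k] V) :
    boxAct lreg (boxAct lreg ρ) t (TensorProduct.assoc k H H V z) =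
      TensorProduct.assoc k H H V (act₃ ρ t z) := by
  induction t using tensor₃_induction with
  | zero => simp
  | add s t hs ht => simp only [map_add, LinearMap.add_apply, hs, ht]
  | tmul x y w =>
    induction z with
    | zero => simp
    | add v w hv hw => simp only [map_add, hv, hw]
    | tmul a v =>
      induction a with
      | zero => simp
      | add a b ha hb => simp only [TensorProduct.add_tmul, map_add, ha, hb]
      | tmul a b => simp [act₃_tmul, boxAct_tmul]

theorem rTensor_Δ_coactTwist (δ : V →ₗ[k] H ⊗[k] V) (u : H ⊗[k] H) (v : V) :
    LinearMap.rTensor V Q.Δ (coactTwist ρ δ u v) =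
      rightTwist ρ (Q.comulCoact δ) v (onTail Q.comul u) := by
  induction u with
  | zero => simp
  | add u v hu hv => simp only [map_add, LinearMap.add_apply, hu, hv]
  | tmul p q =>
    have h3 : ∀ w : H ⊗[k] V, LinearMap.rTensor V Q.Δ (rmul V q w) =
        LinearMap.rTensor V (LinearMap.mulRight k (Q.Δ q)) (LinearMap.rTensor V Q.Δ w) := by
      intro w
      induction w with
      | zero => simp
      | add v w hv hw => simp only [map_add, hv, hw]
      | tmul h v => simp
    rw [coactTwist_tmul, h3, Algebra.TensorProduct.map_tmul, rightTwist_tmul]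
    rfl

variable {Q ρ} in
/-- The compatibility of `(Δ ⊗ id) δ` with the actions. -/
theorem IsCompat.comulCoact {δ : V →ₗ[k] H ⊗[k] V} (hδ : Q.IsCompat ρ δ) (h : H) (v : V) :
    boxAct (lregAlong Q.comul) ρ (Q.Δ h) (Q.comulCoact δ v) =
      rightTwist ρ (Q.comulCoact δ) v (onTail Q.comul (Q.Δ h)) := by
  have h1 : ∀ (u : H ⊗[k] H) w, boxAct (lregAlong Q.comul) ρ u (LinearMap.rTensor V Q.Δ w) =
      LinearMap.rTensor V Q.Δ (boxAct lreg ρ u w) := by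
    intro u w
    induction u with
    | zero => simp
    | add u v hu hv => simp only [map_add, LinearMap.add_apply, hu, hv]
    | tmul p q =>
      induction w with
      | zero => simp
      | add v w hv hw => simp only [map_add, hv, hw]
      | tmul h v => simp [boxAct_tmul, Δ]
  rw [QuasiHopfAlgebra.comulCoact, LinearMap.comp_apply, h1, hδ, rTensor_Δ_coactTwist]
  rfl

variable {Q ρ} in
theorem IsCompat.act₃_rightTwist {δ : V →ₗ[k] H ⊗[k] V} (hδ : Q.IsCompat ρ δ) (h : H) (v : V)
    (t : H ⊗[k] (H ⊗[k] H)) :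
    act₃ ρ (Q.Δ12 h) (rightTwist ρ (iterCoact ρ δ Q.φ ∘ₗ δ) v t) =
      rightTwist ρ (iterCoact ρ δ Q.φ ∘ₗ δ) v (Q.Δ21 h * t) := by
  induction t with
  | zero => simp
  | add s t hs ht => simp only [map_add, mul_add, hs, ht]
  | tmul x u =>
    rw [rightTwist_mul_tmul, rightTwist_tmul, act₃_rTensor_mulRight, LinearMap.comp_apply,
      hδ.act₃_iterCoact, Δ12_mul_φ, Δ21]
    congr 1
    generalize ρ x v = v
    induction Q.Δ h with
    | zero => simp
    | add u v hu hv => simp only [map_add, LinearMap.add_apply, mul_add, hu, hv]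
    | tmul p z =>
      rw [comulHead_tmul, iterCoact_mul_app, hδ]
      induction Q.Δ p with
      | zero => simp
      | add u v hu hv => simp only [app_add, map_add, LinearMap.add_apply, hu, hv]
      | tmul a b =>
        rw [coactTwist_tmul, app_tmul, rightTwist_tmul]
        change LinearMap.rTensor V _ (iterCoact ρ δ Q.φ (rmul V b _)) = _
        rw [iterCoact_rmul, ← rTensor_mulRight_mul]
        simp

/-- Coassociativity of the first kind solved for `comulCoact`: the map sending `v` to
`φ⁻¹ · w(φ̄₁ v) · (φ̄₂ ⊗ φ̄₃)`, where `w(v) = φ₁ v_[-1] ⊗ (φ₂ v_[0])_[-1] φ₃ ⊗ (φ₂ v_[0])_[0]`. -/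
def iterCoactψ (δ : V →ₗ[k] H ⊗[k] V) : V →ₗ[k] (H ⊗[k] H) ⊗[k] V where
  toFun v := act₃ ρ Q.ψ (rightTwist ρ (iterCoact ρ δ Q.φ ∘ₗ δ) v Q.ψ)
  map_add' v w := by rw [rightTwist_add, map_add]
  map_smul' c v := by rw [rightTwist_smul, map_smul]; rfl

theorem iterCoactψ_apply (δ : V →ₗ[k] H ⊗[k] V) (v : V) : Q.iterCoactψ ρ δ v =
    act₃ ρ Q.ψ (rightTwist ρ (iterCoact ρ δ Q.φ ∘ₗ δ) v Q.ψ) := rfl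

theorem rightTwist_iterCoactψ (δ : V →ₗ[k] H ⊗[k] V) (v : V) (t : H ⊗[k] (H ⊗[k] H)) :
    rightTwist ρ (Q.iterCoactψ ρ δ) v t =
      act₃ ρ Q.ψ (rightTwist ρ (iterCoact ρ δ Q.φ ∘ₗ δ) v (Q.ψ * t)) := by
  induction t with
  | zero => simp
  | add s t hs ht => simp only [map_add, mul_add, hs, ht]
  | tmul x u =>
    rw [rightTwist_tmul, rightTwist_mul_tmul, act₃_rTensor_mulRight, iterCoactψ_apply]

theorem act₃_act₃ (s t : H ⊗[k] (H ⊗[k] H)) (z : (H ⊗[k] H) ⊗[k] V) :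
    act₃ ρ s (act₃ ρ t z) = act₃ ρ (s * t) z := by
  rw [map_mul]; rfl

variable {Q ρ} in
theorem IsCompat.iterCoactψ {δ : V →ₗ[k] H ⊗[k] V} (hδ : Q.IsCompat ρ δ) (h : H) (v : V) :
    boxAct (lregAlong Q.comul) ρ (Q.Δ h) (Q.iterCoactψ ρ δ v) =
      rightTwist ρ (Q.iterCoactψ ρ δ) v (onTail Q.comul (Q.Δ h)) := by
  rw [← act₃_comulHead, rightTwist_iterCoactψ, iterCoactψ_apply, act₃_act₃]
  change act₃ ρ (Q.Δ21 h * _) _ = act₃ ρ _ (rightTwist ρ _ v (Q.ψ * Q.Δ12 h))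
  rw [← ψ_mul_Δ12, ← act₃_act₃, hδ.act₃_rightTwist, ψ_mul_Δ12]

theorem yd1_of_iterCoactψ {δ : V →ₗ[k] H ⊗[k] V} (h : Q.iterCoactψ ρ δ = Q.comulCoact δ)
    (v : V) : Q.yd1Left ρ δ v = Q.yd1Right ρ δ v := by
  rw [yd1Left_eq, yd1Right]
  change _ = boxAct lreg (boxAct lreg ρ) Q.φ (Q.coactTwistΔ ρ δ Q.φ v)
  rw [coactTwistΔ_eq, boxAct_assoc, ← h, rightTwist_iterCoactψ, act₃_act₃, φ_mul_ψ, map_one,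
    ψ_mul_φ, Algebra.TensorProduct.one_def, rightTwist_tmul]
  simp

end Coassoc

/-- `twistEval` as a bilinear map. -/
def twistEvalₗ {V : Type*} [AddCommGroup V] [Module k V] (ρ : H →ₐ[k] Module.End k V) {B : Type*}
    [Ring B] [Algebra k B] (δ : V →ₗ[k] B) : H ⊗[k] B →ₗ[k] V →ₗ[k] B :=
  LinearMap.flip
    { toFun := twistEval ρ δ
      map_add' := fun m n => LinearMap.ext fun t => twistEval_add_right ρ δ m n t
      map_smul' := fun c m => LinearMap.ext fun t => twistEval_smul_right ρ δ c m t }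

theorem twistEvalₗ_apply {V : Type*} [AddCommGroup V] [Module k V] (ρ : H →ₐ[k] Module.End k V)
    {B : Type*} [Ring B] [Algebra k B] (δ : V →ₗ[k] B) (t : H ⊗[k] B) (m : V) :
    twistEvalₗ ρ δ t m = twistEval ρ δ m t := rfl

/-- The operator attached to `x ⊗ t`: `h ⊗ a ↦ x h ⊗ Δ(U(t₁ ▷ a)) (t₂ ⊗ t₃)`. -/
def ΔuTail : H ⊗[k] (H ⊗[k] (H ⊗[k] H)) →ₗ[k] H ⊗[k] H →ₗ[k] H ⊗[k] (H ⊗[k] H) :=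
  TensorProduct.homTensorHomMap (.id k) H H H (H ⊗[k] H) ∘ₗ
    TensorProduct.map (Algebra.lmul k H).toLinearMap (twistEvalₗ Q.adAct Q.ΔU)

theorem ΔuTail_tmul (x : H) (t : H ⊗[k] (H ⊗[k] H)) (h a : H) :
    Q.ΔuTail (x ⊗ₜ t) (h ⊗ₜ a) = (x * h) ⊗ₜ twistEval Q.adAct Q.ΔU a t := by
  simp [ΔuTail, twistEvalₗ_apply]

/-- The operator attached to `x ⊗ y ⊗ u`: `v ⊗ a ↦ (x ⊗ y) v ⊗ U(u₁ ▷ a) u₂`. -/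
def uTail₄ : H ⊗[k] (H ⊗[k] (H ⊗[k] H)) →ₗ[k] (H ⊗[k] H) ⊗[k] H →ₗ[k] (H ⊗[k] H) ⊗[k] H :=
  TensorProduct.homTensorHomMap (.id k) (H ⊗[k] H) H (H ⊗[k] H) H ∘ₗ
    TensorProduct.map (Algebra.lmul k (H ⊗[k] H)).toLinearMap Q.uTwist ∘ₗ
      (TensorProduct.assoc k H H (H ⊗[k] H)).symm.toLinearMap

theorem uTail₄_tmul (x y : H) (u : H ⊗[k] H) (v : H ⊗[k] H) (a : H) :
    Q.uTail₄ (x ⊗ₜ (y ⊗ₜ u)) (v ⊗ₜ a) = ((x ⊗ₜ y) * v) ⊗ₜ Q.uTwist u a := by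
  simp [uTail₄]

theorem uTail₄_app (w : H ⊗[k] H) (u : H ⊗[k] H) (v : H ⊗[k] H) (a : H) :
    Q.uTail₄ (app w u) (v ⊗ₜ a) = (w * v) ⊗ₜ Q.uTwist u a := by
  induction w with
  | zero => simp
  | add u v hu hv =>
    simp only [app_add, map_add, LinearMap.add_apply, add_mul, TensorProduct.add_tmul, hu, hv]
  | tmul x y => rw [app_tmul, uTail₄_tmul]

theorem uTail₄_d₁ (t : H ⊗[k] (H ⊗[k] H)) (z : (H ⊗[k] H) ⊗[k] H) :
    Q.uTail₄ (Q.d₁ t) z = Q.uTail (lregAlong Q.comul) t z := by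
  induction t with
  | zero => simp
  | add s t hs ht => simp only [map_add, LinearMap.add_apply, hs, ht]
  | tmul x u =>
    induction z with
    | zero => simp
    | add v w hv hw => simp only [map_add, hv, hw]
    | tmul v a => rw [d₁_tmul, uTail₄_app, uTail_tmul]; rfl

theorem uTail₄_mul_padR (s : H ⊗[k] (H ⊗[k] (H ⊗[k] H))) (t : H ⊗[k] (H ⊗[k] H))
    (z : (H ⊗[k] H) ⊗[k] H) :
    Q.uTail₄ (s * padR t) z = Q.uTail₄ s (act₃ Q.adAct t z) := by
  induction t using tensor₃_induction with
  | zero => simp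
  | add s t hs ht => simp only [map_add, mul_add, LinearMap.add_apply, hs, ht]
  | tmul x y w =>
    induction z with
    | zero => simp
    | add v w hv hw => simp only [map_add, hv, hw]
    | tmul v a =>
      induction s using tensor₄_induction with
      | zero => simp
      | add s t hs ht => simp only [map_add, add_mul, LinearMap.add_apply, hs, ht]
      | tmul p q r s => simp [padR_tmul, uTail₄_tmul, act₃_tmul, uTwist_tmul, ← mul_assoc]

theorem uTail₄_d₃_mul (s : H ⊗[k] (H ⊗[k] H)) (t : H ⊗[k] (H ⊗[k] (H ⊗[k] H)))
    (z : (H ⊗[k] H) ⊗[k] H) :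
    TensorProduct.assoc k H H H (Q.uTail₄ (Q.d₃ s * t) z) =
      s * TensorProduct.assoc k H H H (Q.uTail₄ t z) := by
  induction s using tensor₃_induction with
  | zero => simp
  | add s t hs ht => simp only [map_add, add_mul, LinearMap.add_apply, hs, ht]
  | tmul x y w =>
    induction z with
    | zero => simp
    | add v w hv hw => simp only [map_add, mul_add, hv, hw]
    | tmul v a =>
      induction t using tensor₄_induction with
      | zero => simp
      | add s t hs ht => simp only [map_add, mul_add, LinearMap.add_apply, hs, ht]
      | tmul p q r s =>
        rw [d₃_tmul]
        simp only [Algebra.TensorProduct.tmul_mul_tmul, uTail₄_tmul, uTwist_Δ_mul]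
        induction v with
        | zero => simp
        | add v w hv hw => simp only [TensorProduct.add_tmul, map_add, mul_add, hv, hw]
        | tmul c d => simp [mul_assoc]

theorem lTensor_mulRight_eq_mul {B C : Type*} [Ring B] [Algebra k B] [Ring C] [Algebra k C]
    (y : C) (r : B ⊗[k] C) :
    LinearMap.lTensor B (LinearMap.mulRight k y) r = r * (1 ⊗ₜ y) := by
  induction r with
  | zero => simp
  | add r s hr hs => simp only [map_add, add_mul, hr, hs]
  | tmul a b => simp

theorem uTail_φ_app_coactTwist (y z a : H) (u : H ⊗[k] H) :
    Q.uTail lreg (Q.φ * app (Q.Δ y) z) (coactTwist Q.adAct Q.adCoact u a) =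
      twistEval Q.adAct Q.ΔU a (Q.φ * (app (Q.Δ y) z * onTail includeLeft u)) := by
  have h1 : ∀ v : H ⊗[k] H, app v z * onTail (includeLeft : H →ₐ[k] H ⊗[k] H) u =
      onTail (includeLeft : H →ₐ[k] H ⊗[k] H) (v * u) * (1 ⊗ₜ (1 ⊗ₜ z)) := by
    intro v
    induction v with
    | zero => simp
    | add v w hv hw => simp only [app_add, add_mul, map_add, hv, hw]
    | tmul c d =>
      induction u with
      | zero => simp
      | add v w hv hw => simp only [map_add, mul_add, add_mul, hv, hw]
      | tmul e f => simp
  rw [uTail_mul_app, Q.adCoact_isCompat.boxAct_coactTwist, uTail_φ_coactTwist, h1,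
    ← mul_assoc Q.φ, twistEval_mul_tmul, lTensor_mulRight_eq_mul]
  simp

theorem uTail₄_iterCoact (s t : H ⊗[k] (H ⊗[k] H)) (w : H ⊗[k] H) :
    TensorProduct.assoc k H H H (Q.uTail₄ (padL Q.φ * Q.d₂ t)
      (iterCoact Q.adAct Q.adCoact s w)) = Q.ΔuTail (padL Q.φ * Q.d₂ t * padR s) w := by
  induction w with
  | zero => simp
  | add v w hv hw => simp only [map_add, hv, hw]
  | tmul h n =>
    induction s with
    | zero => simp
    | add r s hr hs => simp only [map_add, mul_add, LinearMap.add_apply, hr, hs]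
    | tmul p u =>
      induction t using tensor₃_induction with
      | zero => simp
      | add r s hr hs => simp only [map_add, mul_add, add_mul, LinearMap.add_apply, hr, hs]
      | tmul x y z =>
        have key : ∀ (a : H) (r : H ⊗[k] (H ⊗[k] H)) (w : H ⊗[k] H), TensorProduct.assoc k H H H
            (Q.uTail₄ (x ⊗ₜ r) ((TensorProduct.assoc k H H H).symm (a ⊗ₜ w))) =
              (x * a) ⊗ₜ Q.uTail lreg r w := by
          intro a r w
          induction w with
          | zero => simp
          | add v w hv hw => simp only [map_add, TensorProduct.tmul_add, hv, hw]
          | tmul b c =>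
            induction r with
            | zero => simp
            | add v w hv hw =>
              simp only [map_add, LinearMap.add_apply, TensorProduct.tmul_add, hv, hw]
            | tmul d e => simp [uTail₄_tmul, uTail_tmul]
        have key2 : padR (p ⊗ₜ u) = p ⊗ₜ[k] onTail (includeLeft : H →ₐ[k] H ⊗[k] H) u := by
          simp [padR]
        rw [d₂_tmul, padL_apply, Algebra.TensorProduct.tmul_mul_tmul, iterCoact_tmul, one_mul, key,
          uTail_φ_app_coactTwist, key2, Algebra.TensorProduct.tmul_mul_tmul, ΔuTail_tmul,
          mul_assoc Q.φ, mul_assoc x]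

theorem ΔuTail_d₃_φ_mul_d₁ (t : H ⊗[k] (H ⊗[k] H)) (a : H) :
    Q.ΔuTail (Q.d₃ Q.φ * Q.d₁ t) (Q.adCoact a) =
      twistEval Q.adAct ((onTail Q.comul).toLinearMap ∘ₗ Q.ΔU) a (Q.d₃ Q.φ * Q.d₁ t) := by
  induction t with
  | zero => simp
  | add r s hr hs => simp only [map_add, mul_add, LinearMap.add_apply, hr, hs]
  | tmul y w =>
    have h1 : ∀ s (v : H ⊗[k] H) r, Q.ΔuTail (Q.d₃ s * app v w) r =
        onTail Q.comul (Q.uTail lreg s (boxAct lreg Q.adAct v r)) * (1 ⊗ₜ w) := by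
      intro s v r
      induction v with
      | zero => simp
      | add v w hv hw =>
        simp only [app_add, map_add, LinearMap.add_apply, mul_add, add_mul, hv, hw]
      | tmul c d =>
        induction r with
        | zero => simp
        | add v w hv hw => simp only [map_add, add_mul, hv, hw]
        | tmul h n =>
          induction s using tensor₃_induction with
          | zero => simp
          | add r s hr hs => simp only [map_add, add_mul, LinearMap.add_apply, hr, hs]
          | tmul p q r =>
            simp [d₃_tmul, ΔuTail_tmul, boxAct_tmul, uTail_tmul, uTwist_tmul, twistEval_tmul,
              ΔU, Δ, mul_assoc]
    have h2 : ∀ v : H ⊗[k] H, Q.d₃ Q.φ * app v w =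
        onTail (onTail Q.comul) (Q.φ * onTail (includeLeft : H →ₐ[k] H ⊗[k] H) v) *
          (1 ⊗ₜ (1 ⊗ₜ w)) := by
      intro v
      rw [map_mul, mul_assoc]
      change Q.d₃ Q.φ * _ = Q.d₃ Q.φ * _
      congr 1
      induction v with
      | zero => simp
      | add v w hv hw => simp only [app_add, add_mul, map_add, hv, hw]
      | tmul c d => simp
    rw [d₁_tmul, h1, Q.adCoact_compat, uTail_φ_coactTwist, h2, twistEval_mul_tmul, twistEval_map]
    simp

/-- Both sides are compatible with the action, so they are compared after applying `U` to the last
leg. There the left-hand side is computed by using the characterisation of the coaction twice and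
the pentagon, and the comparison becomes coassociativity of `Δ` at the elements `U(h ▷ a)`. -/
theorem iterCoactψ_adCoact : Q.iterCoactψ Q.adAct Q.adCoact = Q.comulCoact Q.adCoact := by
  refine Q.ext_of_uTail Q.adAct Q.comul Q.adCoact_isCompat.iterCoactψ
    Q.adCoact_isCompat.comulCoact fun a => ?_
  apply (TensorProduct.assoc k H H H).injective
  -- both sides are `(Δ ⊗ id) Δ (U (φ₁ ▷ a)) (Δ(φ₂) ⊗ φ₃)`
  let T : H ⊗[k] (H ⊗[k] (H ⊗[k] H)) →ₗ[k] H ⊗[k] (H ⊗[k] H) :=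
    twistEval Q.adAct ((Q.comulHead H).toLinearMap ∘ₗ Q.ΔU) a
  have hr : TensorProduct.assoc k H H H (Q.uTail (lregAlong Q.comul) Q.φ
      (Q.comulCoact Q.adCoact a)) = T (Q.d₂ Q.φ) := by
    have h1 : ∀ t w, Q.uTail (lregAlong Q.comul) t (LinearMap.rTensor H Q.Δ w) =
        LinearMap.rTensor H Q.Δ (Q.uTail lreg t w) := by
      intro t w
      induction t with
      | zero => simp
      | add r s hr hs => simp only [map_add, LinearMap.add_apply, hr, hs]
      | tmul x u =>
        induction w with
        | zero => simp
        | add v w hv hw => simp only [map_add, hv, hw]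
        | tmul h n => simp [uTail_tmul, Δ]
    rw [comulCoact, LinearMap.comp_apply, h1, uTail_φ_adCoact]
    exact (twistEval_map Q.adAct (Q.comulHead H) Q.ΔU a Q.φ).symm
  have hl : TensorProduct.assoc k H H H (Q.uTail (lregAlong Q.comul) Q.φ
      (Q.iterCoactψ Q.adAct Q.adCoact a)) = T (Q.d₂ Q.φ) := by
    have h1 : ∀ (u : H ⊗[k] (H ⊗[k] (H ⊗[k] H))) (x : H),
        Q.ψ * twistEval Q.adAct ((onTail Q.comul).toLinearMap ∘ₗ Q.ΔU) x u =
          twistEval Q.adAct ((Q.comulHead H).toLinearMap ∘ₗ Q.ΔU) x (padL Q.ψ * u) := by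
      intro u x
      induction u with
      | zero => simp
      | add v w hv hw => simp only [map_add, mul_add, hv, hw]
      | tmul h n =>
        rw [padL_apply, Algebra.TensorProduct.tmul_mul_tmul, twistEval_tmul, twistEval_tmul,
          ← mul_assoc, ← mul_assoc, one_mul]
        congr 1
        exact Q.ψ_mul_Δ12 _
    have h2 : ∀ x, TensorProduct.assoc k H H H (Q.uTail₄ (Q.d₃ Q.ψ * (padL Q.φ * Q.d₂ Q.φ))
        (iterCoact Q.adAct Q.adCoact Q.φ (Q.adCoact x))) =
          twistEval Q.adAct ((Q.comulHead H).toLinearMap ∘ₗ Q.ΔU) x (Q.d₂ Q.φ * padR Q.φ) := by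
      intro x
      rw [uTail₄_d₃_mul, uTail₄_iterCoact, ← pentagon', ΔuTail_d₃_φ_mul_d₁, pentagon', h1]
      simp [mul_assoc]
    have h3 : ∀ s (v : H ⊗[k] H) z, TensorProduct.assoc k H H H (Q.uTail₄ s
        (LinearMap.rTensor H (LinearMap.mulRight k v) z)) =
          TensorProduct.assoc k H H H (Q.uTail₄ s z) * app v 1 := by
      intro s v z
      induction s using tensor₄_induction with
      | zero => simp
      | add r s hr hs => simp only [map_add, add_mul, LinearMap.add_apply, hr, hs]
      | tmul p q r s =>
        induction z with
        | zero => simp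
        | add v w hv hw => simp only [map_add, add_mul, hv, hw]
        | tmul w a =>
          have h5 : ∀ (w v : H ⊗[k] H) (b : H), TensorProduct.assoc k H H H ((w * v) ⊗ₜ b) =
              TensorProduct.assoc k H H H (w ⊗ₜ b) * app v 1 := by
            intro w v b
            induction w with
            | zero => simp
            | add v w hv hw => simp only [TensorProduct.add_tmul, map_add, add_mul, hv, hw]
            | tmul c d =>
              induction v with
              | zero => simp
              | add v w hv hw =>
                simp only [TensorProduct.add_tmul, app_add, map_add, mul_add, hv, hw]
              | tmul e f => simp
          rw [LinearMap.rTensor_tmul, uTail₄_tmul, uTail₄_tmul, LinearMap.mulRight_apply,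
            ← mul_assoc, h5]
    have h4 : ∀ t, TensorProduct.assoc k H H H (Q.uTail₄ (Q.d₃ Q.ψ * (padL Q.φ * Q.d₂ Q.φ))
        (rightTwist Q.adAct (iterCoact Q.adAct Q.adCoact Q.φ ∘ₗ Q.adCoact) a t)) =
          T (Q.d₂ Q.φ * padR Q.φ * padR t) := by
      intro t
      induction t using tensor₃_induction with
      | zero => simp
      | add r s hr hs => simp only [map_add, mul_add, hr, hs]
      | tmul x y z =>
        rw [rightTwist_tmul, h3, LinearMap.comp_apply, h2, padR_tmul, twistEval_mul_tmul, app_tmul]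
    rw [← uTail₄_d₁, iterCoactψ_apply, ← uTail₄_mul_padR, d₁_φ_padR_ψ, mul_assoc, h4, mul_assoc]
    simp
  rw [hl, hr]

/-- Coassociativity of the first kind for `𝐀`. -/
theorem adCoact_coassoc (a : H) :
    Q.yd1Left Q.adAct Q.adCoact a = Q.yd1Right Q.adAct Q.adCoact a :=
  Q.yd1_of_iterCoactψ _ Q.iterCoactψ_adCoact a

/-! ### The coaction on a tensor product -/

section TensorCoact

variable {V : Type*} [AddCommGroup V] [Module k V] {W : Type*} [AddCommGroup W] [Module k W]
  (ρ : H →ₐ[k] Module.End k V) (σ : H →ₐ[k] Module.End k W)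

/-- `v ⊗ x ⊗ w ↦ v_[-1] x ⊗ v_[0] ⊗ w` -/
def coactMul (W : Type*) [AddCommGroup W] [Module k W] (δ : V →ₗ[k] H ⊗[k] V) :
    V ⊗[k] (H ⊗[k] W) →ₗ[k] H ⊗[k] (V ⊗[k] W) :=
  (LinearMap.rTensor (V ⊗[k] W) (LinearMap.mul' k H)) ∘ₗ
    (TensorProduct.tensorTensorTensorComm k H V H W).toLinearMap ∘ₗ LinearMap.rTensor (H ⊗[k] W) δ

/-- `a ⊗ v ↦ a x ⊗ v ⊗ w` -/
def mulMk (V : Type*) [AddCommGroup V] [Module k V] (x : H) (w : W) :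
    H ⊗[k] V →ₗ[k] H ⊗[k] (V ⊗[k] W) :=
  TensorProduct.map (LinearMap.mulRight k x) ((TensorProduct.mk k V W).flip w)

theorem mulMk_tmul (x : H) (w : W) (a : H) (v : V) :
    mulMk V x w (a ⊗ₜ[k] v) = (a * x) ⊗ₜ (v ⊗ₜ w) := by simp [mulMk]

theorem coactMul_tmul (δ : V →ₗ[k] H ⊗[k] V) (v : V) (x : H) (w : W) :
    coactMul W δ (v ⊗ₜ (x ⊗ₜ w)) = mulMk V x w (δ v) := by
  simp only [coactMul, LinearMap.comp_apply, LinearMap.rTensor_tmul]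
  induction δ v with
  | zero => simp
  | add s t hs ht => simp only [TensorProduct.add_tmul, map_add, hs, ht]
  | tmul a b => simp [mulMk]

/-- The operator attached to `x ⊗ u`: `v ⊗ w ↦ x v ⊗ (u₁ w)_[-1] u₂ ⊗ (u₁ w)_[0]`. -/
def actCoact (δ : W →ₗ[k] H ⊗[k] W) :
    H ⊗[k] (H ⊗[k] H) →ₗ[k] V ⊗[k] W →ₗ[k] V ⊗[k] (H ⊗[k] W) :=
  TensorProduct.homTensorHomMap (.id k) V W V (H ⊗[k] W) ∘ₗ
    TensorProduct.map ρ.toLinearMap (coactTwist σ δ)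

theorem actCoact_tmul (δ : W →ₗ[k] H ⊗[k] W) (x : H) (u : H ⊗[k] H) (v : V) (w : W) :
    actCoact ρ σ δ (x ⊗ₜ u) (v ⊗ₜ w) = ρ x v ⊗ₜ coactTwist σ δ u w := by
  simp [actCoact]

theorem tensorCoact₁_apply (δV : V →ₗ[k] H ⊗[k] V) (δW : W →ₗ[k] H ⊗[k] W) (m : V ⊗[k] W) :
    Q.tensorCoact₁ ρ σ δV δW m = boxAct lreg (boxAct ρ σ) Q.φ
      (coactMul W δV (boxAct ρ (boxAct lreg σ) Q.ψ (actCoact ρ σ δW Q.φ m))) := rfl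

variable {Q σ} in
theorem IsCompat.boxAct_actCoact {δ : W →ₗ[k] H ⊗[k] W} (hδ : Q.IsCompat σ δ) (h : H)
    (t : H ⊗[k] (H ⊗[k] H)) (m : V ⊗[k] W) :
    boxAct ρ (boxAct lreg σ) (Q.Δ12 h) (actCoact ρ σ δ t m) =
      actCoact ρ σ δ (Q.Δ12 h * t) m := by
  induction t with
  | zero => simp
  | add s t hs ht => simp only [map_add, LinearMap.add_apply, mul_add, hs, ht]
  | tmul x u =>
    induction m with
    | zero => simp
    | add v w hv hw => simp only [map_add, hv, hw]
    | tmul v w =>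
      rw [Δ12, actCoact_tmul]
      induction Q.Δ h with
      | zero => simp
      | add u v hu hv => simp only [map_add, LinearMap.add_apply, add_mul, hu, hv]
      | tmul p q =>
        have h1 := hδ.boxAct_coactTwist q u w
        simp only [Δ, AlgHom.toLinearMap_apply] at h1
        simp [boxAct_tmul, actCoact_tmul, h1]

theorem actCoact_mul_app (δ : W →ₗ[k] H ⊗[k] W) (t : H ⊗[k] (H ⊗[k] H)) (u : H ⊗[k] H) (z : H)
    (m : V ⊗[k] W) :
    actCoact ρ σ δ (t * app u z) m =
      LinearMap.lTensor V (rmul W z) (actCoact ρ σ δ t (boxAct ρ σ u m)) := by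
  induction u with
  | zero => simp
  | add u v hu hv => simp only [app_add, map_add, LinearMap.add_apply, mul_add, hu, hv]
  | tmul p q =>
    induction t with
    | zero => simp
    | add s t hs ht => simp only [map_add, LinearMap.add_apply, add_mul, hs, ht]
    | tmul x u =>
      induction m with
      | zero => simp
      | add v w hv hw => simp only [map_add, hv, hw]
      | tmul v w => simp [boxAct_tmul, actCoact_tmul, coactTwist_mul_tmul]

theorem boxAct_lTensor_rmul (t : H ⊗[k] (H ⊗[k] H)) (y : H) (z : V ⊗[k] (H ⊗[k] W)) :
    boxAct ρ (boxAct lreg σ) t (LinearMap.lTensor V (rmul W y) z) =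
      LinearMap.lTensor V (rmul W y) (boxAct ρ (boxAct lreg σ) t z) := by
  induction t with
  | zero => simp
  | add s t hs ht => simp only [map_add, LinearMap.add_apply, hs, ht]
  | tmul a u =>
    induction z with
    | zero => simp
    | add s t hs ht => simp only [map_add, hs, ht]
    | tmul v n => simp [boxAct_tmul, boxAct_lreg_rmul]

theorem coactMul_lTensor_rmul (δ : V →ₗ[k] H ⊗[k] V) (y : H) (z : V ⊗[k] (H ⊗[k] W)) :
    coactMul W δ (LinearMap.lTensor V (rmul W y) z) = rmul (V ⊗[k] W) y (coactMul W δ z) := by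
  induction z using tensor₃_induction with
  | zero => simp
  | add s t hs ht => simp only [map_add, hs, ht]
  | tmul v x w =>
    simp only [LinearMap.lTensor_tmul, LinearMap.rTensor_tmul, LinearMap.mulRight_apply,
      coactMul_tmul]
    induction δ v with
    | zero => simp
    | add s t hs ht => simp only [map_add, hs, ht]
    | tmul a b => simp [mulMk_tmul, mul_assoc]

theorem mulMk_boxAct (u : H ⊗[k] H) (z x : H) (w : W) (n : H ⊗[k] V) :
    boxAct lreg (boxAct ρ σ) (app u z) (mulMk V x w n) =
      mulMk V x (σ z w) (boxAct lreg ρ u n) := by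
  induction u with
  | zero => simp
  | add u v hu hv => simp only [app_add, map_add, LinearMap.add_apply, hu, hv]
  | tmul p q =>
    induction n with
    | zero => simp
    | add v w hv hw => simp only [map_add, hv, hw]
    | tmul a b => simp [boxAct_tmul, mulMk_tmul, mul_assoc]

variable {Q ρ} in
theorem IsCompat.boxAct_coactMul {δ : V →ₗ[k] H ⊗[k] V} (hδ : Q.IsCompat ρ δ) (h : H)
    (n : V ⊗[k] (H ⊗[k] W)) :
    boxAct lreg (boxAct ρ σ) (Q.Δ21 h) (coactMul W δ n) =
      coactMul W δ (boxAct ρ (boxAct lreg σ) (Q.Δ21 h) n) := by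
  induction n using tensor₃_induction with
  | zero => simp
  | add s t hs ht => simp only [map_add, hs, ht]
  | tmul v x w =>
    rw [Δ21, coactMul_tmul]
    induction Q.Δ h with
    | zero => simp
    | add u v hu hv => simp only [map_add, LinearMap.add_apply, hu, hv]
    | tmul p q =>
      rw [comulHead_tmul, mulMk_boxAct, hδ]
      induction Q.Δ p with
      | zero => simp
      | add u v hu hv => simp only [app_add, map_add, LinearMap.add_apply, hu, hv]
      | tmul a b =>
        rw [coactTwist_tmul, app_tmul, boxAct_tmul, boxAct_tmul, coactMul_tmul]
        induction δ (ρ a v) with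
        | zero => simp
        | add u v hu hv => simp only [map_add, hu, hv]
        | tmul c d => simp [mulMk_tmul, mul_assoc]

theorem boxAct_boxAct_mul (s t : H ⊗[k] (H ⊗[k] H)) {A B C : Type*} [AddCommGroup A] [Module k A]
    [AddCommGroup B] [Module k B] [AddCommGroup C] [Module k C] (α : H →ₐ[k] Module.End k A)
    (β : H →ₐ[k] Module.End k B) (γ : H →ₐ[k] Module.End k C) (z : A ⊗[k] (B ⊗[k] C)) :
    boxAct α (boxAct β γ) s (boxAct α (boxAct β γ) t z) = boxAct α (boxAct β γ) (s * t) z := by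
  rw [map_mul]; rfl

theorem boxAct_tensorAct (h : H) (n : H ⊗[k] (V ⊗[k] W)) :
    boxAct lreg (Q.tensorAct ρ σ) (Q.Δ h) n = boxAct lreg (boxAct ρ σ) (Q.Δ12 h) n := by
  rw [Δ12]
  induction Q.Δ h with
  | zero => simp
  | add u v hu hv => simp only [map_add, LinearMap.add_apply, hu, hv]
  | tmul p q =>
    induction n with
    | zero => simp
    | add v w hv hw => simp only [map_add, hv, hw]
    | tmul a b => simp [boxAct_tmul, tensorAct_apply, Δ]

variable {Q ρ σ} in
theorem IsCompat.tensorCoact₁ {δV : V →ₗ[k] H ⊗[k] V} {δW : W →ₗ[k] H ⊗[k] W}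
    (hV : Q.IsCompat ρ δV) (hW : Q.IsCompat σ δW) :
    Q.IsCompat (Q.tensorAct ρ σ) (Q.tensorCoact₁ ρ σ δV δW) := by
  intro h m
  rw [boxAct_tensorAct, tensorCoact₁_apply, boxAct_boxAct_mul, Δ12_mul_φ, ← boxAct_boxAct_mul,
    hV.boxAct_coactMul, boxAct_boxAct_mul, ← ψ_mul_Δ12, ← boxAct_boxAct_mul,
    hW.boxAct_actCoact, Δ12_mul_φ, Δ21]
  induction Q.Δ h with
  | zero => simp
  | add u v hu hv => simp only [map_add, LinearMap.add_apply, mul_add, hu, hv]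
  | tmul p q =>
    rw [comulHead_tmul, actCoact_mul_app, boxAct_lTensor_rmul, coactMul_lTensor_rmul,
      coactTwist_tmul, tensorCoact₁_apply, tensorAct_apply, boxAct_lreg_rmul]

end TensorCoact

/-! ### The multiplication of `𝐀` is colinear -/

/-- The operator attached to `s ⊗ t ⊗ u`: `a ⊗ b ↦ Δ(U(s ▷ a)) Δ(U(t ▷ b)) u`. -/
def ΔuuTwist : H ⊗[k] (H ⊗[k] (H ⊗[k] H)) →ₗ[k] H ⊗[k] H →ₗ[k] H ⊗[k] H :=
  LinearMap.llcomp k (H ⊗[k] H) ((H ⊗[k] H) ⊗[k] (H ⊗[k] H)) (H ⊗[k] H)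
    (LinearMap.mul' k (H ⊗[k] H)) ∘ₗ
    TensorProduct.homTensorHomMap (.id k) H H (H ⊗[k] H) (H ⊗[k] H) ∘ₗ
      TensorProduct.map (LinearMap.llcomp k H H (H ⊗[k] H) Q.ΔU ∘ₗ Q.adAct.toLinearMap)
        (twistEvalₗ Q.adAct Q.ΔU)

theorem ΔuuTwist_tmul (s : H) (t : H ⊗[k] (H ⊗[k] H)) (a b : H) :
    Q.ΔuuTwist (s ⊗ₜ t) (a ⊗ₜ b) = Q.ΔU (Q.adAct s a) * twistEval Q.adAct Q.ΔU b t := by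
  simp [ΔuuTwist, twistEvalₗ_apply]

/-- The operator attached to `x ⊗ t`: `h ⊗ a ⊗ b ↦ x h ⊗ U(t₁ ▷ a) U(t₂ ▷ b) t₃`. -/
def uuTail : H ⊗[k] (H ⊗[k] (H ⊗[k] H)) →ₗ[k] H ⊗[k] (H ⊗[k] H) →ₗ[k] H ⊗[k] H :=
  TensorProduct.homTensorHomMap (.id k) H (H ⊗[k] H) H H ∘ₗ
    TensorProduct.map (Algebra.lmul k H).toLinearMap Q.uuTwist

theorem uuTail_tmul (x : H) (t : H ⊗[k] (H ⊗[k] H)) (h : H) (m : H ⊗[k] H) :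
    Q.uuTail (x ⊗ₜ t) (h ⊗ₜ m) = (x * h) ⊗ₜ Q.uuTwist t m := by
  simp [uuTail]

/-- The operator attached to `s ⊗ t`: `a ⊗ h ⊗ b ↦ Δ(U(s ▷ a)) (t₁ h ⊗ U(t₂ ▷ b) t₃)`. -/
def ΔuTwistTail : H ⊗[k] (H ⊗[k] (H ⊗[k] H)) →ₗ[k] H ⊗[k] (H ⊗[k] H) →ₗ[k] H ⊗[k] H :=
  LinearMap.llcomp k (H ⊗[k] (H ⊗[k] H)) ((H ⊗[k] H) ⊗[k] (H ⊗[k] H)) (H ⊗[k] H)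
    (LinearMap.mul' k (H ⊗[k] H)) ∘ₗ
    TensorProduct.homTensorHomMap (.id k) H (H ⊗[k] H) (H ⊗[k] H) (H ⊗[k] H) ∘ₗ
      TensorProduct.map (LinearMap.llcomp k H H (H ⊗[k] H) Q.ΔU ∘ₗ Q.adAct.toLinearMap)
        (Q.uTail lreg)

theorem ΔuTwistTail_tmul (s : H) (t : H ⊗[k] (H ⊗[k] H)) (a : H) (m : H ⊗[k] H) :
    Q.ΔuTwistTail (s ⊗ₜ t) (a ⊗ₜ m) = Q.ΔU (Q.adAct s a) * Q.uTail lreg t m := by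
  simp [ΔuTwistTail]

theorem uTail_φ_adCoact_starMul (m : H ⊗[k] H) :
    Q.uTail lreg Q.φ (Q.adCoact (Q.starMul m)) = Q.ΔuuTwist (Q.d₃ Q.φ * Q.d₁ Q.φ) m := by
  rw [uTail_φ_adCoact]
  have h1 : ∀ t, twistEval Q.adAct Q.ΔU (Q.starMul m) t = Q.ΔuuTwist (Q.d₃ Q.φ * Q.d₁ t) m := by
    intro t
    induction t with
    | zero => simp
    | add s t hs ht => simp only [map_add, LinearMap.add_apply, mul_add, hs, ht]
    | tmul x u =>
      have key : ∀ s (v : H ⊗[k] H), Q.ΔuuTwist (Q.d₃ s * app v u) m =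
          Q.Δ (Q.uuTwist s (boxAct Q.adAct Q.adAct v m)) * u := by
        intro s v
        induction m with
        | zero => simp
        | add m n hm hn => simp only [map_add, add_mul, hm, hn]
        | tmul a b =>
          induction v with
          | zero => simp
          | add v w hv hw =>
            simp only [app_add, map_add, LinearMap.add_apply, mul_add, add_mul, hv, hw]
          | tmul c d =>
            induction s using tensor₃_induction with
            | zero => simp
            | add r s hr hs => simp only [map_add, LinearMap.add_apply, add_mul, hr, hs]
            | tmul p q r =>
              simp [d₃_tmul, ΔuuTwist_tmul, twistEval_tmul, boxAct_tmul, uuTwist_tmul,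
                uTwist_tmul, ΔU, Δ, mul_assoc]
      rw [twistEval_tmul, d₁_tmul, key, ΔU, LinearMap.comp_apply, ← tensorAct_apply,
        ← Q.U_starMul, starMul_act]
  exact h1 _

theorem uTail_lTensor_starMul (t : H ⊗[k] (H ⊗[k] H)) (n : H ⊗[k] (H ⊗[k] H)) :
    Q.uTail lreg t (LinearMap.lTensor H Q.starMul n) = Q.uuTail (padL Q.φ * Q.d₂ t) n := by
  induction t using tensor₃_induction with
  | zero => simp
  | add s t hs ht => simp only [map_add, LinearMap.add_apply, mul_add, hs, ht]
  | tmul x y z =>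
    induction n with
    | zero => simp
    | add m n hm hn => simp only [map_add, hm, hn]
    | tmul h m =>
      rw [LinearMap.lTensor_tmul, uTail_tmul, uTwist_tmul, d₂_tmul, padL_apply,
        Algebra.TensorProduct.tmul_mul_tmul, uuTail_tmul, uuTwist_mul_app, ← tensorAct_apply,
        ← Q.U_starMul, starMul_act]
      simp

theorem uuTail_mul_padR (s : H ⊗[k] (H ⊗[k] (H ⊗[k] H))) (t : H ⊗[k] (H ⊗[k] H))
    (n : H ⊗[k] (H ⊗[k] H)) :
    Q.uuTail (s * padR t) n = Q.uuTail s (boxAct lreg (boxAct Q.adAct Q.adAct) t n) := by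
  induction t using tensor₃_induction with
  | zero => simp
  | add r s hr hs => simp only [map_add, LinearMap.add_apply, mul_add, hr, hs]
  | tmul x y z =>
    induction n using tensor₃_induction with
    | zero => simp
    | add m n hm hn => simp only [map_add, hm, hn]
    | tmul h a b =>
      induction s using tensor₄_induction with
      | zero => simp
      | add r s hr hs => simp only [map_add, LinearMap.add_apply, add_mul, hr, hs]
      | tmul p q r s =>
        simp [padR_tmul, uuTail_tmul, boxAct_tmul, uuTwist_tmul, uTwist_tmul, mul_assoc]

theorem ΔuTwistTail_mul_padR (s : H ⊗[k] (H ⊗[k] (H ⊗[k] H))) (t : H ⊗[k] (H ⊗[k] H))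
    (n : H ⊗[k] (H ⊗[k] H)) :
    Q.ΔuTwistTail (s * padR t) n = Q.ΔuTwistTail s (boxAct Q.adAct (boxAct lreg Q.adAct) t n) := by
  induction t using tensor₃_induction with
  | zero => simp
  | add r s hr hs => simp only [map_add, LinearMap.add_apply, mul_add, hr, hs]
  | tmul x y z =>
    induction n using tensor₃_induction with
    | zero => simp
    | add m n hm hn => simp only [map_add, hm, hn]
    | tmul h a b =>
      induction s using tensor₄_induction with
      | zero => simp
      | add r s hr hs => simp only [map_add, LinearMap.add_apply, add_mul, hr, hs]
      | tmul p q r s =>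
        simp [padR_tmul, ΔuTwistTail_tmul, boxAct_tmul, uTail_tmul, uTwist_tmul, mul_assoc]

theorem uuTail_coactMul (t n : H ⊗[k] (H ⊗[k] H)) :
    Q.uuTail (Q.d₃ Q.φ * Q.d₁ t) (coactMul H Q.adCoact n) =
      Q.ΔuTwistTail (Q.d₃ Q.φ * Q.d₁ t) n := by
  induction t with
  | zero => simp
  | add r s hr hs => simp only [map_add, LinearMap.add_apply, mul_add, hr, hs]
  | tmul x u =>
    induction n using tensor₃_induction with
    | zero => simp
    | add m n hm hn => simp only [map_add, hm, hn]
    | tmul a y b =>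
      have h1 : ∀ s (v w : H ⊗[k] H), Q.uuTail (Q.d₃ s * app v u) (mulMk H y b w) =
          Q.uTail lreg s (boxAct lreg Q.adAct v w) * (y ⊗ₜ Q.uTwist u b) := by
        intro s v w
        induction w with
        | zero => simp
        | add m n hm hn => simp only [map_add, add_mul, hm, hn]
        | tmul h n =>
          induction v with
          | zero => simp
          | add v w hv hw =>
            simp only [app_add, map_add, LinearMap.add_apply, mul_add, add_mul, hv, hw]
          | tmul c d =>
            induction s using tensor₃_induction with
            | zero => simp
            | add r s hr hs => simp only [map_add, LinearMap.add_apply, add_mul, hr, hs]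
            | tmul p q r =>
              rw [d₃_tmul, app_tmul]
              simp only [Algebra.TensorProduct.tmul_mul_tmul, mulMk_tmul, uuTail_tmul,
                uuTwist_tmul, uTwist_Δ_mul, boxAct_tmul, uTail_tmul, uTwist_tmul]
              simp [mul_assoc]
      have h2 : ∀ s (v : H ⊗[k] H), Q.ΔuTwistTail (Q.d₃ s * app v u) (a ⊗ₜ (y ⊗ₜ b)) =
          twistEval Q.adAct Q.ΔU a (s * onTail includeLeft v) * (y ⊗ₜ Q.uTwist u b) := by
        intro s v
        induction v with
        | zero => simp
        | add v w hv hw =>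
          simp only [app_add, map_add, LinearMap.add_apply, mul_add, add_mul, hv, hw]
        | tmul c d =>
          induction s using tensor₃_induction with
          | zero => simp
          | add r s hr hs => simp only [map_add, LinearMap.add_apply, add_mul, hr, hs]
          | tmul p q r =>
            rw [d₃_tmul, app_tmul]
            simp only [Algebra.TensorProduct.tmul_mul_tmul, ΔuTwistTail_tmul, uTwist_Δ_mul,
              uTail_tmul]
            simp [twistEval_tmul, mul_assoc]
      rw [d₁_tmul, coactMul_tmul, h1, h2, Q.adCoact_compat, uTail_φ_coactTwist]

theorem ΔuTwistTail_actCoact (s t : H ⊗[k] (H ⊗[k] H)) (m : H ⊗[k] H) :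
    Q.ΔuTwistTail (padL Q.φ * Q.d₂ t) (actCoact Q.adAct Q.adAct Q.adCoact s m) =
      Q.ΔuuTwist (padL Q.φ * Q.d₂ t * padR s) m := by
  induction m with
  | zero => simp
  | add m n hm hn => simp only [map_add, hm, hn]
  | tmul a b =>
    induction t using tensor₃_induction with
    | zero => simp
    | add r s hr hs => simp only [map_add, LinearMap.add_apply, mul_add, add_mul, hr, hs]
    | tmul x y z =>
      induction s with
      | zero => simp
      | add r s hr hs => simp only [map_add, LinearMap.add_apply, mul_add, hr, hs]
      | tmul p u =>
        have h1 : padR (p ⊗ₜ u) = p ⊗ₜ[k] onTail (includeLeft : H →ₐ[k] H ⊗[k] H) u := by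
          simp [padR]
        rw [actCoact_tmul, d₂_tmul, padL_apply, Algebra.TensorProduct.tmul_mul_tmul,
          ΔuTwistTail_tmul, uTail_φ_app_coactTwist, h1, Algebra.TensorProduct.tmul_mul_tmul,
          ΔuuTwist_tmul, mul_assoc Q.φ]
        simp

/-- The multiplication of `𝐀` preserves the coactions. -/
theorem adCoact_starMul (m : H ⊗[k] H) : Q.adCoact (Q.starMul m) = LinearMap.lTensor H Q.starMul
    (Q.tensorCoact₁ Q.adAct Q.adAct Q.adCoact Q.adCoact m) := by
  have hT := Q.adCoact_isCompat.tensorCoact₁ Q.adCoact_isCompat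
  set T := Q.tensorCoact₁ Q.adAct Q.adAct Q.adCoact Q.adCoact with hT'
  have h1 : ∀ (u : H ⊗[k] H) n, boxAct lreg Q.adAct u (LinearMap.lTensor H Q.starMul n) =
      LinearMap.lTensor H Q.starMul (boxAct lreg (Q.tensorAct Q.adAct Q.adAct) u n) := by
    intro u n
    induction u with
    | zero => simp
    | add u v hu hv => simp only [map_add, LinearMap.add_apply, hu, hv]
    | tmul p q =>
      induction n with
      | zero => simp
      | add v w hv hw => simp only [map_add, hv, hw]
      | tmul a b => simp [boxAct_tmul, starMul_act]
  have hf : ∀ h m, boxAct (lregAlong (AlgHom.id k H)) Q.adAct (Q.Δ h)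
      ((Q.adCoact ∘ₗ Q.starMul) m) = rightTwist (Q.tensorAct Q.adAct Q.adAct)
        (Q.adCoact ∘ₗ Q.starMul) m (onTail (AlgHom.id k H) (Q.Δ h)) := by
    intro h m
    rw [onTail_id]
    refine (Q.adCoact_compat h (Q.starMul m)).trans ?_
    induction Q.Δ h with
    | zero => simp
    | add u v hu hv => simp only [map_add, LinearMap.add_apply, hu, hv]
    | tmul p q => rw [coactTwist_tmul, rightTwist_tmul, ← starMul_act]; rfl
  have hg : ∀ h m, boxAct (lregAlong (AlgHom.id k H)) Q.adAct (Q.Δ h)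
      ((LinearMap.lTensor H Q.starMul ∘ₗ T) m) = rightTwist (Q.tensorAct Q.adAct Q.adAct)
        (LinearMap.lTensor H Q.starMul ∘ₗ T) m (onTail (AlgHom.id k H) (Q.Δ h)) := by
    intro h m
    rw [onTail_id]
    refine (h1 _ _).trans ?_
    rw [hT]
    induction Q.Δ h with
    | zero => simp
    | add u v hu hv => simp only [map_add, LinearMap.add_apply, hu, hv]
    | tmul p q =>
      rw [coactTwist_tmul, rightTwist_tmul, LinearMap.comp_apply]
      generalize T (Q.tensorAct Q.adAct Q.adAct p m) = n
      induction n with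
      | zero => simp
      | add v w hv hw => simp only [map_add, hv, hw]
      | tmul a b => simp
  refine LinearMap.congr_fun (Q.ext_of_uTail _ (AlgHom.id k H) hf hg fun m => ?_) m
  -- after applying `U`, both sides are `a ⊗ b ↦ Δ(U(x ▷ a)) Δ(U(y ▷ b)) (z ⊗ w)`, summed over the
  -- two sides `x ⊗ y ⊗ z ⊗ w` of the pentagon
  refine (Q.uTail_φ_adCoact_starMul m).trans (Eq.trans ?_ (Q.uTail_lTensor_starMul Q.φ (T m)).symm)
  rw [hT', tensorCoact₁_apply, ← uuTail_mul_padR, ← pentagon', uuTail_coactMul,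
    ← ΔuTwistTail_mul_padR, mul_assoc, d₁_φ_padR_ψ]
  have h2 : Q.d₃ Q.φ * (Q.d₃ Q.ψ * padL Q.φ * Q.d₂ Q.φ) = padL Q.φ * Q.d₂ Q.φ := by
    rw [← mul_assoc, ← mul_assoc, ← map_mul, φ_mul_ψ, map_one, one_mul]
  rw [h2, ΔuTwistTail_actCoact, pentagon']

/-! ### The coaction of the second kind of a Yetter–Drinfeld module of the first kind -/

section Second

variable {V : Type*} [AddCommGroup V] [Module k V] (ρ : H →ₐ[k] Module.End k V)

/-- The operator attached to `x ⊗ y ⊗ z`: `a ⊗ b ⊗ v ↦ x a ⊗ y₁ b S(z) ⊗ y₂ v`. -/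
def adBoxTail : H ⊗[k] (H ⊗[k] H) →ₐ[k] Module.End k (H ⊗[k] (H ⊗[k] V)) :=
  boxAct lreg ((Q.adBox ρ).comp (Algebra.TensorProduct.map Q.comul (AlgHom.id k H)))

theorem adBoxTail_tmul (x y z a : H) (n : H ⊗[k] V) :
    Q.adBoxTail ρ (x ⊗ₜ (y ⊗ₜ z)) (a ⊗ₜ n) = (x * a) ⊗ₜ Q.adBox ρ (Q.Δ y ⊗ₜ z) n := by
  simp [adBoxTail, boxAct_tmul, Δ]

theorem adBox_tmul_right (u : H ⊗[k] H) (z : H) (n : H ⊗[k] V) :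
    Q.adBox ρ (u ⊗ₜ z) n = rmul V (Q.S z) (boxAct lreg ρ u n) := by
  induction u with
  | zero => simp
  | add s t hs ht => simp only [TensorProduct.add_tmul, map_add, LinearMap.add_apply, hs, ht]
  | tmul a b =>
    induction n with
    | zero => simp
    | add s t hs ht => simp only [map_add, hs, ht]
    | tmul c v => simp [adBox_tmul, boxAct_tmul]

variable {Q ρ} in
theorem IsCompat.adBox_toSecond {δ : V →ₗ[k] H ⊗[k] V} (hδ : Q.IsCompat ρ δ) (u : H ⊗[k] H)
    (v : V) :
    Q.adBox ρ (Algebra.TensorProduct.map Q.comul (AlgHom.id k H) u) (Q.toSecond ρ δ v) =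
      coactTwist ρ δ (Q.pRMap u) v := by
  induction u with
  | zero => simp
  | add s t hs ht => simp only [map_add, LinearMap.add_apply, hs, ht]
  | tmul x y =>
    have h1 := Q.adBox_tmul_right ρ (Q.Δ x) y (Q.toSecond ρ δ v)
    rw [toSecond, hδ.boxAct_coactTwist] at h1
    rw [pRMap_tmul, coactTwist_mul_tmul, map_one, Module.End.one_apply, ← h1]
    rfl

/-- Compatibility of the second kind. -/
theorem IsCompat.toSecond_act {δ : V →ₗ[k] H ⊗[k] V} (hδ : Q.IsCompat ρ δ) (h : H) (v : V) :
    Q.toSecond ρ δ (ρ h v) = Q.RAct ρ h (Q.toSecond ρ δ v) := by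
  refine Eq.trans ?_ (hδ.adBox_toSecond (Q.Δ h) v).symm
  rw [pRMap_Δ, coactTwist_mul_tmul, toSecond, rmul, LinearMap.mulRight_one, LinearMap.rTensor_id,
    LinearMap.id_apply]

theorem counitLid_coactTwist {δ : V →ₗ[k] H ⊗[k] V}
    (hδ : ∀ v, TensorProduct.lid k V (LinearMap.rTensor V Q.ε (δ v)) = v) (u : H ⊗[k] H) (v : V) :
    TensorProduct.lid k V (LinearMap.rTensor V Q.ε (coactTwist ρ δ u v)) =
      ρ (Q.counitTail u) v := by
  induction u with
  | zero => simp
  | add s t hs ht => simp only [map_add, LinearMap.add_apply, hs, ht]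
  | tmul x y =>
    have h1 : ∀ n : H ⊗[k] V, TensorProduct.lid k V (LinearMap.rTensor V Q.ε (rmul V y n)) =
        Q.counit y • TensorProduct.lid k V (LinearMap.rTensor V Q.ε n) := by
      intro n
      induction n with
      | zero => simp
      | add s t hs ht => simp only [map_add, smul_add, hs, ht]
      | tmul c v => simp [ε, smul_smul, mul_comm]
    rw [coactTwist_tmul, h1, hδ]
    simp

theorem toSecond_counit {δ : V →ₗ[k] H ⊗[k] V}
    (hδ : ∀ v, TensorProduct.lid k V (LinearMap.rTensor V Q.ε (δ v)) = v) (v : V) :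
    TensorProduct.lid k V (LinearMap.rTensor V Q.ε (Q.toSecond ρ δ v)) = v := by
  rw [toSecond, counitLid_coactTwist _ _ hδ, counitTail_pR, map_one, Module.End.one_apply]

variable {Q ρ} in
theorem IsCompat.lTensor_toSecond {δ : V →ₗ[k] H ⊗[k] V} (hδ : Q.IsCompat ρ δ) (n : H ⊗[k] V) :
    LinearMap.lTensor H (Q.toSecond ρ δ) n = Q.adBoxTail ρ Q.φ (TensorProduct.assoc k H H V
      (iterCoact ρ δ (Q.φ * Q.comulHead H Q.pR) n)) := by
  have h1 : ∀ t, TensorProduct.assoc k H H V (iterCoact ρ δ (LinearMap.lTensor H Q.pRMap t) n) =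
      Q.adBoxTail ρ t (LinearMap.lTensor H (Q.toSecond ρ δ) n) := by
    intro t
    induction t with
    | zero => simp
    | add s t hs ht => simp only [map_add, LinearMap.add_apply, hs, ht]
    | tmul x u =>
      induction n with
      | zero => simp
      | add s t hs ht => simp only [map_add, hs, ht]
      | tmul h v =>
        rw [LinearMap.lTensor_tmul, iterCoact_tmul, ← hδ.adBox_toSecond, LinearMap.lTensor_tmul,
          adBoxTail, boxAct_tmul]
        simp
  rw [φ_mul_comulHead_pR, h1, ← Module.End.mul_apply, ← map_mul, φ_mul_ψ, map_one,
    Module.End.one_apply]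

theorem rightTwist_comp_act₃ {δ : V →ₗ[k] (H ⊗[k] H) ⊗[k] V} (s t : H ⊗[k] (H ⊗[k] H)) (v : V)
    {γ : V →ₗ[k] (H ⊗[k] H) ⊗[k] V} (hγ : ∀ v, γ v = act₃ ρ s (rightTwist ρ δ v s)) :
    rightTwist ρ γ v t = act₃ ρ s (rightTwist ρ δ v (s * t)) := by
  induction t with
  | zero => simp
  | add r t hr ht => simp only [map_add, mul_add, hr, ht]
  | tmul x u => rw [rightTwist_tmul, rightTwist_mul_tmul, act₃_rTensor_mulRight, hγ]

variable {Q ρ} in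
theorem IsCompat.iterCoact_coactTwist {δ : V →ₗ[k] H ⊗[k] V} (hδ : Q.IsCompat ρ δ)
    (s : H ⊗[k] (H ⊗[k] H)) (u w : H ⊗[k] H) (v : V) :
    iterCoact ρ δ (s * Q.comulHead H w) (coactTwist ρ δ u v) =
      rightTwist ρ (iterCoact ρ δ s ∘ₗ δ) v (Q.comulHead H w * onTail includeLeft u) := by
  induction w with
  | zero => simp
  | add r t hr ht => simp only [map_add, mul_add, add_mul, LinearMap.add_apply, hr, ht]
  | tmul x y =>
    induction u with
    | zero => simp
    | add r t hr ht => simp only [map_add, mul_add, LinearMap.add_apply, hr, ht]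
    | tmul c d =>
      rw [comulHead_tmul, iterCoact_mul_app, coactTwist_tmul, boxAct_lreg_rmul, iterCoact_rmul,
        hδ]
      induction Q.Δ x with
      | zero => simp
      | add r t hr ht =>
        simp only [app_add, map_add, add_mul, LinearMap.add_apply, hr, ht]
      | tmul a b =>
        have h1 : iterCoact ρ δ s (rmul V b (δ (ρ a (ρ c v)))) = _ := iterCoact_rmul ..
        rw [coactTwist_tmul, h1, ← rTensor_mulRight_mul, ← rTensor_mulRight_mul, app_tmul,
          Algebra.TensorProduct.map_tmul]
        rw [Algebra.TensorProduct.tmul_mul_tmul a (AlgHom.id k H c), rightTwist_tmul]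
        simp

variable {Q ρ} in
theorem IsCompat.act₃_Δ21_rightTwist {δ : V →ₗ[k] H ⊗[k] V} (hδ : Q.IsCompat ρ δ) (h : H)
    (t : H ⊗[k] (H ⊗[k] H)) (v : V) :
    act₃ ρ (Q.Δ21 h) (rightTwist ρ (Q.comulCoact δ) v t) =
      rightTwist ρ (Q.comulCoact δ) v (Q.Δ12 h * t) := by
  induction t with
  | zero => simp
  | add r t hr ht => simp only [map_add, mul_add, hr, ht]
  | tmul x u =>
    rw [rightTwist_mul_tmul, rightTwist_tmul, act₃_rTensor_mulRight, Δ21, act₃_comulHead,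
      hδ.comulCoact]
    rfl

theorem rTensor_mulRight_add (a b : H ⊗[k] H) (z : (H ⊗[k] H) ⊗[k] V) :
    LinearMap.rTensor V (LinearMap.mulRight k (a + b)) z =
      LinearMap.rTensor V (LinearMap.mulRight k a) z +
        LinearMap.rTensor V (LinearMap.mulRight k b) z := by
  have : LinearMap.mulRight k (a + b) = LinearMap.mulRight k a + LinearMap.mulRight k b := by
    apply LinearMap.ext; intro x; simp [mul_add]
  rw [this, LinearMap.rTensor_add, LinearMap.add_apply]

theorem rightMul₂_assoc (e : H ⊗[k] H) (z : (H ⊗[k] H) ⊗[k] V) :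
    rightMul₂ V (TensorProduct.comm k H H e) (TensorProduct.assoc k H H V z) =
      TensorProduct.assoc k H H V (LinearMap.rTensor V (LinearMap.mulRight k e) z) := by
  induction e with
  | zero => simp
  | add r s hr hs => simp only [map_add, LinearMap.add_apply, hr, hs, rTensor_mulRight_add]
  | tmul a b =>
    induction z with
    | zero => simp
    | add r s hr hs => simp only [map_add, hr, hs]
    | tmul u v =>
      induction u with
      | zero => simp
      | add r s hr hs => simp only [TensorProduct.add_tmul, map_add, hr, hs]
      | tmul c d => simp [rightMul₂_tmul]

theorem adBoxTail_assoc (a b c : H) (z : (H ⊗[k] H) ⊗[k] V) :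
    Q.adBoxTail ρ (a ⊗ₜ (b ⊗ₜ c)) (TensorProduct.assoc k H H V z) =
      TensorProduct.assoc k H H V (act₃ ρ (a ⊗ₜ Q.Δ b)
        (LinearMap.rTensor V (LinearMap.mulRight k (1 ⊗ₜ Q.S c)) z)) := by
  induction z with
  | zero => simp
  | add r s hr hs => simp only [map_add, hr, hs]
  | tmul u v =>
    induction u with
    | zero => simp
    | add r s hr hs => simp only [TensorProduct.add_tmul, map_add, hr, hs]
    | tmul d e =>
      rw [TensorProduct.assoc_tmul, adBoxTail_tmul]
      induction Q.Δ b with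
      | zero => simp
      | add r s hr hs =>
        simp only [TensorProduct.add_tmul, TensorProduct.tmul_add, map_add, LinearMap.add_apply,
          hr, hs]
      | tmul p q => simp [adBox_tmul, act₃_tmul, mul_assoc]

/-- The operator `Ω` with `χ` replaced by another element of `H^{⊗4}`. -/
def OmegaAt : H ⊗[k] (H ⊗[k] (H ⊗[k] H)) →ₗ[k] H ⊗[k] (H ⊗[k] V) →ₗ[k] H ⊗[k] (H ⊗[k] V) :=
  LinearMap.mul' k (Module.End k (H ⊗[k] (H ⊗[k] V))) ∘ₗ
    TensorProduct.map (boxAct lreg (boxAct lreg ρ)).toLinearMap (rightMul₂ V) ∘ₗ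
    LinearMap.mulRight k (Q.φ ⊗ₜ[k] (1 : H ⊗[k] H)) ∘ₗ
    LinearMap.mulLeft k
      ((1 : H ⊗[k] (H ⊗[k] H)) ⊗ₜ[k] TensorProduct.comm k H H Q.drinfeldTwistInv) ∘ₗ
    TensorProduct.map (TensorProduct.map LinearMap.id Q.Δ) (TensorProduct.map Q.S Q.S) ∘ₗ
    (TensorProduct.assoc k H H (H ⊗[k] H)).symm.toLinearMap

/-- `Ω` is `OmegaAt` at `χ = (φ ⊗ 1) (Δ ⊗ id ⊗ id)(φ⁻¹)`. -/
theorem Omega_eq (z : H ⊗[k] (H ⊗[k] V)) :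
    Q.Omega ρ z = Q.OmegaAt ρ (padR Q.φ * Q.d₁ Q.ψ) z := by
  rw [← pad_eq, ← Δ1_eq]; rfl

theorem OmegaAt_tmul (x y z w : H) (n : (H ⊗[k] H) ⊗[k] V) :
    Q.OmegaAt ρ (x ⊗ₜ (y ⊗ₜ (z ⊗ₜ w))) (TensorProduct.assoc k H H V n) =
      TensorProduct.assoc k H H V (act₃ ρ ((x ⊗ₜ Q.Δ y) * Q.φ) (LinearMap.rTensor V
        (LinearMap.mulRight k (Q.drinfeldTwistInv * Q.SScop (z ⊗ₜ w))) n)) := by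
  have h1 : ∀ e : H ⊗[k] H, TensorProduct.comm k H H e * (Q.S z ⊗ₜ Q.S w) =
      TensorProduct.comm k H H (e * (Q.S w ⊗ₜ Q.S z)) := by
    intro e
    induction e with
    | zero => simp
    | add r s hr hs => simp only [map_add, add_mul, hr, hs]
    | tmul a b => simp
  simp only [OmegaAt, LinearMap.comp_apply, LinearEquiv.coe_coe, TensorProduct.assoc_symm_tmul,
    TensorProduct.map_tmul, LinearMap.mulLeft_apply, LinearMap.mulRight_apply,
    Algebra.TensorProduct.tmul_mul_tmul, one_mul, mul_one, h1, LinearMap.mul'_apply,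
    Module.End.mul_apply, rightMul₂_assoc, LinearMap.id_apply, SScop_tmul]
  rw [← boxAct_assoc]
  rfl

variable {Q ρ} in
theorem IsCompat.Omega_rightTwist {δ : V →ₗ[k] H ⊗[k] V} (hδ : Q.IsCompat ρ δ) (v : V) :
    Q.Omega ρ (TensorProduct.assoc k H H V
        (rightTwist ρ (Q.comulCoact δ) v (onTail Q.comul Q.pR))) =
      Q.adBoxTail ρ Q.φ (TensorProduct.assoc k H H V
        (act₃ ρ Q.φ (rightTwist ρ (Q.comulCoact δ) v (Q.pRfInvMap Q.ψ)))) := by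
  have h1 : ∀ s (w u : H ⊗[k] H) (n : (H ⊗[k] H) ⊗[k] V),
      Q.OmegaAt ρ (padR s * app w u) (TensorProduct.assoc k H H V n) =
        Q.adBoxTail ρ s (TensorProduct.assoc k H H V (act₃ ρ (onTail Q.comul w * Q.φ)
          (LinearMap.rTensor V (LinearMap.mulRight k (Q.drinfeldTwistInv * Q.SScop u)) n))) := by
    intro s w u n
    induction s using tensor₃_induction with
    | zero => simp
    | add r s hr hs => simp only [map_add, add_mul, LinearMap.add_apply, hr, hs]
    | tmul a b c =>
      induction w with
      | zero => simp
      | add r s hr hs => simp only [app_add, map_add, add_mul, mul_add, LinearMap.add_apply, hr, hs]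
      | tmul p q =>
        rw [app_tmul]
        induction u with
        | zero => simp
        | add r s hr hs =>
          simp only [TensorProduct.tmul_add, map_add, mul_add, LinearMap.add_apply, hr, hs,
            rTensor_mulRight_add]
        | tmul g h =>
          have h2 : Q.drinfeldTwistInv * Q.SScop ((c * g) ⊗ₜ h) =
              Q.drinfeldTwistInv * Q.SScop (g ⊗ₜ h) * (1 ⊗ₜ Q.S c) := by
            simp [SScop_tmul, mul_assoc]
          rw [padR_tmul]
          simp only [Algebra.TensorProduct.tmul_mul_tmul, one_mul]
          rw [OmegaAt_tmul, adBoxTail_assoc, h2, rTensor_mulRight_mul, ← act₃_rTensor_mulRight,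
            act₃_act₃, ← mul_assoc]
          simp [Δ]
  have h2 : ∀ s t, Q.OmegaAt ρ (padR s * Q.d₁ t) (TensorProduct.assoc k H H V
      (rightTwist ρ (Q.comulCoact δ) v (onTail Q.comul Q.pR))) =
        Q.adBoxTail ρ s (TensorProduct.assoc k H H V
          (act₃ ρ Q.φ (rightTwist ρ (Q.comulCoact δ) v (Q.pRfInvMap t)))) := by
    intro s t
    induction t with
    | zero => simp
    | add r t hr ht => simp only [map_add, mul_add, LinearMap.add_apply, hr, ht]
    | tmul x u =>
      rw [d₁_tmul, h1, pRfInvMap_tmul, rightTwist_mul_tmul, map_one, Module.End.one_apply,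
        act₃_rTensor_mulRight, act₃_rTensor_mulRight, ← hδ.act₃_Δ21_rightTwist, act₃_act₃,
        ← Δ12_mul_φ]
      rfl
  rw [Omega_eq, h2]

/-- A Yetter–Drinfeld module of the first kind gives one of the second kind. For coassociativity,
the iterated coaction of the second kind is a first-kind expression at `φ (Δ ⊗ id)(pᴿ) (pᴿ ⊗ 1)`,
and the value of this element found in `φ_mul_comulHead_pR_mul_pR` contains the `𝕗⁻¹` of `Ω`. -/
theorem IsYD₁.toSecond {δ : V →ₗ[k] H ⊗[k] V} (hδ : Q.IsYD₁ ρ δ) :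
    Q.IsYD₂ ρ (Q.toSecond ρ δ) where
  coassoc v := by
    have hc : Q.IsCompat ρ δ := hδ.compat
    have h1 : ∀ v, (iterCoact ρ δ Q.φ ∘ₗ δ) v =
        act₃ ρ Q.φ (rightTwist ρ (Q.comulCoact δ) v Q.φ) := by
      intro v
      have h2 := hδ.coassoc v
      rw [yd1Left_eq, yd1Right] at h2
      change _ = boxAct lreg (boxAct lreg ρ) Q.φ (Q.coactTwistΔ ρ δ Q.φ v) at h2
      rw [coactTwistΔ_eq, boxAct_assoc] at h2
      exact (TensorProduct.assoc k H H V).injective h2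
    rw [hc.lTensor_toSecond, QuasiHopfAlgebra.toSecond, hc.iterCoact_coactTwist,
      rightTwist_comp_act₃ ρ _ _ _ h1, ← mul_assoc, φ_mul_comulHead_pR_mul_pR,
      ← hc.Omega_rightTwist, ← rTensor_Δ_coactTwist]
    rfl
  counit := Q.toSecond_counit ρ hδ.counit
  compat := IsCompat.toSecond_act Q ρ hδ.compat

end Second

/-! ### Naturality of the constructions on coactions -/

section Naturality

variable {V : Type*} [AddCommGroup V] [Module k V] {W : Type*} [AddCommGroup W] [Module k W]
  {V' : Type*} [AddCommGroup V'] [Module k V'] {W' : Type*} [AddCommGroup W'] [Module k W']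
  {ρ : H →ₐ[k] Module.End k V} {σ : H →ₐ[k] Module.End k W}
  {ρ' : H →ₐ[k] Module.End k V'} {σ' : H →ₐ[k] Module.End k W'}

theorem boxAct_map {A B : Type*} [Ring A] [Algebra k A] [Ring B] [Algebra k B]
    {α : A →ₐ[k] Module.End k V} {β : B →ₐ[k] Module.End k W}
    {α' : A →ₐ[k] Module.End k V'} {β' : B →ₐ[k] Module.End k W'}
    {f : V →ₗ[k] V'} {g : W →ₗ[k] W'} (hf : ∀ a v, f (α a v) = α' a (f v))
    (hg : ∀ b w, g (β b w) = β' b (g w)) (t : A ⊗[k] B) (n : V ⊗[k] W) :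
    boxAct α' β' t (TensorProduct.map f g n) = TensorProduct.map f g (boxAct α β t n) := by
  induction t with
  | zero => simp
  | add s t hs ht => simp only [map_add, LinearMap.add_apply, hs, ht]
  | tmul a b =>
    induction n with
    | zero => simp
    | add s t hs ht => simp only [map_add, hs, ht]
    | tmul v w => simp [boxAct_tmul, hf, hg]

theorem coactTwist_map {δ : V →ₗ[k] H ⊗[k] V} {δ' : V' →ₗ[k] H ⊗[k] V'} {f : V →ₗ[k] V'}
    (hf : ∀ a v, f (ρ a v) = ρ' a (f v)) (hδ : ∀ v, δ' (f v) = LinearMap.lTensor H f (δ v))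
    (u : H ⊗[k] H) (v : V) :
    coactTwist ρ' δ' u (f v) = LinearMap.lTensor H f (coactTwist ρ δ u v) := by
  induction u with
  | zero => simp
  | add s t hs ht => simp only [map_add, LinearMap.add_apply, hs, ht]
  | tmul x y =>
    rw [coactTwist_tmul, coactTwist_tmul, ← hf, hδ, ← LinearMap.comp_apply,
      LinearMap.rTensor_comp_lTensor, ← LinearMap.lTensor_comp_rTensor, LinearMap.comp_apply]

theorem toSecond_map {δ : V →ₗ[k] H ⊗[k] V} {δ' : V' →ₗ[k] H ⊗[k] V'} {f : V →ₗ[k] V'}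
    (hf : ∀ a v, f (ρ a v) = ρ' a (f v)) (hδ : ∀ v, δ' (f v) = LinearMap.lTensor H f (δ v))
    (v : V) : Q.toSecond ρ' δ' (f v) = LinearMap.lTensor H f (Q.toSecond ρ δ v) :=
  coactTwist_map hf hδ _ v

theorem adBox_map {f : V →ₗ[k] V'} (hf : ∀ a v, f (ρ a v) = ρ' a (f v))
    (t : (H ⊗[k] H) ⊗[k] H) (n : H ⊗[k] V) :
    Q.adBox ρ' t (LinearMap.lTensor H f n) = LinearMap.lTensor H f (Q.adBox ρ t n) := by
  induction t with
  | zero => simp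
  | add s t hs ht => simp only [map_add, LinearMap.add_apply, hs, ht]
  | tmul u c =>
    induction u with
    | zero => simp
    | add s t hs ht =>
      simp only [TensorProduct.add_tmul, map_add, LinearMap.add_apply, hs, ht]
    | tmul a b =>
      induction n with
      | zero => simp
      | add s t hs ht => simp only [map_add, hs, ht]
      | tmul m v => simp [adBox_tmul, hf]

theorem toFirst_map {δ : V →ₗ[k] H ⊗[k] V} {δ' : V' →ₗ[k] H ⊗[k] V'} {f : V →ₗ[k] V'}
    (hf : ∀ a v, f (ρ a v) = ρ' a (f v)) (hδ : ∀ v, δ' (f v) = LinearMap.lTensor H f (δ v))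
    (v : V) : Q.toFirst ρ' δ' (f v) = LinearMap.lTensor H f (Q.toFirst ρ δ v) := by
  rw [toFirst, LinearMap.comp_apply, hδ, Q.adBox_map hf]
  rfl

theorem RAct_map {f : V →ₗ[k] V'} (hf : ∀ a v, f (ρ a v) = ρ' a (f v)) (h : H) (n : H ⊗[k] V) :
    Q.RAct ρ' h (LinearMap.lTensor H f n) = LinearMap.lTensor H f (Q.RAct ρ h n) :=
  Q.adBox_map hf _ n

theorem RCoact₂_map {f : V →ₗ[k] V'} (hf : ∀ a v, f (ρ a v) = ρ' a (f v)) (n : H ⊗[k] V) :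
    Q.RCoact₂ ρ' (LinearMap.lTensor H f n) =
      LinearMap.lTensor H (LinearMap.lTensor H f) (Q.RCoact₂ ρ n) := by
  have h1 : ∀ n : H ⊗[k] V, TensorProduct.assoc k H H V'
      (LinearMap.rTensor V' Q.Δ (LinearMap.lTensor H f n)) =
        LinearMap.lTensor H (LinearMap.lTensor H f)
          (TensorProduct.assoc k H H V (LinearMap.rTensor V Q.Δ n)) := by
    intro n
    induction n with
    | zero => simp
    | add s t hs ht => simp only [map_add, hs, ht]
    | tmul a v =>
      rw [LinearMap.lTensor_tmul, LinearMap.rTensor_tmul, LinearMap.rTensor_tmul]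
      induction Q.Δ a with
      | zero => simp
      | add s t hs ht => simp only [TensorProduct.add_tmul, map_add, hs, ht]
      | tmul p q => simp
  rw [RCoact₂, RCoact₂]
  simp only [LinearMap.comp_apply, LinearEquiv.coe_coe, h1]
  rw [Omega, Omega]
  generalize TensorProduct.assoc k H H V (LinearMap.rTensor V Q.Δ n) = z
  induction Q.omega with
  | zero => simp
  | add s t hs ht => simp only [map_add, LinearMap.add_apply, hs, ht]
  | tmul t u =>
    have h2 : ∀ z : H ⊗[k] (H ⊗[k] V), rightMul₂ V' u
        (LinearMap.lTensor H (LinearMap.lTensor H f) z) =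
          LinearMap.lTensor H (LinearMap.lTensor H f) (rightMul₂ V u z) := by
      intro z
      induction u with
      | zero => simp
      | add s t hs ht => simp only [map_add, LinearMap.add_apply, hs, ht]
      | tmul a b =>
        induction z using tensor₃_induction with
        | zero => simp
        | add s t hs ht => simp only [map_add, hs, ht]
        | tmul p q v => simp [rightMul₂_tmul]
    simp only [TensorProduct.map_tmul, LinearMap.mul'_apply, Module.End.mul_apply, h2]
    exact boxAct_map (fun _ _ => rfl) (fun b w => (boxAct_map (fun _ _ => rfl) hf b w).symm) _ _

theorem coactMul_map {δ : V →ₗ[k] H ⊗[k] V} {δ' : V' →ₗ[k] H ⊗[k] V'} {f : V →ₗ[k] V'}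
    (g : W →ₗ[k] W') (hδ : ∀ v, δ' (f v) = LinearMap.lTensor H f (δ v))
    (n : V ⊗[k] (H ⊗[k] W)) :
    coactMul W' δ' (TensorProduct.map f (LinearMap.lTensor H g) n) =
      LinearMap.lTensor H (TensorProduct.map f g) (coactMul W δ n) := by
  induction n using tensor₃_induction with
  | zero => simp
  | add s t hs ht => simp only [map_add, hs, ht]
  | tmul v x w =>
    simp only [TensorProduct.map_tmul, LinearMap.lTensor_tmul, coactMul_tmul, hδ]
    induction δ v with
    | zero => simp
    | add s t hs ht => simp only [map_add, hs, ht]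
    | tmul a b => simp [mulMk_tmul]

theorem actCoact_map {δ : W →ₗ[k] H ⊗[k] W} {δ' : W' →ₗ[k] H ⊗[k] W'} {f : V →ₗ[k] V'}
    {g : W →ₗ[k] W'} (hf : ∀ a v, f (ρ a v) = ρ' a (f v)) (hg : ∀ a w, g (σ a w) = σ' a (g w))
    (hδ : ∀ w, δ' (g w) = LinearMap.lTensor H g (δ w)) (t : H ⊗[k] (H ⊗[k] H)) (m : V ⊗[k] W) :
    actCoact ρ' σ' δ' t (TensorProduct.map f g m) =
      TensorProduct.map f (LinearMap.lTensor H g) (actCoact ρ σ δ t m) := by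
  induction t with
  | zero => simp
  | add s t hs ht => simp only [map_add, LinearMap.add_apply, hs, ht]
  | tmul x u =>
    induction m with
    | zero => simp
    | add s t hs ht => simp only [map_add, hs, ht]
    | tmul v w => simp [actCoact_tmul, hf, coactTwist_map hg hδ]

theorem tensorCoact₁_map {δV : V →ₗ[k] H ⊗[k] V} {δV' : V' →ₗ[k] H ⊗[k] V'}
    {δW : W →ₗ[k] H ⊗[k] W} {δW' : W' →ₗ[k] H ⊗[k] W'} {f : V →ₗ[k] V'} {g : W →ₗ[k] W'}
    (hf : ∀ a v, f (ρ a v) = ρ' a (f v)) (hg : ∀ a w, g (σ a w) = σ' a (g w))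
    (hV : ∀ v, δV' (f v) = LinearMap.lTensor H f (δV v))
    (hW : ∀ w, δW' (g w) = LinearMap.lTensor H g (δW w)) (m : V ⊗[k] W) :
    Q.tensorCoact₁ ρ' σ' δV' δW' (TensorProduct.map f g m) =
      LinearMap.lTensor H (TensorProduct.map f g) (Q.tensorCoact₁ ρ σ δV δW m) := by
  rw [tensorCoact₁_apply, tensorCoact₁_apply, actCoact_map hf hg hW]
  have h1 := boxAct_map hf (fun b w => (boxAct_map (α := lreg (k := k) (H := H)) (α' := lreg)
    (f := LinearMap.id) (fun _ _ => rfl) hg b w).symm) Q.ψ (actCoact ρ σ δW Q.φ m)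
  have h2 := boxAct_map (α := lreg (k := k) (H := H)) (α' := lreg) (f := LinearMap.id)
    (fun _ _ => rfl) (fun b w => (boxAct_map hf hg b w).symm) Q.φ
    (coactMul W δV (boxAct ρ (boxAct lreg σ) Q.ψ (actCoact ρ σ δW Q.φ m)))
  refine Eq.trans ?_ h2
  refine congrArg _ (Eq.trans (congrArg _ h1) ?_)
  exact coactMul_map g hV _

theorem tensorAct_map {f : V →ₗ[k] V'} {g : W →ₗ[k] W'}
    (hf : ∀ a v, f (ρ a v) = ρ' a (f v)) (hg : ∀ a w, g (σ a w) = σ' a (g w)) (h : H)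
    (m : V ⊗[k] W) :
    TensorProduct.map f g (Q.tensorAct ρ σ h m) = Q.tensorAct ρ' σ' h (TensorProduct.map f g m) :=
  (boxAct_map hf hg _ m).symm

end Naturality

/-! ### The identification of `R(𝟙)` with `H` -/

theorem rid_adBox_trivAct (u : H ⊗[k] H) (n : H ⊗[k] k) :
    TensorProduct.rid k H
        (Q.adBox Q.trivAct (Algebra.TensorProduct.map Q.comul (AlgHom.id k H) u) n) =
      Q.sandwich u (TensorProduct.rid k H n) := by
  have h1 : ∀ (v : H ⊗[k] H) y, TensorProduct.rid k H (Q.adBox Q.trivAct (v ⊗ₜ y) n) =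
      Q.sandwich (Q.counitTail v ⊗ₜ y) (TensorProduct.rid k H n) := by
    intro v y
    induction v with
    | zero => simp
    | add s t hs ht =>
      simp only [TensorProduct.add_tmul, map_add, LinearMap.add_apply, hs, ht]
    | tmul a b =>
      induction n with
      | zero => simp
      | add s t hs ht => simp only [map_add, hs, ht]
      | tmul m c =>
        simp [adBox_tmul, sandwich_tmul, trivAct, smul_smul, mul_comm, ← TensorProduct.smul_tmul']
  induction u with
  | zero => simp
  | add s t hs ht => simp only [map_add, LinearMap.add_apply, hs, ht]
  | tmul x y =>
    have h2 := h1 (Q.Δ x) y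
    rw [counitTail_Δ] at h2
    exact h2

theorem rid_RAct (h : H) (n : H ⊗[k] k) :
    TensorProduct.rid k H (Q.RAct Q.trivAct h n) = Q.adAct h (TensorProduct.rid k H n) :=
  Q.rid_adBox_trivAct _ n

theorem lTensor_rid_RCoact₂ (n : H ⊗[k] k) :
    LinearMap.lTensor H (TensorProduct.rid k H).toLinearMap (Q.RCoact₂ Q.trivAct n) =
      Q.coactFormula₂ (TensorProduct.rid k H n) := by
  induction n with
  | zero => simp
  | add s t hs ht => simp only [map_add, hs, ht]
  | tmul a c =>
    have h1 : ∀ t (u : H ⊗[k] H), LinearMap.lTensor H (TensorProduct.rid k H).toLinearMap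
        (TensorProduct.assoc k H H k (act₃ Q.trivAct t (u ⊗ₜ c))) =
          c • (onTail Q.counitTail t * u) := by
      intro t u
      induction t using tensor₃_induction with
      | zero => simp
      | add s t hs ht => simp only [map_add, LinearMap.add_apply, add_mul, smul_add, hs, ht]
      | tmul x y z =>
        induction u with
        | zero => simp
        | add s t hs ht =>
          simp only [TensorProduct.add_tmul, map_add, mul_add, smul_add, hs, ht]
        | tmul d e => simp [act₃_tmul, trivAct, smul_smul, mul_comm]
    have h2 : ∀ s, LinearMap.lTensor H (TensorProduct.rid k H).toLinearMap
        (Q.OmegaAt Q.trivAct s (TensorProduct.assoc k H H k (Q.Δ a ⊗ₜ c))) =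
          c • Q.sandwichOI s (Q.ΔfInv a) := by
      intro s
      induction s using tensor₄_induction with
      | zero => simp
      | add s t hs ht => simp only [map_add, LinearMap.add_apply, smul_add, hs, ht]
      | tmul x y z w =>
        have h3 := Q.sandwichOI_app (x ⊗ₜ y) (Q.ΔfInv a) z w
        rw [app_tmul] at h3
        have h4 : onTail Q.counitTail (x ⊗ₜ Q.Δ y) = x ⊗ₜ y := by simp [counitTail_Δ]
        rw [OmegaAt_tmul, LinearMap.rTensor_tmul, h1, h3, map_mul, counit₃_φ, mul_one, h4]
        simp [ΔfInv, SScop_tmul, mul_assoc]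
    rw [RCoact₂]
    simp only [LinearMap.comp_apply, LinearEquiv.coe_coe, LinearMap.rTensor_tmul, Omega_eq, h2,
      coactFormula₂, pad_eq, Δ1_eq, TensorProduct.rid_tmul, map_smul]

theorem lTensor_rid_RCoact₁ (n : H ⊗[k] k) :
    LinearMap.lTensor H (TensorProduct.rid k H).toLinearMap (Q.RCoact₁ Q.trivAct n) =
      Q.adCoact (TensorProduct.rid k H n) := by
  rw [← toFirst_coactFormula₂]
  exact (Q.toFirst_map (f := (TensorProduct.rid k H).toLinearMap) Q.rid_RAct
    (fun v => (Q.lTensor_rid_RCoact₂ v).symm) n).symm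

/-- `x ⊗ a ⊗ b ↦ ε(a) ε(b) x` -/
def counitTail₂ : H ⊗[k] (H ⊗[k] H) →ₐ[k] H := Q.counitTail.comp (onTail Q.counitTail)

theorem counitTail₂_tmul (x y z : H) :
    Q.counitTail₂ (x ⊗ₜ (y ⊗ₜ z)) = (Q.counit y * Q.counit z) • x := by
  simp [counitTail₂, smul_smul, mul_comm]

theorem counit_adAct (h a : H) : Q.counit (Q.adAct h a) = Q.counit h * Q.counit a := by
  have h1 : ∀ u : H ⊗[k] H, Q.counit (Q.sandwich u a) =
      Q.counit (Q.counitTail u) * Q.counit a := by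
    intro u
    induction u with
    | zero => simp
    | add s t hs ht => simp only [map_add, LinearMap.add_apply, add_mul, hs, ht]
    | tmul x y => simp [sandwich_tmul, counit_S]; ring
  rw [adAct_apply, h1, counitTail_Δ]

theorem counitTail_coactTwist (u : H ⊗[k] H) (a : H) :
    Q.counitTail (coactTwist Q.adAct Q.adCoact u a) = Q.uTwist u a := by
  induction u with
  | zero => simp
  | add s t hs ht => simp only [map_add, LinearMap.add_apply, hs, ht]
  | tmul x y =>
    rw [coactTwist_tmul, rTensor_mulRight_eq_mul, map_mul, counitTail_adCoact, uTwist_tmul]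
    simp

theorem counitTail_coactFormula₂ (a : H) : Q.counitTail (Q.coactFormula₂ a) = a := by
  rw [← toSecond_adCoact, toSecond, counitTail_coactTwist, uTwist_apply, twistEval_U_pR]

/-- `v ⊗ x ⊗ w ↦ U(v) x ε(w)` -/
def uCounitTail : H ⊗[k] (H ⊗[k] H) →ₗ[k] H := mulMap Q.U Q.counitTail.toLinearMap

theorem uCounitTail_tmul (v : H) (u : H ⊗[k] H) :
    Q.uCounitTail (v ⊗ₜ u) = Q.U v * Q.counitTail u := by simp [uCounitTail]

/-- `(id ⊗ ε ⊗ ε)` of the coaction on `𝐀 ⊗ 𝐀` is `a ⊗ b ↦ U(φ₁ ▷ a) U(φ₂ ▷ b) φ₃`. -/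
theorem counitTail₂_tensorCoact₁ (m : H ⊗[k] H) :
    Q.counitTail₂ (Q.tensorCoact₁ Q.adAct Q.adAct Q.adCoact Q.adCoact m) = Q.uuTwist Q.φ m := by
  have h1 : ∀ t n, Q.counitTail₂ (boxAct lreg (boxAct Q.adAct Q.adAct) t n) =
      Q.counitTail₂ t * Q.counitTail₂ n := by
    intro t n
    induction t using tensor₃_induction with
    | zero => simp
    | add s t hs ht => simp only [map_add, LinearMap.add_apply, add_mul, hs, ht]
    | tmul x y z =>
      induction n using tensor₃_induction with
      | zero => simp
      | add s t hs ht => simp only [map_add, mul_add, hs, ht]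
      | tmul a b c =>
        simp only [boxAct_tmul, counitTail₂_tmul, counit_adAct]
        simp only [Algebra.coe_lmul_eq_mul, LinearMap.mul_apply', smul_mul_assoc, mul_smul_comm,
          smul_smul]
        congr 1
        ring
  have h2 : ∀ n, Q.counitTail₂ (coactMul H Q.adCoact n) = Q.uCounitTail n := by
    intro n
    induction n using tensor₃_induction with
    | zero => simp
    | add s t hs ht => simp only [map_add, hs, ht]
    | tmul v x w =>
      rw [coactMul_tmul, uCounitTail_tmul, ← counitTail_adCoact]
      induction Q.adCoact v with
      | zero => simp
      | add s t hs ht => simp only [map_add, add_mul, hs, ht]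
      | tmul a b => simp [mulMk_tmul, counitTail₂_tmul, smul_smul, mul_comm]
  have h3 : ∀ t v u, Q.uCounitTail (boxAct Q.adAct (boxAct lreg Q.adAct) t (v ⊗ₜ u)) =
      Q.uTwist (onTail Q.counitTail t) v * Q.counitTail u := by
    intro t v u
    induction t using tensor₃_induction with
    | zero => simp
    | add s t hs ht => simp only [map_add, LinearMap.add_apply, add_mul, hs, ht]
    | tmul x y z =>
      induction u with
      | zero => simp
      | add s t hs ht => simp only [TensorProduct.tmul_add, map_add, mul_add, hs, ht]
      | tmul a b =>
        simp [boxAct_tmul, uCounitTail_tmul, uTwist_tmul, counit_adAct, smul_smul, mul_assoc,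
          mul_comm (Q.counit z)]
  have h4 : ∀ n, Q.uCounitTail (boxAct Q.adAct (boxAct lreg Q.adAct) Q.ψ n) =
      Q.uCounitTail n := by
    intro n
    induction n with
    | zero => simp
    | add s t hs ht => simp only [map_add, hs, ht]
    | tmul v u =>
      rw [h3, counit₃_ψ, uCounitTail_tmul, Algebra.TensorProduct.one_def, uTwist_tmul, map_one,
        Module.End.one_apply, mul_one]
  have h5 : ∀ t, Q.uCounitTail (actCoact Q.adAct Q.adAct Q.adCoact t m) = Q.uuTwist t m := by
    intro t
    induction m with
    | zero => simp
    | add s t hs ht => simp only [map_add, hs, ht]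
    | tmul a b =>
      induction t with
      | zero => simp
      | add s t hs ht => simp only [map_add, LinearMap.add_apply, hs, ht]
      | tmul x u =>
        rw [actCoact_tmul, uCounitTail_tmul, counitTail_coactTwist, uuTwist_tmul]
  rw [tensorCoact₁_apply, h1, h2, h4, h5]
  simp [counitTail₂, counit₃_φ]

theorem counitTail₂_toSecond (m : H ⊗[k] H) :
    Q.counitTail₂ (Q.toSecond (Q.tensorAct Q.adAct Q.adAct)
      (Q.tensorCoact₁ Q.adAct Q.adAct Q.adCoact Q.adCoact) m) = Q.starMul m := by
  rw [starMul_eq, toSecond]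
  induction Q.pR with
  | zero => simp
  | add s t hs ht => simp only [map_add, LinearMap.add_apply, hs, ht]
  | tmul x y =>
    have h1 : ∀ n : H ⊗[k] (H ⊗[k] H), Q.counitTail₂ (rmul (H ⊗[k] H) y n) =
        Q.counitTail₂ n * y := by
      intro n
      induction n using tensor₃_induction with
      | zero => simp
      | add s t hs ht => simp only [map_add, add_mul, hs, ht]
      | tmul a b c => simp [counitTail₂_tmul]
    rw [coactTwist_tmul, h1, counitTail₂_tensorCoact₁, twistEval_tmul]

theorem adjointAlgebra_mul (a b : H) :
    Q.adjointAlgebra.mul (a ⊗ₜ b) = Q.starMul (a ⊗ₜ b) := by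
  have h1 : ∀ w : H ⊗[k] ((H ⊗[k] k) ⊗[k] (H ⊗[k] k)),
      TensorProduct.rid k H (RMap (TensorProduct.lid k k).toLinearMap
        (RMap (TensorProduct.map (Q.RCounit k) (Q.RCounit k)) w)) =
        Q.counitTail₂ (LinearMap.lTensor H (TensorProduct.map (TensorProduct.rid k H).toLinearMap
          (TensorProduct.rid k H).toLinearMap) w) := by
    intro w
    induction w using tensor₃_induction with
    | zero => simp
    | add s t hs ht => simp only [map_add, hs, ht]
    | tmul x m n =>
      induction m with
      | zero => simp
      | add s t hs ht => simp only [TensorProduct.add_tmul, TensorProduct.tmul_add, map_add, hs, ht]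
      | tmul y c =>
        induction n with
        | zero => simp
        | add s t hs ht => simp only [TensorProduct.tmul_add, map_add, hs, ht]
        | tmul z d =>
          simp only [RMap, RCounit, ε, LinearMap.lTensor_tmul, TensorProduct.map_tmul,
            LinearMap.comp_apply, LinearMap.rTensor_tmul, LinearEquiv.coe_coe,
            TensorProduct.lid_tmul, TensorProduct.rid_tmul, counitTail₂_tmul, map_smul,
            smul_eq_mul, AlgHom.toLinearMap_apply]
          congr 1
          ring
  have h2 := fun v => (Q.lTensor_rid_RCoact₁ v).symm
  have h3 := Q.toSecond_map (Q.tensorAct_map (f := (TensorProduct.rid k H).toLinearMap)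
    (g := (TensorProduct.rid k H).toLinearMap) Q.rid_RAct Q.rid_RAct)
    (Q.tensorCoact₁_map Q.rid_RAct Q.rid_RAct h2 h2) ((a ⊗ₜ 1) ⊗ₜ (b ⊗ₜ 1))
  rw [← counitTail₂_toSecond]
  refine (h1 _).trans ?_
  rw [TensorProduct.map_tmul] at h3
  simp only [LinearEquiv.coe_coe, TensorProduct.rid_tmul, one_smul] at h3
  rw [h3]
  rfl

theorem adjointAlgebra_one : Q.adjointAlgebra.one = Q.beta := by
  have h1 : ∀ u, TensorProduct.rid k H (coactTwist Q.trivAct trivCoact₁ u 1) =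
      Q.counitHead H u := by
    intro u
    induction u with
    | zero => simp
    | add s t hs ht => simp only [map_add, LinearMap.add_apply, hs, ht]
    | tmul x y => simp [coactTwist_tmul, trivAct, trivCoact₁]
  rw [← counitHead_pR]
  exact h1 _

theorem adjointAlgebra_act : Q.adjointAlgebra.act = Q.adAct := by
  apply AlgHom.ext
  intro h
  apply LinearMap.ext
  intro a
  refine (Q.rid_RAct h _).trans ?_
  simp

theorem adjointAlgebra_coact₁ : Q.adjointAlgebra.coact₁ = Q.adCoact := by
  apply LinearMap.ext
  intro a
  refine (Q.lTensor_rid_RCoact₁ _).trans ?_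
  simp

theorem adjointAlgebra_coact₂ : Q.adjointAlgebra.coact₂ = Q.coactFormula₂ := by
  apply LinearMap.ext
  intro a
  refine (Q.lTensor_rid_RCoact₂ _).trans ?_
  simp

theorem adjointAlgebra_eq : Q.adjointAlgebra =
    ⟨Q.adAct, Q.adCoact, Q.coactFormula₂, Q.starMul, Q.beta⟩ := by
  rw [← adjointAlgebra_act, ← adjointAlgebra_coact₁, ← adjointAlgebra_coact₂,
    ← adjointAlgebra_one, ← show Q.adjointAlgebra.mul = Q.starMul from
      TensorProduct.ext' Q.adjointAlgebra_mul]

theorem adjointAlgebra_eq_bcpAlgebra : Q.adjointAlgebra = Q.bcpAlgebra := by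
  rw [adjointAlgebra_eq, bcpAlgebra, coactFormula₁_eq, toFirst_coactFormula₂, toSecond_adCoact]

/-! ### The algebra structure and the universal property of `𝐀` -/

theorem adCoact_isYD₁ : Q.IsYD₁ Q.adAct Q.adCoact where
  coassoc := Q.adCoact_coassoc
  counit a := Q.counitHead_adCoact a
  compat := Q.adCoact_compat

theorem adCoact_isYD : Q.IsYD Q.adAct Q.adCoact Q.coactFormula₂ where
  first := Q.adCoact_isYD₁
  second := by rw [← toSecond_adCoact]; exact Q.adCoact_isYD₁.toSecond
  toSecond_eq := Q.toSecond_adCoact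
  toFirst_eq := Q.toFirst_coactFormula₂

theorem adjointAlgebra_isYDAlgebra : Q.IsYDAlgebra Q.adjointAlgebra := by
  rw [adjointAlgebra_eq]
  exact
    { isYD := Q.adCoact_isYD
      mul_hom :=
        { map_act := Q.starMul_act
          map_coact := Q.adCoact_starMul }
      one_hom :=
        { map_act := fun h c => by
            simp [trivAct, adAct_beta, smul_smul, mul_comm]
          map_coact := fun c => by
            simp [trivCoact₁, adCoact_beta, TensorProduct.smul_tmul'] }
      mul_assoc := Q.starMul_assoc
      one_mul := Q.starMul_beta_left
      mul_one := Q.starMul_beta_right }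

section Universal

variable {M : Type*} [AddCommGroup M] [Module k M] {ρ : H →ₐ[k] Module.End k M}
  {δ₁ δ₂ : M →ₗ[k] H ⊗[k] M}

/-- The morphism into `𝐀` attached to a linear form: `m ↦ m_{-1} g(m_0)`; it is `R(g) ∘ η_M` under
`H ⊗ k ≅ H`. -/
def cofreeLift (δ₂ : M →ₗ[k] H ⊗[k] M) (g : M →ₗ[k] k) : M →ₗ[k] H :=
  (TensorProduct.rid k H).toLinearMap ∘ₗ LinearMap.lTensor H g ∘ₗ δ₂

theorem cofreeLift_apply (g : M →ₗ[k] k) (m : M) :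
    cofreeLift δ₂ g m = TensorProduct.rid k H (LinearMap.lTensor H g (δ₂ m)) := rfl

variable {Q}

theorem IsYD.cofreeLift_act (hM : Q.IsYD ρ δ₁ δ₂) {g : M →ₗ[k] k}
    (hg : ∀ h m, g (ρ h m) = Q.counit h * g m) (h : H) (m : M) :
    cofreeLift δ₂ g (ρ h m) = Q.adAct h (cofreeLift δ₂ g m) := by
  rw [cofreeLift_apply, hM.second.compat, cofreeLift_apply, ← rid_RAct,
    ← Q.RAct_map (ρ := ρ) (ρ' := Q.trivAct) hg]

theorem IsYD.coactFormula₂_cofreeLift (hM : Q.IsYD ρ δ₁ δ₂) {g : M →ₗ[k] k}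
    (hg : ∀ h m, g (ρ h m) = Q.counit h * g m) (m : M) :
    Q.coactFormula₂ (cofreeLift δ₂ g m) = LinearMap.lTensor H (cofreeLift δ₂ g) (δ₂ m) := by
  rw [cofreeLift_apply, ← lTensor_rid_RCoact₂, Q.RCoact₂_map (ρ := ρ) (ρ' := Q.trivAct) hg,
    ← hM.second.coassoc]
  simp only [cofreeLift, LinearMap.lTensor_comp, LinearMap.comp_apply]

theorem IsYD.adCoact_cofreeLift (hM : Q.IsYD ρ δ₁ δ₂) {g : M →ₗ[k] k}
    (hg : ∀ h m, g (ρ h m) = Q.counit h * g m) (m : M) :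
    Q.adCoact (cofreeLift δ₂ g m) = LinearMap.lTensor H (cofreeLift δ₂ g) (δ₁ m) := by
  rw [← toFirst_coactFormula₂, ← hM.toFirst_eq]
  exact Q.toFirst_map (hM.cofreeLift_act hg) (hM.coactFormula₂_cofreeLift hg) m

theorem IsYD.counit_cofreeLift (hM : Q.IsYD ρ δ₁ δ₂) (g : M →ₗ[k] k) (m : M) :
    Q.counit (cofreeLift δ₂ g m) = g m := by
  have h1 : ∀ n : H ⊗[k] M, Q.counit (TensorProduct.rid k H (LinearMap.lTensor H g n)) =
      g (TensorProduct.lid k M (LinearMap.rTensor M Q.ε n)) := by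
    intro n
    induction n with
    | zero => simp
    | add s t hs ht => simp only [map_add, hs, ht]
    | tmul a v => simp [ε, mul_comm]
  rw [cofreeLift_apply, h1, hM.second.counit]

/-- Uniqueness: a morphism `G` is recovered from `ε ∘ G`, since `(id ⊗ ε) δ² = id` on `𝐀` and `G`
preserves `δ²`. -/
theorem IsYD.eq_cofreeLift (hM : Q.IsYD ρ δ₁ δ₂) {G : M →ₗ[k] H}
    (hG : IsYDHom ρ Q.adAct δ₁ Q.adCoact G) {g : M →ₗ[k] k} (hg : ∀ m, Q.counit (G m) = g m) :
    G = cofreeLift δ₂ g := by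
  refine LinearMap.ext fun m => ?_
  have h1 := Q.toSecond_map hG.map_act hG.map_coact m
  rw [toSecond_adCoact, hM.toSecond_eq] at h1
  rw [← Q.counitTail_coactFormula₂ (G m), h1, cofreeLift_apply]
  induction δ₂ m with
  | zero => simp
  | add s t hs ht => simp only [map_add, hs, ht]
  | tmul a v => simp [hg]

theorem IsYD.existsUnique_hom (hM : Q.IsYD ρ δ₁ δ₂) {g : M →ₗ[k] k}
    (hg : ∀ h m, g (ρ h m) = Q.counit h * g m) :
    ∃! G : M →ₗ[k] H, IsYDHom ρ Q.adAct δ₁ Q.adCoact G ∧ ∀ m, Q.counit (G m) = g m :=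
  ⟨cofreeLift δ₂ g, ⟨⟨hM.cofreeLift_act hg, hM.adCoact_cofreeLift hg⟩, hM.counit_cofreeLift g⟩,
    fun _ hG => hM.eq_cofreeLift hG.1 hG.2⟩

end Universal

end QuasiHopfAlgebra
end QHopf

end

theorem mainTheorem6 {k : Type u} {H : Type v} [Field k] [Ring H] [Algebra k H]
    (Q : QHopf.QuasiHopfAlgebra k H) :
    -- the element called the inverse of Drinfeld's gauge transformation is its inverse
    (Q.drinfeldTwist * Q.drinfeldTwistInv = 1 ∧ Q.drinfeldTwistInv * Q.drinfeldTwist = 1) ∧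
    -- `𝐀 = R(𝟙)` is an algebra in the category of Yetter-Drinfeld modules
    Q.IsYDAlgebra Q.adjointAlgebra ∧
    -- `𝐀` together with `ε : 𝐀 → 𝟙` is the value at `𝟙` of a right adjoint of the functor
    -- that forgets the coaction
    (∀ (M : Type w) [AddCommGroup M] [Module k M] (ρ : H →ₐ[k] Module.End k M)
      (δ₁ δ₂ : M →ₗ[k] TensorProduct k H M), Q.IsYD ρ δ₁ δ₂ →
      ∀ g : M →ₗ[k] k, (∀ (h : H) (m : M), g (ρ h m) = Q.counit h * g m) →
        ∃! G : M →ₗ[k] H,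
          QHopf.QuasiHopfAlgebra.IsYDHom ρ Q.adjointAlgebra.act δ₁ Q.adjointAlgebra.coact₁ G ∧
            ∀ m : M, Q.counit (G m) = g m) ∧
    -- the explicit formulas
    (∀ h a : H, Q.adjointAlgebra.act h a = Q.sandwich (Q.comul h) a) ∧
    (∀ a : H, Q.adjointAlgebra.coact₁ a = Q.coactFormula₁ a) ∧
    (∀ a : H, Q.adjointAlgebra.coact₂ a = Q.coactFormula₂ a) ∧
    (∀ a b : H, Q.adjointAlgebra.mul (a ⊗ₜ[k] b) = Q.starMul (a ⊗ₜ[k] b)) ∧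
    Q.adjointAlgebra.one = Q.beta ∧
    -- `𝐀` is the Bulacu-Caenepeel-Panaite algebra `H₀`
    Q.adjointAlgebra = Q.bcpAlgebra := by
  refine ⟨⟨Q.drinfeldTwist_mul_inv, Q.drinfeldTwistInv_mul⟩, Q.adjointAlgebra_isYDAlgebra,
    fun M _ _ ρ δ₁ δ₂ hM g hg => ?_, fun h a => ?_, fun a => ?_, fun a => ?_,
    Q.adjointAlgebra_mul, Q.adjointAlgebra_one, Q.adjointAlgebra_eq_bcpAlgebra⟩
  · rw [Q.adjointAlgebra_act, Q.adjointAlgebra_coact₁]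
    exact hM.existsUnique_hom hg
  · rw [Q.adjointAlgebra_act]
    rfl
  · rw [Q.adjointAlgebra_coact₁, Q.coactFormula₁_eq, Q.toFirst_coactFormula₂]
  · rw [Q.adjointAlgebra_coact₂]
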